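/- Let $V:\mathbb R\to[0,\infty)$ be a smooth even function with $0<\delta_-\le V''\le\delta_+<\infty$ and $\delta_- /\delta_+>(3/4)^{1/16}$, and let $\beta,\gamma>0$. On $\Omega=(\mathbb R^2)^{\mathbb Z}$, with configurations $\omega=(p_i,r_i)_{i\in\mathbb Z}$, let $\nu_\beta$ be the product probability measure with marginals proportional to $e^{-\beta(p^2/2+V(r))}\,dp\,dr$, and write $\langle f\rangle=\int f\,d\nu_\beta$, $\langle f,g\rangle=\langle fg\rangle$. Let $\tau_j$ be the shift ($\tau_jp_i=p_{i+j}$, $\tau_jr_i=r_{i+j}$) and put $$Y_{i,j}=p_i\partial_{r_j}-V'(r_j)\partial_{p_i},\qquad X_i=Y_{i,i},\qquad \mathcal E_i=\tfrac{p_i^2}{2}+V(r_i),$$ $$L=\sum_{i\in\mathbb Z}(X_i-Y_{i,i+1})+\frac{\gamma}{2}\sum_{i\in\mathbb Z}\bigl(X_i^2+Y_{i,i+1}^2\bigr).$$ Let $\mathcal C$ be the set of smooth local functions (smooth functions of finitely many coordinates $(p_i,r_i)$) that are compactly supported as functions of these coordinates and have zero $\nu_\beta$-average. Let $\tilde{\mathcal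 C}$ be the set of smooth local $f$ such that $f$, $X_if$, $Y_{i,i+1}f$ lie in $L^2(\nu_\beta)$ for all $i$, and let $\mathcal C_0$ be the linear space of finite sums $\sum_i\bigl(X_iF_i+Y_{i,i+1}G_i\bigr)$ with $F_i,G_i\in\tilde{\mathcal C}$. For $g\in\mathcal C$ let $\Gamma_g=\sum_{j}\tau_jg$ (a formal sum; $X_0\Gamma_g$ and $Y_{0,1}\Gamma_g$ are finite sums), and for $h\in\mathcal C_0$ let $$|\!|\!|h|\!|\!|_{-1}^2=\sup_{g\in\mathcal C,\,a\in\mathbb R}\Bigl\{2\sum_{i}\langle g,\tau_ih\rangle+2a\sum_i i\,\langle h,\mathcal E_i\rangle-\frac\gamma2\bigl\langle(a\,p_0V'(r_1)+Y_{0,1}\Gamma_g)^2\bigr\rangle-\frac\gamma2\bigl\langle(X_0\Gamma_g)^2\bigr\rangle\Bigr\}.$$ Then $Lg\in\mathcal C_0$ for every $g\in\mathcal C$, $p_1^2-p_0^2\in\mathcal C_0$, the supremum is finite for every $h\in\mathcal C_0$, and polarization, $\ll g,h\gg_{-1}=\frac14\bigl(|\!|\!|g+h|\!|\!|_{-1}^2-|\!|\!|g-h|\!|\!|_{-1}^2\bigr)$,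 defines a semi-inner product on $\mathcal C_0$ with semi-norm $|\!|\!|\cdot|\!|\!|_{-1}$. Let $\mathcal H_{-1}$ be the Hilbert space obtained by completing the quotient of $\mathcal C_0$ by the kernel of $|\!|\!|\cdot|\!|\!|_{-1}$, and let $\overline{L\mathcal C}$ be the closure in $\mathcal H_{-1}$ of (the image of) $\{Lg:\ g\in\mathcal C\}$. Then $\overline{L\mathcal C}$ is a linear subspace, $$\mathcal H_{-1}=\overline{L\mathcal C}\oplus\mathbb R\,(p_1^2-p_0^2),$$ and for every $g\in\mathcal C_0$ there is a unique $a\in\mathbb R$ such that $g+a(p_1^2-p_0^2)\in\overline{L\mathcal C}$ in $\mathcal H_{-1}$. -/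

import Mathlib

open MeasureTheory

noncomputable section

namespace EnergyChain

/-- Configurations `ω = (p_i, r_i)_{i ∈ ℤ}`: `(ω i).1 = p_i` and `(ω i).2 = r_i`. -/
abbrev Config : Type := ℤ → ℝ × ℝ

/-- The standing assumptions on the potential `V : ℝ → ℝ₊`. -/
structure IsAdmissible (V : ℝ → ℝ) (δm δp : ℝ) : Prop where
  nonneg : ∀ r, 0 ≤ V r
  smooth : ContDiff ℝ (⊤ : ℕ∞) V
  symm : ∀ r, V (-r) = V r
  pos : 0 < δm
  lower : ∀ r, δm ≤ deriv (deriv V) r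
  upper : ∀ r, deriv (deriv V) r ≤ δp
  ratio : (3 / 4 : ℝ) ^ (1 / 16 : ℝ) < δm / δp

/-! ### The grand canonical measure -/

/-- The partition function `Z_β = ∫ exp (-β V(r)) dr`. -/
def partitionZ (V : ℝ → ℝ) (β : ℝ) : ℝ := ∫ r : ℝ, Real.exp (-β * V r)

/-- The one-site Gibbs measure
`exp (-β (p²/2 + V(r))) / (√(2π/β) Z_β) dp dr` on `ℝ²`. -/
def siteMeasure (V : ℝ → ℝ) (β : ℝ) : Measure (ℝ × ℝ) :=
  (volume : Measure (ℝ × ℝ)).withDensity fun x =>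
    ENNReal.ofReal
      (Real.exp (-β * (x.1 ^ 2 / 2 + V x.2)) / (Real.sqrt (2 * Real.pi * β⁻¹) * partitionZ V β))

theorem IsAdmissible.quadratic_le {V : ℝ → ℝ} {δm δp : ℝ} (hV : IsAdmissible V δm δp) (r : ℝ) :
    δm / 2 * r ^ 2 ≤ V r := by
  have hd : Differentiable ℝ V := hV.smooth.differentiable (by simp)
  have hd2 : Differentiable ℝ (deriv V) := by
    have h1 : ContDiff ℝ (⊤ : ℕ∞) (deriv V) := hV.smooth.iterate_deriv 1
    exact h1.differentiable (by simp)
  have e1 : deriv (fun x => V x - δm / 2 * x ^ 2) = fun x => deriv V x - δm * x := by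
    funext x
    have := (hd x).hasDerivAt.sub (((hasDerivAt_id x).pow 2).const_mul (δm / 2))
    refine (this.congr_deriv ?_).deriv
    simp; ring
  have e2 : deriv (fun x => deriv V x - δm * x) = fun x => deriv (deriv V) x - δm := by
    funext x
    have := (hd2 x).hasDerivAt.sub ((hasDerivAt_id x).const_mul δm)
    refine (this.congr_deriv ?_).deriv
    simp
  have hc : ConvexOn ℝ Set.univ (fun x => V x - δm / 2 * x ^ 2) := by
    refine convexOn_univ_of_deriv2_nonneg (by fun_prop) ?_ ?_
    · rw [e1]; fun_prop
    · intro x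
      simp only [Function.iterate_succ, Function.iterate_zero, Function.comp, id]
      rw [e1, e2]; linarith [hV.lower x]
  have := hc.2 (Set.mem_univ r) (Set.mem_univ (-r)) (show (0 : ℝ) ≤ 1 / 2 by norm_num)
    (show (0 : ℝ) ≤ 1 / 2 by norm_num) (by norm_num)
  simp only [smul_eq_mul] at this
  have e : (1 / 2 : ℝ) * r + 1 / 2 * -r = 0 := by ring
  rw [e, hV.symm r] at this
  have h0 := hV.nonneg 0
  nlinarith

/-- The one-site Gibbs measure is a probability measure, so that `gibbs` is the product measure. -/
theorem isProbabilityMeasure_siteMeasure {V : ℝ → ℝ} {δm δp β : ℝ} (hV : IsAdmissible V δm δp)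
    (hβ : 0 < β) : IsProbabilityMeasure (siteMeasure V β) := by
  have hcont : Continuous V := hV.smooth.continuous
  have hp : 0 < β * (δm / 2) := by have := hV.pos; positivity
  have hiV : Integrable fun r : ℝ => Real.exp (-β * V r) := by
    refine (integrable_exp_neg_mul_sq hp).mono' (by fun_prop) (.of_forall fun r => ?_)
    rw [Real.norm_eq_abs, abs_of_pos (Real.exp_pos _)]
    refine Real.exp_le_exp.2 ?_
    have := mul_le_mul_of_nonneg_left (hV.quadratic_le r) hβ.le
    nlinarith
  have hZ : 0 < partitionZ V β := integral_exp_pos hiV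
  have hig : Integrable fun p : ℝ => Real.exp (-(β / 2) * p ^ 2) :=
    integrable_exp_neg_mul_sq (by positivity)
  have hs : Real.sqrt (2 * Real.pi * β⁻¹) = ∫ p : ℝ, Real.exp (-(β / 2) * p ^ 2) := by
    rw [integral_gaussian]; congr 1; field_simp
  have hs0 : 0 < Real.sqrt (2 * Real.pi * β⁻¹) := by have := Real.pi_pos; positivity
  have hsplit : (fun x : ℝ × ℝ => Real.exp (-β * (x.1 ^ 2 / 2 + V x.2)) /
      (Real.sqrt (2 * Real.pi * β⁻¹) * partitionZ V β)) = fun x : ℝ × ℝ =>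
      (Real.exp (-(β / 2) * x.1 ^ 2) * Real.exp (-β * V x.2)) /
      (Real.sqrt (2 * Real.pi * β⁻¹) * partitionZ V β) := by
    funext x; rw [← Real.exp_add]; congr 2; ring
  refine ⟨?_⟩
  rw [siteMeasure, withDensity_apply _ MeasurableSet.univ, Measure.restrict_univ,
    ← ofReal_integral_eq_lintegral_ofReal]
  · rw [hsplit, integral_div, Measure.volume_eq_prod,
      integral_prod_mul (fun p : ℝ => Real.exp (-(β / 2) * p ^ 2)) fun r => Real.exp (-β * V r),
      ← hs, partitionZ, div_self, ENNReal.ofReal_one]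
    exact (mul_pos hs0 hZ).ne'
  · rw [hsplit, Measure.volume_eq_prod]
    exact (hig.mul_prod hiV).div_const _
  · exact .of_forall fun x => by positivity

/-- The product measure `ν_β` on `(ℝ²)^ℤ`. -/
def gibbs (V : ℝ → ℝ) (β : ℝ) : Measure Config :=
  Measure.infinitePi fun _ : ℤ => siteMeasure V β

/-! ### Shifts, vector fields and generators -/

/-- `(τ_j f)(ω) = f(τ_j ω)` with `(τ_j ω)_i = ω_{i+j}`, so that `τ_j p_i = p_{i+j}`. -/
def shift (j : ℤ) (f : Config → ℝ) : Config → ℝ := fun ω => f fun i => ω (i + j)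

/-- `∂ f / ∂ p_i`. -/
def dp (i : ℤ) (f : Config → ℝ) : Config → ℝ := fun ω =>
  deriv (fun x : ℝ => f (Function.update ω i (x, (ω i).2))) (ω i).1

/-- `∂ f / ∂ r_i`. -/
def dr (i : ℤ) (f : Config → ℝ) : Config → ℝ := fun ω =>
  deriv (fun x : ℝ => f (Function.update ω i ((ω i).1, x))) (ω i).2

/-- `Y_{i,j} = p_i ∂_{r_j} - V'(r_j) ∂_{p_i}`. -/
def Y (V : ℝ → ℝ) (i j : ℤ) (f : Config → ℝ) : Config → ℝ := fun ω =>
  (ω i).1 * dr j f ω - deriv V (ω j).2 * dp i f ω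

/-- `X_i = Y_{i,i}`. -/
def X (V : ℝ → ℝ) (i : ℤ) (f : Config → ℝ) : Config → ℝ := Y V i i f

/-- `A = ∑_i (X_i - Y_{i,i+1})`; on local functions the sum is finite. -/
def opA (V : ℝ → ℝ) (f : Config → ℝ) : Config → ℝ := fun ω =>
  ∑ᶠ i : ℤ, (X V i f ω - Y V i (i + 1) f ω)

/-- `S^γ = (γ/2) ∑_i (X_i² + Y_{i,i+1}²)`; on local functions the sum is finite. -/
def opS (V : ℝ → ℝ) (γ : ℝ) (f : Config → ℝ) : Config → ℝ := fun ω =>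
  γ / 2 * ∑ᶠ i : ℤ, (X V i (X V i f) ω + Y V i (i + 1) (Y V i (i + 1) f) ω)

/-- The generator `L = L^γ = S^γ + A`. -/
def opL (V : ℝ → ℝ) (γ : ℝ) (f : Config → ℝ) : Config → ℝ := opS V γ f + opA V f

/-- The energy `ℰ_i = p_i²/2 + V(r_i)`. -/
def energy (V : ℝ → ℝ) (i : ℤ) : Config → ℝ := fun ω => (ω i).1 ^ 2 / 2 + V (ω i).2

/-! ### Spaces of local functions -/

/-- Smooth local functions: smooth functions of finitely many coordinates. -/
def IsSmoothLocal (f : Config → ℝ) : Prop :=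
  ∃ (Λ : Finset ℤ) (φ : (Λ → ℝ × ℝ) → ℝ), ContDiff ℝ (⊤ : ℕ∞) φ ∧ ∀ ω, f ω = φ fun i => ω i

/-- The set `𝒞` of smooth local functions with compact support (as functions of the finitely many
coordinates on which they depend) and zero average with respect to `ν_β`. -/
def spaceC (V : ℝ → ℝ) (β : ℝ) : Set (Config → ℝ) :=
  {f | (∃ (Λ : Finset ℤ) (φ : (Λ → ℝ × ℝ) → ℝ),
      ContDiff ℝ (⊤ : ℕ∞) φ ∧ HasCompactSupport φ ∧ ∀ ω, f ω = φ fun i => ω i) ∧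
    ∫ ω, f ω ∂(gibbs V β) = 0}

/-- The set `𝒞̃` of smooth local `f` with `f`, `X_i f`, `Y_{i,i+1} f` in `L²(ν_β)` for all `i`. -/
def spaceCTilde (V : ℝ → ℝ) (β : ℝ) : Set (Config → ℝ) :=
  {f | IsSmoothLocal f ∧ MemLp f 2 (gibbs V β) ∧
    ∀ i : ℤ, MemLp (X V i f) 2 (gibbs V β) ∧ MemLp (Y V i (i + 1) f) 2 (gibbs V β)}

/-- The space `𝒞₀` of finite sums `∑_{i ∈ Λ} (X_i F_i + Y_{i,i+1} G_i)` with `F_i`, `G_i` in `𝒞̃`.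
(As `𝒞̃` is a linear space on which the vector fields are linear, these sums are the linear span
of the `X_i F` and the `Y_{i,i+1} G`.) -/
def spaceC0 (V : ℝ → ℝ) (β : ℝ) : Submodule ℝ (Config → ℝ) :=
  Submodule.span ℝ
    {f | ∃ i : ℤ, ∃ F ∈ spaceCTilde V β, f = X V i F ∨ f = Y V i (i + 1) F}

/-- The function `p_1² - p_0²`. -/
def gradP : Config → ℝ := fun ω => (ω 1).1 ^ 2 - (ω 0).1 ^ 2

/-! ### The semi-norm and the Hilbert space `ℋ₋₁` -/

/-- `X_0 Γ_g` for the formal sum `Γ_g = ∑_j τ_j g`. -/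
def XGamma (V : ℝ → ℝ) (g : Config → ℝ) : Config → ℝ := fun ω =>
  ∑ᶠ j : ℤ, X V 0 (shift j g) ω

/-- `Y_{0,1} Γ_g` for the formal sum `Γ_g = ∑_j τ_j g`. -/
def YGamma (V : ℝ → ℝ) (g : Config → ℝ) : Config → ℝ := fun ω =>
  ∑ᶠ j : ℤ, Y V 0 1 (shift j g) ω

/-- `≪ g, h ≫_* = ∑_i ⟨g, τ_i h⟩`. -/
def pairStar (V : ℝ → ℝ) (β : ℝ) (g h : Config → ℝ) : ℝ :=
  ∑ᶠ i : ℤ, ∫ ω, g ω * shift i h ω ∂(gibbs V β)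

/-- `≪ h ≫_{**} = ∑_i i ⟨h, ℰ_i⟩`. -/
def pairStarStar (V : ℝ → ℝ) (β : ℝ) (h : Config → ℝ) : ℝ :=
  ∑ᶠ i : ℤ, (i : ℝ) * ∫ ω, h ω * energy V i ω ∂(gibbs V β)

/-- The set of values over which the supremum defining the squared semi-norm is taken. -/
def variationalSet (V : ℝ → ℝ) (β γ : ℝ) (h : Config → ℝ) : Set ℝ :=
  {x | ∃ g ∈ spaceC V β, ∃ a : ℝ,
    x = 2 * pairStar V β g h + 2 * a * pairStarStar V β h
      - γ / 2 * ∫ ω, (a * ((ω 0).1 * deriv V (ω 1).2) + YGamma V g ω) ^ 2 ∂(gibbs V β)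
      - γ / 2 * ∫ ω, (XGamma V g ω) ^ 2 ∂(gibbs V β)}

/-- The squared semi-norm `|||h|||₋₁²`. -/
def normSq (V : ℝ → ℝ) (β γ : ℝ) (h : Config → ℝ) : ℝ := sSup (variationalSet V β γ h)

/-- The form `≪ g, h ≫₋₁` on `𝒞₀` obtained from `||| · |||₋₁` by polarization. -/
def form (V : ℝ → ℝ) (β γ : ℝ) (g h : spaceC0 V β) : ℝ :=
  1 / 4 * (normSq V β γ ((g + h : spaceC0 V β) : Config → ℝ)
    - normSq V β γ ((g - h : spaceC0 V β) : Config → ℝ))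

/-- A real form is a semi-inner product: symmetric, bilinear and positive semi-definite. -/
structure IsSemiInner {E : Type*} [AddCommGroup E] [Module ℝ E] (B : E → E → ℝ) : Prop where
  symm : ∀ x y, B x y = B y x
  add_left : ∀ x y z, B (x + y) z = B x z + B y z
  smul_left : ∀ (a : ℝ) (x y : E), B (a • x) y = a * B x y
  nonneg : ∀ x, 0 ≤ B x x

/-- A copy of the vector space `E` that carries the semi-norm of the semi-inner product `B`
(and no other topology). -/
def PreHilbert {E : Type*} [AddCommGroup E] [Module ℝ E] {B : E → E → ℝ}
    (_hB : IsSemiInner B) : Type _ := E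

section Completion

variable {E : Type*} [AddCommGroup E] [Module ℝ E] {B : E → E → ℝ} (hB : IsSemiInner B)

instance : AddCommGroup (PreHilbert hB) := inferInstanceAs (AddCommGroup E)

instance : Module ℝ (PreHilbert hB) := inferInstanceAs (Module ℝ E)

/-- The semi-inner product `B` as Mathlib's bundled structure. -/
abbrev preCore : PreInnerProductSpace.Core ℝ (PreHilbert hB) where
  inner x y := B x y
  conj_inner_symm x y := hB.symm y x
  re_inner_nonneg x := hB.nonneg x
  add_left x y z := hB.add_left x y z
  smul_left x y a := hB.smul_left a x y

instance : SeminormedAddCommGroup (PreHilbert hB) :=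
  @InnerProductSpace.Core.toSeminormedAddCommGroup ℝ (PreHilbert hB) _ _ _ (preCore hB)

instance : InnerProductSpace ℝ (PreHilbert hB) := InnerProductSpace.ofCore (preCore hB)

/-- The Hilbert space completion of `E` modulo the kernel of the semi-norm of `B`. -/
abbrev HilbertCompletion : Type _ := UniformSpace.Completion (PreHilbert hB)

/-- The canonical linear map from `E` to the completion. -/
def toCompletion : E →ₗ[ℝ] HilbertCompletion hB :=
  (UniformSpace.Completion.toComplₗᵢ (𝕜 := ℝ) (E := PreHilbert hB)).toLinearMap

end Completion

/-- The Hilbert space `ℋ₋₁`: the completion of `𝒞₀` modulo the kernel of `||| · |||₋₁`. -/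
abbrev HMinusOne (V : ℝ → ℝ) (β γ : ℝ) (hB : IsSemiInner (form V β γ)) : Type :=
  HilbertCompletion hB

/-- The image of `L𝒞 = {L g ; g ∈ 𝒞}` in `ℋ₋₁`. -/
def imageLC (V : ℝ → ℝ) (β γ : ℝ) (hB : IsSemiInner (form V β γ)) :
    Set (HMinusOne V β γ hB) :=
  {x | ∃ g ∈ spaceC V β, ∃ h : spaceC0 V β,
    (h : Config → ℝ) = opL V γ g ∧ x = toCompletion hB h}

end EnergyChain

end

/-!
After integration by parts, the pairings of `h ∈ 𝒞₀` with `Γ_g` and with the energy profile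
`∑ i ℰ_i` are bounded functionals of the pair `(X_0 Γ_g, a p_0 V'(r_1) + Y_{0,1} Γ_g)`, and, up to
a constant, `|||h|||₋₁` is the norm of their Riesz representative in the closure of these pairs in
`L² ⊕ L²`.

Split `L = A + S` into its antisymmetric and symmetric parts. On representatives, `S` is a multiple
of the test pair with `a = 0`, hence its range is complementary to the line spanned by
`p_1² - p_0²`. The Poincaré inequality for functions odd in a momentum, along the one-site
Hamiltonian flow, bounds `A` relative to `S` (a sector condition). An antisymmetric relatively
bounded perturbation does not change the codimension of the closed range, so the decomposition
persists for `L`.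
-/

noncomputable section

namespace EnergyChain

open Filter Topology

/-! ### Calculus -/

section Calculus

variable {E : Type*} [NormedAddCommGroup E] [NormedSpace ℝ E]

/-- The product `u w` is `u² / ℓ`, whose derivative involves no derivative of `w`. -/
theorem hasFDerivAt_mul_of_eq_clm_mul {u w : E → ℝ} {ℓ u' : E →L[ℝ] ℝ} {x : E}
    (huw : ∀ y, u y = ℓ y * w y) (hw : ContinuousAt w x) (hu : HasFDerivAt u u' x) :
    HasFDerivAt (fun y => u y * w y) ((2 * w x) • u' - w x ^ 2 • ℓ) x := by
  have hw0 : (fun y => w y - w x) =o[𝓝 x] fun _ => (1 : ℝ) := by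
    rw [Asymptotics.isLittleO_one_iff, tendsto_sub_nhds_zero_iff]
    exact hw
  have hlin : (fun y => u y - u x - w x * ℓ (y - x)) =O[𝓝 x] fun y => y - x :=
    hu.isBigO_sub.sub ((ℓ.isBigO_sub _ _).const_mul_left _)
  rw [hasFDerivAt_iff_isLittleO]
  have hrem : (fun y => u y * w y - u x * w x - ((2 * w x) • u' - w x ^ 2 • ℓ) (y - x)) =
      fun y => 2 * w x * (u y - u x - u' (y - x)) +
        (w y - w x) * (u y - u x - w x * ℓ (y - x)) := by
    ext y
    simp only [sub_apply, smul_apply, smul_eq_mul, huw, map_sub]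
    ring
  rw [hrem]
  refine (hu.isLittleO.const_mul_left _).add ?_
  simpa only [one_mul, Asymptotics.isLittleO_norm_right] using hw0.mul_isBigO hlin.norm_right

theorem integral_fderiv_apply_eq_zero [FiniteDimensional ℝ E] [MeasurableSpace E] [BorelSpace E]
    (μ : Measure E) [μ.IsAddHaarMeasure] {f : E → ℝ} (hf : ContDiff ℝ 1 f)
    (hc : HasCompactSupport f) (v : E) : ∫ x, fderiv ℝ f x v ∂μ = 0 := by
  have hint : Integrable (fun x => fderiv ℝ f x v) μ :=
    ((hf.continuous_fderiv one_ne_zero).clm_apply continuous_const).integrable_of_hasCompactSupport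
      (hc.fderiv_apply ℝ v)
  simpa using integral_mul_fderiv_eq_neg_fderiv_mul_of_integrable (μ := μ) (f := fun _ => (1 : ℝ))
    (g := f) (v := v) (by simp) (by simpa using hint)
    (by simpa using hf.continuous.integrable_of_hasCompactSupport hc)
    (fun _ _ => differentiableAt_const _) fun x _ => hf.differentiable one_ne_zero x

theorem exists_continuous_eq_fst_mul {u : ℝ × ℝ → ℝ} (hu : ContDiff ℝ 1 u)
    (h0 : ∀ r, u (0, r) = 0) : ∃ w : ℝ × ℝ → ℝ, Continuous w ∧ ∀ x, u x = x.1 * w x := by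
  have hcont : Continuous fun y : (ℝ × ℝ) × ℝ => fderiv ℝ u (y.2 * y.1.1, y.1.2) (1, 0) := by
    have := hu.continuous_fderiv one_ne_zero
    fun_prop
  refine ⟨fun x => ∫ t in (0 : ℝ)..1, fderiv ℝ u (t * x.1, x.2) (1, 0),
    intervalIntegral.continuous_parametric_intervalIntegral_of_continuous' hcont 0 1, fun x => ?_⟩
  have hderiv (t : ℝ) : HasDerivAt (fun s : ℝ => u (s * x.1, x.2))
      (x.1 * fderiv ℝ u (t * x.1, x.2) (1, 0)) t := by
    have hline : HasDerivAt (fun s : ℝ => (s * x.1, x.2)) (x.1 • ((1, 0) : ℝ × ℝ)) t := by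
      simpa using ((hasDerivAt_id t).mul_const x.1).prodMk (hasDerivAt_const t x.2)
    simpa only [map_smul, smul_eq_mul] using!
      (hu.differentiable one_ne_zero (t * x.1, x.2)).hasFDerivAt.comp_hasDerivAt t hline
  have hFTC := intervalIntegral.integral_eq_sub_of_hasDerivAt (fun t _ => hderiv t)
    (Continuous.intervalIntegrable (by fun_prop) 0 1)
  rw [intervalIntegral.integral_const_mul] at hFTC
  simpa [h0] using hFTC.symm

end Calculus

/-! ### Convex potentials -/

/-- Smooth potentials whose second derivative is pinched between two positive constants. -/
structure IsConvexPotential (V : ℝ → ℝ) (δm δp : ℝ) : Prop where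
  smooth : ContDiff ℝ (⊤ : ℕ∞) V
  pos : 0 < δm
  lower : ∀ r, δm ≤ deriv (deriv V) r
  upper : ∀ r, deriv (deriv V) r ≤ δp

theorem IsAdmissible.isConvexPotential {V : ℝ → ℝ} {δm δp : ℝ} (hV : IsAdmissible V δm δp) :
    IsConvexPotential V δm δp :=
  ⟨hV.smooth, hV.pos, hV.lower, hV.upper⟩

namespace IsConvexPotential

variable {V : ℝ → ℝ} {δm δp : ℝ}

theorem contDiff_deriv (hV : IsConvexPotential V δm δp) : ContDiff ℝ (⊤ : ℕ∞) (deriv V) :=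
  hV.smooth.iterate_deriv 1

theorem differentiable (hV : IsConvexPotential V δm δp) : Differentiable ℝ V :=
  hV.smooth.differentiable (by simp)

theorem differentiable_deriv (hV : IsConvexPotential V δm δp) : Differentiable ℝ (deriv V) :=
  hV.contDiff_deriv.differentiable (by simp)

theorem abs_deriv_le (hV : IsConvexPotential V δm δp) (r : ℝ) :
    |deriv V r| ≤ |deriv V 0| + δp * |r| := by
  have hlip : |deriv V r - deriv V 0| ≤ δp * |r - 0| :=
    convex_univ.norm_image_sub_le_of_norm_deriv_le (fun x _ => hV.differentiable_deriv x)
      (fun x _ => by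
        rw [Real.norm_of_nonneg (hV.pos.le.trans (hV.lower x))]
        exact hV.upper x) (Set.mem_univ _) (Set.mem_univ _)
  rw [sub_zero] at hlip
  linarith [abs_sub_abs_le_abs_sub (deriv V r) (deriv V 0)]

theorem tangent_add_sq_le (hV : IsConvexPotential V δm δp) (r : ℝ) :
    V 0 + deriv V 0 * r + δm / 2 * r ^ 2 ≤ V r := by
  have hderiv (x : ℝ) : HasDerivAt (fun x => V x - δm / 2 * x ^ 2) (deriv V x - δm * x) x := by
    refine ((hV.differentiable x).hasDerivAt.sub
      ((hasDerivAt_pow 2 x).const_mul (δm / 2))).congr_deriv ?_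
    push_cast
    ring
  have hderiv2 (x : ℝ) : HasDerivAt (fun x => deriv V x - δm * x) (deriv (deriv V) x - δm) x :=
    ((hV.differentiable_deriv x).hasDerivAt.sub ((hasDerivAt_id x).const_mul δm)).congr_deriv
      (by rw [mul_one])
  have hmono : Monotone fun x => deriv V x - δm * x :=
    monotone_of_deriv_nonneg (fun x => (hderiv2 x).differentiableAt) fun x => by
      rw [(hderiv2 x).deriv]
      exact sub_nonneg.2 (hV.lower x)
  have hconv : ConvexOn ℝ Set.univ fun x => V x - δm / 2 * x ^ 2 := by
    refine MonotoneOn.convexOn_of_deriv convex_univ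
      (fun x _ => (hderiv x).continuousAt.continuousWithinAt)
      (fun x _ => (hderiv x).differentiableAt.differentiableWithinAt) ?_
    simpa only [funext fun x => (hderiv x).deriv] using hmono.monotoneOn _
  rcases lt_trichotomy 0 r with hr | rfl | hr
  · have := hconv.le_slope_of_hasDerivAt trivial trivial hr (hderiv 0)
    rw [slope_def_field, le_div_iff₀ (by linarith)] at this
    linarith
  · simp
  · have := hconv.slope_le_of_hasDerivAt trivial trivial hr (hderiv 0)
    rw [slope_def_field, div_le_iff₀ (by linarith)] at this
    linarith

theorem sq_sub_le (hV : IsConvexPotential V δm δp) (r : ℝ) :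
    δm / 4 * r ^ 2 - (deriv V 0 ^ 2 / δm - V 0) ≤ V r := by
  have hδ := hV.pos
  have hsq : δm / 4 * (r + 2 * deriv V 0 / δm) ^ 2 =
      δm / 4 * r ^ 2 + deriv V 0 * r + deriv V 0 ^ 2 / δm := by
    field_simp
    ring
  nlinarith [hV.tangent_add_sq_le r, mul_nonneg hδ.le (sq_nonneg (r + 2 * deriv V 0 / δm))]

end IsConvexPotential

/-! ### Boltzmann measures -/

/-- The probability measure on `ℝ` with density proportional to `exp (-W)`. -/
def boltzmann (W : ℝ → ℝ) : Measure ℝ :=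
  volume.withDensity fun x => ENNReal.ofReal (Real.exp (-W x) / ∫ y, Real.exp (-W y))

section Boltzmann

variable {W : ℝ → ℝ} {c d : ℝ}

theorem exp_neg_le_of_quadratic_le (h : ∀ x, c * x ^ 2 - d ≤ W x) (x : ℝ) :
    Real.exp (-W x) ≤ Real.exp d * Real.exp (-c * x ^ 2) := by
  rw [← Real.exp_add]
  exact Real.exp_le_exp.2 (by linarith [h x])

theorem integrable_exp_neg_of_quadratic_le (hW : Continuous W) (hc : 0 < c)
    (h : ∀ x, c * x ^ 2 - d ≤ W x) : Integrable fun x => Real.exp (-W x) :=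
  ((integrable_exp_neg_mul_sq hc).const_mul (Real.exp d)).mono' (by fun_prop)
    (.of_forall fun x => (Real.norm_of_nonneg (Real.exp_pos _).le).trans_le
      (exp_neg_le_of_quadratic_le h x))

theorem isProbabilityMeasure_boltzmann (hW : Continuous W) (hc : 0 < c)
    (h : ∀ x, c * x ^ 2 - d ≤ W x) : IsProbabilityMeasure (boltzmann W) := by
  have hint := integrable_exp_neg_of_quadratic_le hW hc h
  have hZ : 0 < ∫ y, Real.exp (-W y) := integral_exp_pos hint
  refine ⟨?_⟩
  rw [boltzmann, withDensity_apply _ MeasurableSet.univ, Measure.restrict_univ,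
    ← ofReal_integral_eq_lintegral_ofReal (hint.div_const _) (.of_forall fun x => by positivity),
    integral_div, div_self hZ.ne', ENNReal.ofReal_one]

theorem memLp_id_boltzmann (hW : Continuous W) (hc : 0 < c)
    (h : ∀ x, c * x ^ 2 - d ≤ W x) {q : ENNReal} (hq : q ≠ ⊤) :
    MemLp (fun x => x) q (boltzmann W) := by
  have := isProbabilityMeasure_boltzmann hW hc h
  obtain ⟨k, hk⟩ := ENNReal.exists_nat_gt hq
  refine MemLp.mono_exponent (q := (k : ENNReal)) ?_ hk.le
  have hk0 : (k : ENNReal) ≠ 0 := (bot_le.trans_lt hk).ne'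
  have : 0 ≤ ∫ y, Real.exp (-W y) := integral_nonneg fun x => (Real.exp_pos _).le
  have hgauss := ((integrable_rpow_mul_exp_neg_mul_sq hc (s := (k : ℝ))
    (neg_one_lt_zero.trans_le k.cast_nonneg)).norm.const_mul (Real.exp d)).div_const
      (∫ y, Real.exp (-W y))
  rw [← integrable_norm_rpow_iff (by fun_prop) hk0 (ENNReal.natCast_ne_top k), boltzmann,
    integrable_withDensity_iff (by fun_prop) (.of_forall fun x => ENNReal.ofReal_lt_top)]
  refine hgauss.mono' (Measurable.aestronglyMeasurable (by fun_prop)) (.of_forall fun x => ?_)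
  have hexp := exp_neg_le_of_quadratic_le h x
  rw [ENNReal.toReal_ofReal (by positivity), ENNReal.toReal_natCast, Real.rpow_natCast,
    Real.rpow_natCast, Real.norm_of_nonneg (by positivity), norm_mul, norm_pow,
    Real.norm_of_nonneg (Real.exp_pos (-c * x ^ 2)).le, mul_left_comm, mul_div_assoc]
  gcongr

end Boltzmann

/-! ### The Hamiltonian vector field of one site -/

/-- The energy of one site with momentum `x.1` and position `x.2`. -/
def siteEnergy (V : ℝ → ℝ) (x : ℝ × ℝ) : ℝ := x.1 ^ 2 / 2 + V x.2

/-- The density of the one-site Gibbs measure with respect to the Lebesgue measure. -/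
def siteDensity (V : ℝ → ℝ) (β : ℝ) (x : ℝ × ℝ) : ℝ :=
  Real.exp (-β * siteEnergy V x) / (Real.sqrt (2 * Real.pi * β⁻¹) * partitionZ V β)

/-- The derivative of `u` along the Hamiltonian vector field `p ∂_r - V'(r) ∂_p` of one site: the
one-site version of the fields `X_i`. -/
def hamiltonianDeriv (V : ℝ → ℝ) (u : ℝ × ℝ → ℝ) (x : ℝ × ℝ) : ℝ :=
  fderiv ℝ u x (-deriv V x.2, x.1)

/-- Smooth truncations to low energies. Being functions of the energy, they are constant along the
Hamiltonian flow. -/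
def energyCutoff (V : ℝ → ℝ) (n : ℕ) (x : ℝ × ℝ) : ℝ :=
  Real.smoothTransition (n - siteEnergy V x)

/-- Reversal of the momentum. -/
def flip (x : ℝ × ℝ) : ℝ × ℝ := (-x.1, x.2)

section OneSite

variable {V : ℝ → ℝ} {δm δp β : ℝ}

theorem hamiltonianDeriv_eq (u : ℝ × ℝ → ℝ) (x : ℝ × ℝ) :
    hamiltonianDeriv V u x = x.1 * fderiv ℝ u x (0, 1) - deriv V x.2 * fderiv ℝ u x (1, 0) := by
  have hfield : ((-deriv V x.2, x.1) : ℝ × ℝ) = x.1 • (0, 1) - deriv V x.2 • (1, 0) := by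
    ext <;> simp
  rw [hamiltonianDeriv, hfield, map_sub, map_smul, map_smul, smul_eq_mul, smul_eq_mul]

theorem hamiltonianDeriv_mul {u v : ℝ × ℝ → ℝ} {x : ℝ × ℝ} (hu : DifferentiableAt ℝ u x)
    (hv : DifferentiableAt ℝ v x) :
    hamiltonianDeriv V (fun y => u y * v y) x =
      hamiltonianDeriv V u x * v x + u x * hamiltonianDeriv V v x := by
  simp only [hamiltonianDeriv, fderiv_fun_mul hu hv, add_apply, smul_apply, smul_eq_mul]
  ring

theorem hamiltonianDeriv_comp {φ : ℝ → ℝ} {u : ℝ × ℝ → ℝ} {x : ℝ × ℝ}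
    (hφ : DifferentiableAt ℝ φ (u x)) (hu : DifferentiableAt ℝ u x) :
    hamiltonianDeriv V (fun y => φ (u y)) x = deriv φ (u x) * hamiltonianDeriv V u x := by
  have hcomp := (hφ.hasDerivAt.comp_hasFDerivAt x hu.hasFDerivAt).fderiv
  simpa only [hamiltonianDeriv, smul_apply, smul_eq_mul] using! congr($hcomp (-deriv V x.2, x.1))

theorem hamiltonianDeriv_siteEnergy (hV : Differentiable ℝ V) (x : ℝ × ℝ) :
    hamiltonianDeriv V (siteEnergy V) x = 0 := by
  have hE : HasFDerivAt (siteEnergy V)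
      (x.1 • ContinuousLinearMap.fst ℝ ℝ ℝ + deriv V x.2 • ContinuousLinearMap.snd ℝ ℝ ℝ) x := by
    have hp : HasDerivAt (fun p : ℝ => p ^ 2 / 2) x.1 x.1 := by
      simpa using (hasDerivAt_pow 2 x.1).div_const 2
    exact (hp.comp_hasFDerivAt x hasFDerivAt_fst).add
      ((hV x.2).hasDerivAt.comp_hasFDerivAt x hasFDerivAt_snd)
  rw [hamiltonianDeriv, hE.fderiv]
  simp [mul_comm]

theorem continuous_hamiltonianDeriv (hV : Continuous (deriv V)) {u : ℝ × ℝ → ℝ}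
    (hu : ContDiff ℝ 1 u) : Continuous (hamiltonianDeriv V u) := by
  have := hu.continuous_fderiv one_ne_zero
  unfold hamiltonianDeriv
  fun_prop

theorem IsConvexPotential.contDiff_siteEnergy (hV : IsConvexPotential V δm δp) :
    ContDiff ℝ (⊤ : ℕ∞) (siteEnergy V) :=
  ((contDiff_fst.pow 2).div_const 2).add (hV.smooth.comp contDiff_snd)

theorem IsConvexPotential.contDiff_siteDensity (hV : IsConvexPotential V δm δp) :
    ContDiff ℝ (⊤ : ℕ∞) (siteDensity V β) :=
  (contDiff_const.mul hV.contDiff_siteEnergy).exp.div_const _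

theorem siteDensity_nonneg (x : ℝ × ℝ) : 0 ≤ siteDensity V β x := by
  have : 0 ≤ partitionZ V β := integral_nonneg fun r => (Real.exp_pos _).le
  unfold siteDensity
  positivity

theorem hamiltonianDeriv_siteDensity (hV : IsConvexPotential V δm δp) (x : ℝ × ℝ) :
    hamiltonianDeriv V (siteDensity V β) x = 0 := by
  have hE : DifferentiableAt ℝ (siteEnergy V) x := hV.contDiff_siteEnergy.differentiable (by simp) x
  exact (hamiltonianDeriv_comp (φ := fun e => Real.exp (-β * e) /
    (Real.sqrt (2 * Real.pi * β⁻¹) * partitionZ V β)) (by fun_prop) hE).trans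
    (by rw [hamiltonianDeriv_siteEnergy hV.differentiable, mul_zero])

theorem integral_siteMeasure (hV : IsConvexPotential V δm δp) (f : ℝ × ℝ → ℝ) :
    ∫ x, f x ∂(siteMeasure V β) = ∫ x, f x * siteDensity V β x := by
  refine (integral_withDensity_eq_integral_toReal_smul
    (hV.contDiff_siteDensity (β := β)).continuous.measurable.ennreal_ofReal
    (.of_forall fun x => ENNReal.ofReal_lt_top) f).trans
    (integral_congr_ae (.of_forall fun x => ?_))
  simp only [ENNReal.toReal_ofReal (siteDensity_nonneg x), smul_eq_mul, mul_comm (f x)]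

theorem siteMeasure_eq_prod (hV : Continuous V) :
    siteMeasure V β = (boltzmann fun p => β * (p ^ 2 / 2)).prod (boltzmann fun r => β * V r) := by
  have hgauss : Real.sqrt (2 * Real.pi * β⁻¹) = ∫ p : ℝ, Real.exp (-(β * (p ^ 2 / 2))) := by
    have hexponent (p : ℝ) : -(β * (p ^ 2 / 2)) = -(β / 2) * p ^ 2 := by ring
    simp_rw [hexponent, integral_gaussian]
    congr 1
    rw [div_div_eq_mul_div, div_eq_mul_inv, mul_comm Real.pi]
  have : 0 ≤ ∫ p : ℝ, Real.exp (-(β * (p ^ 2 / 2))) :=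
    integral_nonneg fun x => (Real.exp_pos _).le
  have hZ : partitionZ V β = ∫ r : ℝ, Real.exp (-(β * V r)) := by
    simp_rw [partitionZ, neg_mul]
  rw [boltzmann, boltzmann, prod_withDensity (by fun_prop) (by fun_prop), siteMeasure,
    Measure.volume_eq_prod]
  congr 1 with x
  rw [← ENNReal.ofReal_mul (by positivity), hgauss, hZ, div_mul_div_comm, ← Real.exp_add]
  congr 4
  ring

theorem IsConvexPotential.quadratic_le_mul (hV : IsConvexPotential V δm δp) (hβ : 0 < β) (r : ℝ) :
    β * (δm / 4) * r ^ 2 - β * (deriv V 0 ^ 2 / δm - V 0) ≤ β * V r := by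
  linarith [mul_le_mul_of_nonneg_left (hV.sq_sub_le r) hβ.le]

theorem isProbabilityMeasure_boltzmann_momentum (hβ : 0 < β) :
    IsProbabilityMeasure (boltzmann fun p => β * (p ^ 2 / 2)) :=
  isProbabilityMeasure_boltzmann (c := β / 2) (d := 0) (by fun_prop) (half_pos hβ)
    fun p => by linarith

theorem IsConvexPotential.isProbabilityMeasure_boltzmann (hV : IsConvexPotential V δm δp)
    (hβ : 0 < β) : IsProbabilityMeasure (boltzmann fun r => β * V r) :=
  EnergyChain.isProbabilityMeasure_boltzmann (hV.smooth.continuous.const_mul β)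
    (mul_pos hβ (div_pos hV.pos four_pos)) (hV.quadratic_le_mul hβ)

theorem IsConvexPotential.isProbabilityMeasure_siteMeasure (hV : IsConvexPotential V δm δp)
    (hβ : 0 < β) : IsProbabilityMeasure (siteMeasure V β) := by
  have := isProbabilityMeasure_boltzmann_momentum hβ
  have := hV.isProbabilityMeasure_boltzmann hβ
  rw [siteMeasure_eq_prod hV.smooth.continuous]
  infer_instance

theorem memLp_fst_siteMeasure (hV : IsConvexPotential V δm δp) (hβ : 0 < β) {q : ENNReal}
    (hq : q ≠ ⊤) : MemLp (fun x : ℝ × ℝ => x.1) q (siteMeasure V β) := by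
  have := isProbabilityMeasure_boltzmann_momentum hβ
  have := hV.isProbabilityMeasure_boltzmann hβ
  rw [siteMeasure_eq_prod hV.smooth.continuous]
  exact (memLp_id_boltzmann (c := β / 2) (d := 0) (by fun_prop) (half_pos hβ)
    (fun p => by linarith) hq).comp_measurePreserving measurePreserving_fst

theorem memLp_snd_siteMeasure (hV : IsConvexPotential V δm δp) (hβ : 0 < β) {q : ENNReal}
    (hq : q ≠ ⊤) : MemLp (fun x : ℝ × ℝ => x.2) q (siteMeasure V β) := by
  have := isProbabilityMeasure_boltzmann_momentum hβ
  have := hV.isProbabilityMeasure_boltzmann hβ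
  rw [siteMeasure_eq_prod hV.smooth.continuous]
  exact (memLp_id_boltzmann (hV.smooth.continuous.const_mul β)
    (mul_pos hβ (div_pos hV.pos four_pos)) (hV.quadratic_le_mul hβ)
    hq).comp_measurePreserving measurePreserving_snd

theorem measurePreserving_flip (hV : Continuous V) :
    MeasurePreserving flip (siteMeasure V β) (siteMeasure V β) := by
  have hflip : Measurable flip := by unfold flip; fun_prop
  have hvol : MeasurePreserving flip (volume : Measure (ℝ × ℝ)) volume :=
    (Measure.measurePreserving_neg (volume : Measure ℝ)).prod (MeasurePreserving.id volume)
  refine ⟨hflip, Measure.ext fun s hs => ?_⟩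
  rw [Measure.map_apply hflip hs, siteMeasure, withDensity_apply _ (hflip hs),
    withDensity_apply _ hs, ← hvol.setLIntegral_comp_preimage hs (by fun_prop)]
  simp only [flip, neg_sq]

/-! ### Energy truncation -/

theorem tendsto_siteEnergy_cocompact (hV : IsConvexPotential V δm δp) :
    Tendsto (siteEnergy V) (cocompact _) atTop := by
  set c := min (1 / 2) (δm / 4)
  have hc : 0 < c := lt_min one_half_pos (div_pos hV.pos four_pos)
  have hnorm : Tendsto (fun x : ℝ × ℝ => c * ‖x‖ ^ 2 + -(deriv V 0 ^ 2 / δm - V 0))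
      (cocompact _) atTop :=
    tendsto_atTop_add_const_right _ _
      (((tendsto_pow_atTop two_ne_zero).comp tendsto_norm_cocompact_atTop).const_mul_atTop hc)
  refine tendsto_atTop_mono (fun x => ?_) hnorm
  have hmax : ‖x‖ ^ 2 ≤ x.1 ^ 2 + x.2 ^ 2 := by
    rw [Prod.norm_def]
    rcases max_choice ‖x.1‖ ‖x.2‖ with h | h <;> rw [h, Real.norm_eq_abs, sq_abs] <;>
      linarith [sq_nonneg x.1, sq_nonneg x.2]
  have hle := mul_le_mul_of_nonneg_left hmax hc.le
  have h1 := mul_le_mul_of_nonneg_right (min_le_left (1 / 2) (δm / 4)) (sq_nonneg x.1)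
  have h2 := mul_le_mul_of_nonneg_right (min_le_right (1 / 2) (δm / 4)) (sq_nonneg x.2)
  rw [siteEnergy]
  linarith [hV.sq_sub_le x.2]

theorem contDiff_energyCutoff (hV : IsConvexPotential V δm δp) (n : ℕ) :
    ContDiff ℝ (⊤ : ℕ∞) (energyCutoff V n) :=
  Real.smoothTransition.contDiff.comp (contDiff_const.sub hV.contDiff_siteEnergy)

theorem hasCompactSupport_energyCutoff (hV : IsConvexPotential V δm δp) (n : ℕ) :
    HasCompactSupport (energyCutoff V n) := by
  rw [hasCompactSupport_iff_eventuallyEq, coclosedCompact_eq_cocompact]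
  filter_upwards [(tendsto_siteEnergy_cocompact hV).eventually_ge_atTop (n : ℝ)] with x hx
  exact Real.smoothTransition.zero_of_nonpos (sub_nonpos.2 hx)

theorem hamiltonianDeriv_energyCutoff (hV : IsConvexPotential V δm δp) (n : ℕ) (x : ℝ × ℝ) :
    hamiltonianDeriv V (energyCutoff V n) x = 0 := by
  have hφ : ContDiff ℝ 1 fun e : ℝ => Real.smoothTransition (n - e) :=
    Real.smoothTransition.contDiff.comp (contDiff_const.sub contDiff_id)
  exact (hamiltonianDeriv_comp (hφ.differentiable one_ne_zero _)
    (hV.contDiff_siteEnergy.differentiable (by simp) x)).trans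
    (by rw [hamiltonianDeriv_siteEnergy hV.differentiable, mul_zero])

theorem hamiltonianDeriv_mul_energyCutoff (hV : IsConvexPotential V δm δp) {u : ℝ × ℝ → ℝ}
    (hu : Differentiable ℝ u) (n : ℕ) (x : ℝ × ℝ) :
    hamiltonianDeriv V (fun y => u y * energyCutoff V n y) x =
      hamiltonianDeriv V u x * energyCutoff V n x := by
  rw [hamiltonianDeriv_mul (hu x) ((contDiff_energyCutoff hV n).differentiable (by simp) x),
    hamiltonianDeriv_energyCutoff hV, mul_zero, add_zero]

theorem eventually_energyCutoff_eq_one (x : ℝ × ℝ) : ∀ᶠ n in atTop, energyCutoff V n x = 1 := by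
  filter_upwards [tendsto_natCast_atTop_atTop.eventually_ge_atTop (siteEnergy V x + 1)] with n hn
  exact Real.smoothTransition.one_of_one_le (by linarith)

theorem tendsto_integral_mul_energyCutoff (hV : IsConvexPotential V δm δp) {μ : Measure (ℝ × ℝ)}
    {f : ℝ × ℝ → ℝ} (hf : Integrable f μ) :
    Tendsto (fun n => ∫ x, f x * energyCutoff V n x ∂μ) atTop (𝓝 (∫ x, f x ∂μ)) := by
  refine tendsto_integral_of_dominated_convergence (fun x => ‖f x‖)
    (fun n =>
      hf.aestronglyMeasurable.mul (contDiff_energyCutoff hV n).continuous.aestronglyMeasurable)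
    hf.norm (fun n => .of_forall fun x => ?_) (.of_forall fun x => ?_)
  · rw [norm_mul, energyCutoff, Real.norm_of_nonneg (Real.smoothTransition.nonneg _)]
    exact mul_le_of_le_one_right (norm_nonneg _) (Real.smoothTransition.le_one _)
  · refine tendsto_const_nhds.congr' ?_
    filter_upwards [eventually_energyCutoff_eq_one x] with n hn
    rw [hn, mul_one]

/-! ### Invariance of the one-site measure and the Poincaré inequality -/

/-- Liouville's theorem: the Hamiltonian vector field is divergence free. -/
theorem integral_hamiltonianDeriv_volume (hV : IsConvexPotential V δm δp) {u : ℝ × ℝ → ℝ}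
    (hu : ContDiff ℝ 1 u) (hc : HasCompactSupport u) : ∫ x, hamiltonianDeriv V u x = 0 := by
  have hV' : ContDiff ℝ 1 fun x : ℝ × ℝ => deriv V x.2 :=
    (hV.contDiff_deriv.of_le (by simp)).comp contDiff_snd
  have hpu : ContDiff ℝ 1 fun x : ℝ × ℝ => x.1 * u x := contDiff_fst.mul hu
  have hVu : ContDiff ℝ 1 fun x : ℝ × ℝ => deriv V x.2 * u x := hV'.mul hu
  have hdiv (x : ℝ × ℝ) : hamiltonianDeriv V u x =
      fderiv ℝ (fun x => x.1 * u x) x (0, 1) - fderiv ℝ (fun x => deriv V x.2 * u x) x (1, 0) := by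
    have hux := hu.differentiable one_ne_zero x
    rw [hamiltonianDeriv_eq, fderiv_fun_mul differentiableAt_fst hux,
      fderiv_fun_mul (hV'.differentiable one_ne_zero x) hux]
    have hVx : fderiv ℝ (fun x : ℝ × ℝ => deriv V x.2) x (1, 0) = 0 := by
      have hcomp := ((hV.differentiable_deriv x.2).hasDerivAt.comp_hasFDerivAt x
        (hasFDerivAt_snd (𝕜 := ℝ))).fderiv
      simpa using! congr($hcomp (1, 0))
    simp [hVx, fderiv_fst]
  have hint (f : ℝ × ℝ → ℝ) (hf : ContDiff ℝ 1 f) (hfc : HasCompactSupport f) (v : ℝ × ℝ) :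
      Integrable fun x => fderiv ℝ f x v :=
    ((hf.continuous_fderiv one_ne_zero).clm_apply continuous_const).integrable_of_hasCompactSupport
      (hfc.fderiv_apply ℝ v)
  simp_rw [hdiv]
  rw [integral_sub (hint _ hpu hc.mul_left _) (hint _ hVu hc.mul_left _), sub_eq_zero,
    integral_fderiv_apply_eq_zero _ hpu hc.mul_left,
    integral_fderiv_apply_eq_zero _ hVu hc.mul_left]

theorem integral_hamiltonianDeriv_of_hasCompactSupport (hV : IsConvexPotential V δm δp)
    {u : ℝ × ℝ → ℝ} (hu : ContDiff ℝ 1 u) (hc : HasCompactSupport u) :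
    ∫ x, hamiltonianDeriv V u x ∂(siteMeasure V β) = 0 := by
  have hρ : ContDiff ℝ 1 (siteDensity V β) := hV.contDiff_siteDensity.of_le (by simp)
  rw [integral_siteMeasure hV, ← integral_hamiltonianDeriv_volume hV (hu.mul hρ) hc.mul_right]
  congr 1 with x
  rw [hamiltonianDeriv_mul (hu.differentiable one_ne_zero x) (hρ.differentiable one_ne_zero x),
    hamiltonianDeriv_siteDensity hV, mul_zero, add_zero]

theorem integral_hamiltonianDeriv_eq_zero (hV : IsConvexPotential V δm δp) {u : ℝ × ℝ → ℝ}
    (hu : ContDiff ℝ 1 u) (hint : Integrable (hamiltonianDeriv V u) (siteMeasure V β)) :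
    ∫ x, hamiltonianDeriv V u x ∂(siteMeasure V β) = 0 := by
  have hcut (n : ℕ) : ∫ x, hamiltonianDeriv V u x * energyCutoff V n x ∂(siteMeasure V β) = 0 := by
    rw [← integral_hamiltonianDeriv_of_hasCompactSupport (β := β) hV
      (hu.mul ((contDiff_energyCutoff hV n).of_le (by simp)))
      (hasCompactSupport_energyCutoff hV n).mul_left]
    simp_rw [hamiltonianDeriv_mul_energyCutoff hV (hu.differentiable one_ne_zero) n]
  have hlim := tendsto_integral_mul_energyCutoff hV hint
  simp_rw [hcut] at hlim
  exact tendsto_nhds_unique hlim tendsto_const_nhds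

/-- Writing `u = p w`, one has `(Du)² + D(V' u w) = V'' u² + (Du + V' w)²`, which is how the
convexity of `V` enters the Poincaré inequality. -/
theorem exists_sq_add_hamiltonianDeriv_eq (hV : IsConvexPotential V δm δp) {u : ℝ × ℝ → ℝ}
    (hu : ContDiff ℝ 1 u) (h0 : ∀ r, u (0, r) = 0) :
    ∃ z w : ℝ × ℝ → ℝ, ContDiff ℝ 1 z ∧ ∀ x,
      hamiltonianDeriv V u x ^ 2 + hamiltonianDeriv V z x =
        deriv (deriv V) x.2 * u x ^ 2 + (hamiltonianDeriv V u x + deriv V x.2 * w x) ^ 2 := by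
  obtain ⟨w, hw, huw⟩ := exists_continuous_eq_fst_mul hu h0
  have huw_deriv (x : ℝ × ℝ) := hasFDerivAt_mul_of_eq_clm_mul
    (ℓ := ContinuousLinearMap.fst ℝ ℝ ℝ) huw hw.continuousAt
    (hu.differentiable one_ne_zero x).hasFDerivAt
  have huw_contDiff : ContDiff ℝ 1 fun x => u x * w x := by
    refine contDiff_one_iff_fderiv.2 ⟨fun x => (huw_deriv x).differentiableAt, ?_⟩
    rw [funext fun x => (huw_deriv x).fderiv]
    have := hu.continuous_fderiv one_ne_zero
    fun_prop
  have hV' : ContDiff ℝ 1 fun x : ℝ × ℝ => deriv V x.2 :=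
    (hV.contDiff_deriv.of_le (by simp)).comp contDiff_snd
  refine ⟨fun x => deriv V x.2 * (u x * w x), w, hV'.mul huw_contDiff, fun x => ?_⟩
  have hDV' : hamiltonianDeriv V (fun y => deriv V y.2) x = deriv (deriv V) x.2 * x.1 := by
    rw [hamiltonianDeriv_comp (hV.differentiable_deriv _) differentiableAt_snd, hamiltonianDeriv,
      fderiv_snd, ContinuousLinearMap.coe_snd']
  have hDuw : hamiltonianDeriv V (fun y => u y * w y) x =
      2 * w x * hamiltonianDeriv V u x + w x ^ 2 * deriv V x.2 := by
    rw [hamiltonianDeriv, (huw_deriv x).fderiv]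
    simp [hamiltonianDeriv]
  rw [hamiltonianDeriv_mul (hV'.differentiable one_ne_zero x)
    (huw_contDiff.differentiable one_ne_zero x), hDV', hDuw, huw x]
  ring

theorem mul_integral_sq_le_integral_hamiltonianDeriv_sq (hV : IsConvexPotential V δm δp)
    (hβ : 0 < β) {u : ℝ × ℝ → ℝ} (hu : ContDiff ℝ 1 u) (h0 : ∀ r, u (0, r) = 0)
    (hint : Integrable (fun x => u x ^ 2) (siteMeasure V β))
    (hDint : Integrable (fun x => hamiltonianDeriv V u x ^ 2) (siteMeasure V β)) :
    δm * ∫ x, u x ^ 2 ∂(siteMeasure V β) ≤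
      ∫ x, hamiltonianDeriv V u x ^ 2 ∂(siteMeasure V β) := by
  have := hV.isProbabilityMeasure_siteMeasure hβ
  obtain ⟨z, w, hz, hzw⟩ := exists_sq_add_hamiltonianDeriv_eq hV hu h0
  have hcont {v : ℝ × ℝ → ℝ} (hv : ContDiff ℝ 1 v) : Continuous (hamiltonianDeriv V v) :=
    continuous_hamiltonianDeriv hV.contDiff_deriv.continuous hv
  have hcutoff (n : ℕ) {f : ℝ × ℝ → ℝ} (hf : Continuous f) :
      Integrable (fun x => f x * energyCutoff V n x) (siteMeasure V β) :=
    (hf.mul (contDiff_energyCutoff hV n).continuous).integrable_of_hasCompactSupport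
      (hasCompactSupport_energyCutoff hV n).mul_left
  refine le_of_tendsto_of_tendsto' ((tendsto_integral_mul_energyCutoff hV hint).const_mul δm)
    (tendsto_integral_mul_energyCutoff hV hDint) fun n => ?_
  have hz0 : ∫ x, hamiltonianDeriv V z x * energyCutoff V n x ∂(siteMeasure V β) = 0 := by
    simp_rw [← hamiltonianDeriv_mul_energyCutoff hV (hz.differentiable one_ne_zero)]
    exact integral_hamiltonianDeriv_of_hasCompactSupport hV
      (hz.mul ((contDiff_energyCutoff hV n).of_le (by simp)))
      (hasCompactSupport_energyCutoff hV n).mul_left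
  have hDu : Integrable (fun x => hamiltonianDeriv V u x ^ 2 * energyCutoff V n x)
      (siteMeasure V β) := hcutoff n ((hcont hu).pow 2)
  have hDz := hcutoff n (hcont hz)
  rw [← add_zero (∫ x, hamiltonianDeriv V u x ^ 2 * energyCutoff V n x ∂(siteMeasure V β)), ← hz0,
    ← integral_add hDu hDz, ← integral_const_mul]
  refine integral_mono ((hcutoff n (hu.continuous.pow 2)).const_mul δm) (hDu.add hDz) fun x => ?_
  simp only [← mul_assoc, ← add_mul, hzw]
  refine mul_le_mul_of_nonneg_right ?_ (Real.smoothTransition.nonneg _)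
  nlinarith [mul_le_mul_of_nonneg_right (hV.lower x.2) (sq_nonneg (u x)),
    sq_nonneg (hamiltonianDeriv V u x + deriv V x.2 * w x)]

end OneSite

/-! ### Invariance properties of infinite product measures -/

section InfiniteProduct

variable {α ι κ : Type*} [MeasurableSpace α] (μ : Measure α) [IsProbabilityMeasure μ]

theorem measurePreserving_infinitePi_reindex (e : κ ≃ ι) :
    MeasurePreserving (fun (ω : ι → α) k => ω (e k)) (Measure.infinitePi fun _ => μ)
      (Measure.infinitePi fun _ => μ) :=
  MeasurePreserving.symm (MeasurableEquiv.piCongrLeft (fun _ => α) e)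
    ⟨by fun_prop, Measure.infinitePi_map_piCongrLeft (fun _ => μ) e⟩

theorem measurePreserving_infinitePi_pair {γ : Type*} [MeasurableSpace γ] (ν : Measure γ)
    [IsProbabilityMeasure ν] :
    MeasurePreserving (fun (z : (ι → α) × (ι → γ)) i => (z.1 i, z.2 i))
      ((Measure.infinitePi fun _ => μ).prod (Measure.infinitePi fun _ => ν))
      (Measure.infinitePi fun _ => μ.prod ν) := by
  have hm : Measurable fun (z : (ι → α) × (ι → γ)) i => (z.1 i, z.2 i) := by fun_prop
  refine ⟨hm, IsProjectiveLimit.unique (P := fun I : Finset ι => Measure.pi fun _ : I => μ.prod ν)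
    (fun I => ?_) (Measure.isProjectiveLimit_infinitePi _)⟩
  rw [Measure.map_map (by fun_prop) hm]
  have restrict_comp : I.restrict ∘ (fun (z : (ι → α) × (ι → γ)) i => (z.1 i, z.2 i)) =
      (MeasurableEquiv.arrowProdEquivProdArrow α γ I).symm ∘ Prod.map I.restrict I.restrict := rfl
  rw [restrict_comp, ← Measure.map_map (MeasurableEquiv.measurable _) (by fun_prop),
    ← Measure.map_prod_map _ _ (by fun_prop) (by fun_prop), Measure.infinitePi_map_restrict,
    Measure.infinitePi_map_restrict]
  exact ((measurePreserving_arrowProdEquivProdArrow α γ I (fun _ => μ) fun _ => ν).symm).map_eq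

variable [DecidableEq ι]

theorem measurePreserving_infinitePi_update (i : ι) :
    MeasurePreserving (fun z : (ι → α) × α => Function.update z.1 i z.2)
      ((Measure.infinitePi fun _ => μ).prod μ) (Measure.infinitePi fun _ => μ) := by
  have hm : Measurable fun z : (ι → α) × α => Function.update z.1 i z.2 := by
    refine measurable_pi_iff.2 fun k => ?_
    rcases eq_or_ne k i with rfl | h
    · simpa using measurable_snd
    · simp only [Function.update_of_ne h]
      fun_prop
  refine ⟨hm, Measure.eq_infinitePi _ fun s t ht => ?_⟩
  rw [Measure.map_apply hm (.pi s.countable_toSet fun i _ => ht i)]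
  by_cases hi : i ∈ s
  · have preimage_eq : (fun z : (ι → α) × α => Function.update z.1 i z.2) ⁻¹' (s : Set ι).pi t =
        ((s.erase i : Finset ι) : Set ι).pi t ×ˢ t i := by
      ext z
      simp only [Set.mem_preimage, Set.mem_pi, Finset.mem_coe, Set.mem_prod, Finset.mem_erase]
      constructor
      · intro h
        exact ⟨fun k hk => by simpa [hk.1] using h k hk.2, by simpa using h i hi⟩
      · rintro ⟨hs, hzi⟩ k hk
        rcases eq_or_ne k i with rfl | hki
        · simpa using hzi
        · simpa [hki] using hs k ⟨hki, hk⟩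
    rw [preimage_eq, Measure.prod_prod, Measure.infinitePi_pi _ fun i _ => ht _,
      Finset.prod_erase_mul _ _ hi]
  · have preimage_eq : (fun z : (ι → α) × α => Function.update z.1 i z.2) ⁻¹' (s : Set ι).pi t =
        (s : Set ι).pi t ×ˢ Set.univ := by
      ext z
      simp only [Set.mem_preimage, Set.mem_pi, Finset.mem_coe, Set.mem_prod, Set.mem_univ,
        and_true]
      refine forall₂_congr fun k hk => ?_
      rw [Function.update_of_ne (ne_of_mem_of_not_mem hk hi)]
    rw [preimage_eq, Measure.prod_prod, Measure.infinitePi_pi _ fun i _ => ht _,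
      measure_univ, mul_one]

theorem measurePreserving_infinitePi_apply_single {f : α → α} (hf : MeasurePreserving f μ μ)
    (i : ι) :
    MeasurePreserving (fun (ω : ι → α) => Function.update ω i (f (ω i)))
      (Measure.infinitePi fun _ => μ) (Measure.infinitePi fun _ => μ) := by
  have update_eq : (fun (ω : ι → α) => Function.update ω i (f (ω i))) =
      fun ω k => (if k = i then f else id) (ω k) := by
    ext ω k
    rcases eq_or_ne k i with rfl | h <;> simp [*]
  have hm (k : ι) : Measurable (if k = i then f else id) := by
    split_ifs; exacts [hf.measurable, measurable_id]
  rw [update_eq]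
  refine ⟨measurable_pi_iff.2 fun k => (hm k).comp (measurable_pi_apply k), ?_⟩
  rw [Measure.infinitePi_map_pi _ hm]
  congr 1 with k : 1
  split_ifs
  · exact hf.map_eq
  · exact Measure.map_id

end InfiniteProduct

section Gibbs

variable {V : ℝ → ℝ} {δm δp β : ℝ}

/-- Translation of the positions relative to the momenta. -/
def slide (s : ℤ) (ω : Config) : Config := fun k => ((ω k).1, (ω (k - s)).2)

/-- Reversal of the momentum at the site `i`. -/
def flipAt (i : ℤ) (ω : Config) : Config := Function.update ω i (flip (ω i))

theorem IsConvexPotential.isProbabilityMeasure_gibbs (hV : IsConvexPotential V δm δp) (hβ : 0 < β) :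
    IsProbabilityMeasure (gibbs V β) := by
  have := hV.isProbabilityMeasure_siteMeasure hβ
  unfold gibbs; infer_instance

theorem measurePreserving_shift (hV : IsConvexPotential V δm δp) (hβ : 0 < β) (j : ℤ) :
    MeasurePreserving (fun (ω : Config) i => ω (i + j)) (gibbs V β) (gibbs V β) := by
  have := hV.isProbabilityMeasure_siteMeasure hβ
  exact measurePreserving_infinitePi_reindex _ (Equiv.addRight j)

theorem measurePreserving_update (hV : IsConvexPotential V δm δp) (hβ : 0 < β) (i : ℤ) :
    MeasurePreserving (fun z : Config × (ℝ × ℝ) => Function.update z.1 i z.2)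
      ((gibbs V β).prod (siteMeasure V β)) (gibbs V β) := by
  have := hV.isProbabilityMeasure_siteMeasure hβ
  exact measurePreserving_infinitePi_update _ i

theorem measurePreserving_eval (hV : IsConvexPotential V δm δp) (hβ : 0 < β) (i : ℤ) :
    MeasurePreserving (fun ω : Config => ω i) (gibbs V β) (siteMeasure V β) := by
  have := hV.isProbabilityMeasure_siteMeasure hβ
  exact measurePreserving_eval_infinitePi _ i

theorem measurePreserving_flipAt (hV : IsConvexPotential V δm δp) (hβ : 0 < β) (i : ℤ) :
    MeasurePreserving (flipAt i) (gibbs V β) (gibbs V β) := by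
  have := hV.isProbabilityMeasure_siteMeasure hβ
  exact measurePreserving_infinitePi_apply_single _ (measurePreserving_flip hV.smooth.continuous) i

theorem measurePreserving_slide (hV : IsConvexPotential V δm δp) (hβ : 0 < β) (s : ℤ) :
    MeasurePreserving (slide s) (gibbs V β) (gibbs V β) := by
  have := isProbabilityMeasure_boltzmann_momentum hβ
  have := hV.isProbabilityMeasure_boltzmann hβ
  have hpair := measurePreserving_infinitePi_pair (ι := ℤ) (boltzmann fun p => β * (p ^ 2 / 2))
    (boltzmann fun r => β * V r)
  have hslide := (MeasurePreserving.id (Measure.infinitePi fun _ : ℤ =>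
    boltzmann fun p => β * (p ^ 2 / 2))).prod
    (measurePreserving_infinitePi_reindex (boltzmann fun r => β * V r) (Equiv.addRight (-s)))
  have gibbs_eq : gibbs V β = Measure.infinitePi fun _ : ℤ =>
      (boltzmann fun p => β * (p ^ 2 / 2)).prod (boltzmann fun r => β * V r) := by
    unfold gibbs
    congr 1 with _ : 1
    exact siteMeasure_eq_prod hV.smooth.continuous
  have hmeas : Measurable (slide s) := by unfold slide; fun_prop
  refine ⟨hmeas, ?_⟩
  rw [gibbs_eq]
  conv_lhs => rw [← hpair.map_eq]
  rw [Measure.map_map hmeas hpair.measurable, ← (hpair.comp hslide).map_eq]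
  rfl

end Gibbs

/-! ### Smooth local functions -/

/-- Smooth functions of finitely many coordinates, with values in a normed space; real-valued ones
are the functions satisfying `IsSmoothLocal`. -/
def SmoothLocal {E : Type*} [NormedAddCommGroup E] [NormedSpace ℝ E] (f : Config → E) : Prop :=
  ∃ (Λ : Finset ℤ) (φ : (Λ → ℝ × ℝ) → E), ContDiff ℝ (⊤ : ℕ∞) φ ∧ ∀ ω, f ω = φ fun i => ω i

namespace SmoothLocal

variable {E F : Type*} [NormedAddCommGroup E] [NormedSpace ℝ E] [NormedAddCommGroup F]
  [NormedSpace ℝ F]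

theorem exists_superset {f : Config → E} (hf : SmoothLocal f) (M : Finset ℤ) :
    ∃ (Λ : Finset ℤ) (φ : (Λ → ℝ × ℝ) → E), M ⊆ Λ ∧ ContDiff ℝ (⊤ : ℕ∞) φ ∧
      ∀ ω, f ω = φ fun i => ω i := by
  obtain ⟨Λ, φ, hφ, h⟩ := hf
  refine ⟨Λ ∪ M, fun y => φ fun i => y ⟨i, Finset.mem_union_left _ i.2⟩,
    Finset.subset_union_right, hφ.comp ?_, h⟩
  exact contDiff_pi.2 fun i => contDiff_apply _ _ _

theorem comp {f : Config → E} (hf : SmoothLocal f) {ψ : E → F} (hψ : ContDiff ℝ (⊤ : ℕ∞) ψ) :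
    SmoothLocal fun ω => ψ (f ω) := by
  obtain ⟨Λ, φ, hφ, h⟩ := hf
  exact ⟨Λ, fun y => ψ (φ y), hψ.comp hφ, fun ω => congrArg ψ (h ω)⟩

theorem const (c : E) : SmoothLocal fun _ => c := ⟨∅, fun _ => c, contDiff_const, fun _ => rfl⟩

theorem coord (k : ℤ) : SmoothLocal fun ω => ω k :=
  ⟨{k}, fun y => y ⟨k, Finset.mem_singleton_self k⟩, contDiff_apply _ _ _, fun _ => rfl⟩

theorem prodMk {f : Config → E} {g : Config → F} (hf : SmoothLocal f) (hg : SmoothLocal g) :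
    SmoothLocal fun ω => (f ω, g ω) := by
  obtain ⟨M, ψ, hψ, h'⟩ := hg
  obtain ⟨Λ, φ, hM, hφ, h⟩ := hf.exists_superset M
  refine ⟨Λ, fun y => (φ y, ψ fun i => y ⟨i, hM i.2⟩), hφ.prodMk (hψ.comp ?_), fun ω =>
    Prod.ext (h ω) (h' ω)⟩
  exact contDiff_pi.2 fun i => contDiff_apply _ _ _

theorem pi {ι : Type*} [Fintype ι] {f : ι → Config → E} (hf : ∀ k, SmoothLocal (f k)) :
    SmoothLocal fun ω k => f k ω := by
  choose Λ φ hφ h using hf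
  refine ⟨Finset.univ.biUnion Λ, fun y k => φ k fun i =>
    y ⟨i, Finset.mem_biUnion.2 ⟨k, Finset.mem_univ k, i.2⟩⟩,
    contDiff_pi.2 fun k => (hφ k).comp ?_, fun ω => ?_⟩
  · exact contDiff_pi.2 fun i => contDiff_apply _ _ _
  · ext k; exact h k ω

theorem subst {f : Config → E} (hf : SmoothLocal f) {T : Config → Config}
    (hT : ∀ k, SmoothLocal fun ω => T ω k) : SmoothLocal fun ω => f (T ω) := by
  obtain ⟨Λ, φ, hφ, h⟩ := hf
  have := (pi fun k : Λ => hT k).comp hφ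
  simpa only [h] using this

theorem add {f g : Config → E} (hf : SmoothLocal f) (hg : SmoothLocal g) :
    SmoothLocal (f + g) := (hf.prodMk hg).comp (ψ := fun z => z.1 + z.2) (by fun_prop)

theorem sub {f g : Config → E} (hf : SmoothLocal f) (hg : SmoothLocal g) :
    SmoothLocal (f - g) := (hf.prodMk hg).comp (ψ := fun z => z.1 - z.2) (by fun_prop)

theorem smul {f : Config → E} (hf : SmoothLocal f) (c : ℝ) : SmoothLocal (c • f) :=
  hf.comp (ψ := fun z => c • z) (by fun_prop)

theorem mul {f g : Config → ℝ} (hf : SmoothLocal f) (hg : SmoothLocal g) :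
    SmoothLocal (f * g) := (hf.prodMk hg).comp (ψ := fun z => z.1 * z.2) (by fun_prop)

theorem sum {ι : Type*} (s : Finset ι) {f : ι → Config → E} (hf : ∀ k ∈ s, SmoothLocal (f k)) :
    SmoothLocal (∑ k ∈ s, f k) :=
  Finset.sum_induction f SmoothLocal (fun _ _ => add) (const 0) hf

theorem shift {f : Config → ℝ} (hf : SmoothLocal f) (j : ℤ) : SmoothLocal (shift j f) :=
  hf.subst fun k => coord (k + j)

theorem slide {f : Config → E} (hf : SmoothLocal f) (s : ℤ) :
    SmoothLocal fun ω => f (slide s ω) :=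
  hf.subst fun k => ((coord k).comp contDiff_fst).prodMk ((coord (k - s)).comp contDiff_snd)

theorem flipAt {f : Config → E} (hf : SmoothLocal f) (i : ℤ) :
    SmoothLocal fun ω => f (flipAt i ω) := by
  refine hf.subst fun k => ?_
  have h : ContDiff ℝ (⊤ : ℕ∞) flip := contDiff_fst.neg.prodMk contDiff_snd
  rcases eq_or_ne k i with rfl | hk
  · simpa [EnergyChain.flipAt] using (coord k).comp h
  · simpa [EnergyChain.flipAt, hk] using coord k

theorem continuous {f : Config → E} (hf : SmoothLocal f) : Continuous f := by
  obtain ⟨Λ, φ, hφ, h⟩ := hf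
  rw [show f = fun ω => φ fun i => ω i from funext h]
  exact hφ.continuous.comp (by fun_prop)

theorem contDiff_slice {f : Config → E} (hf : SmoothLocal f) (ω : Config) (i : ℤ) :
    ContDiff ℝ (⊤ : ℕ∞) fun x => f (Function.update ω i x) := by
  obtain ⟨Λ, φ, hφ, h⟩ := hf
  simp only [h]
  refine hφ.comp (contDiff_pi.2 fun k => ?_)
  rcases eq_or_ne (k : ℤ) i with hk | hk
  · simpa [hk] using contDiff_fun_id
  · simpa [hk] using contDiff_const

theorem hasFDerivAt_slice {f : Config → E} (hf : SmoothLocal f) (ω : Config) (i : ℤ)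
    (x : ℝ × ℝ) : HasFDerivAt (fun x => f (Function.update ω i x))
      (fderiv ℝ (fun x => f (Function.update ω i x)) x) x :=
  ((hf.contDiff_slice ω i).differentiable (by simp) x).hasFDerivAt

end SmoothLocal

theorem dp_eq_fderiv {f : Config → ℝ} (hf : SmoothLocal f) (i : ℤ) (ω : Config) :
    dp i f ω = fderiv ℝ (fun x => f (Function.update ω i x)) (ω i) (1, 0) := by
  have hline : HasDerivAt (fun x : ℝ => (x, (ω i).2)) (1, 0) (ω i).1 :=
    (hasDerivAt_id _).prodMk (hasDerivAt_const _ _)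
  exact ((hf.hasFDerivAt_slice ω i (ω i)).comp_hasDerivAt _ hline).deriv

theorem dr_eq_fderiv {f : Config → ℝ} (hf : SmoothLocal f) (i : ℤ) (ω : Config) :
    dr i f ω = fderiv ℝ (fun x => f (Function.update ω i x)) (ω i) (0, 1) := by
  have hline : HasDerivAt (fun x : ℝ => ((ω i).1, x)) (0, 1) (ω i).2 :=
    (hasDerivAt_const _ _).prodMk (hasDerivAt_id _)
  exact ((hf.hasFDerivAt_slice ω i (ω i)).comp_hasDerivAt _ hline).deriv

theorem fderiv_slice_apply {f : Config → ℝ} {Λ : Finset ℤ} {φ : (Λ → ℝ × ℝ) → ℝ}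
    (hφ : ContDiff ℝ (⊤ : ℕ∞) φ) (h : ∀ ω, f ω = φ fun i => ω i) {i : ℤ} (hi : i ∈ Λ)
    (ω : Config) (v : ℝ × ℝ) :
    fderiv ℝ (fun x => f (Function.update ω i x)) (ω i) v =
      fderiv ℝ φ (fun k => ω k) (Pi.single ⟨i, hi⟩ v) := by
  have hupdate : HasFDerivAt (fun x (k : Λ) => Function.update ω i x k)
      (ContinuousLinearMap.single ℝ (fun _ : Λ => ℝ × ℝ) ⟨i, hi⟩) (ω i) := by
    refine hasFDerivAt_pi'.2 fun k => ?_
    rcases eq_or_ne k ⟨i, hi⟩ with rfl | hk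
    · simp only [Function.update_self]
      exact (hasFDerivAt_id (𝕜 := ℝ) (ω i)).congr_fderiv
        (ContinuousLinearMap.ext fun w => by simp)
    · have hk' : (k : ℤ) ≠ i := fun h => hk (Subtype.ext h)
      simp only [Function.update_of_ne hk']
      exact (hasFDerivAt_const (𝕜 := ℝ) (ω k) (ω i)).congr_fderiv
        (ContinuousLinearMap.ext fun w => by simp [hk])
  have hcomp := (hφ.differentiable (by simp) fun k : Λ =>
    Function.update ω i (ω i) k).hasFDerivAt.comp (ω i) hupdate
  have slice_eq : (fun x => f (Function.update ω i x)) =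
      φ ∘ fun x (k : Λ) => Function.update ω i x k := funext fun x => h _
  simp only [slice_eq, hcomp.fderiv, Function.update_eq_self]
  rfl

theorem smoothLocal_fderiv {f : Config → ℝ} (hf : SmoothLocal f) (i : ℤ) (v : ℝ × ℝ) :
    SmoothLocal fun ω => fderiv ℝ (fun x => f (Function.update ω i x)) (ω i) v := by
  obtain ⟨Λ, φ, hi, hφ, h⟩ := hf.exists_superset {i}
  exact ⟨Λ, fun y => fderiv ℝ φ y (Pi.single ⟨i, Finset.singleton_subset_iff.1 hi⟩ v),
    (hφ.fderiv_right (m := (⊤ : ℕ∞)) (by simp)).clm_apply contDiff_const,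
    fun ω => fderiv_slice_apply hφ h _ ω v⟩

section Calculus

variable {V : ℝ → ℝ} {δm δp β : ℝ} {f g : Config → ℝ}

theorem SmoothLocal.dp (hf : SmoothLocal f) (i : ℤ) : SmoothLocal (dp i f) := by
  rw [show EnergyChain.dp i f = _ from funext fun ω => dp_eq_fderiv hf i ω]
  exact smoothLocal_fderiv hf i _

theorem SmoothLocal.dr (hf : SmoothLocal f) (i : ℤ) : SmoothLocal (dr i f) := by
  rw [show EnergyChain.dr i f = _ from funext fun ω => dr_eq_fderiv hf i ω]
  exact smoothLocal_fderiv hf i _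

theorem smoothLocal_momentum (i : ℤ) : SmoothLocal fun ω => (ω i).1 :=
  (SmoothLocal.coord i).comp contDiff_fst

theorem smoothLocal_position (i : ℤ) : SmoothLocal fun ω => (ω i).2 :=
  (SmoothLocal.coord i).comp contDiff_snd

theorem smoothLocal_force (hV : IsConvexPotential V δm δp) (i : ℤ) :
    SmoothLocal fun ω => deriv V (ω i).2 :=
  (smoothLocal_position i).comp hV.contDiff_deriv

theorem SmoothLocal.Y (hV : IsConvexPotential V δm δp) (hf : SmoothLocal f) (i j : ℤ) :
    SmoothLocal (Y V i j f) :=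
  ((smoothLocal_momentum i).mul (hf.dr j)).sub ((smoothLocal_force hV j).mul (hf.dp i))

theorem SmoothLocal.differentiableAt_dp (hf : SmoothLocal f) (i : ℤ) (ω : Config) (x : ℝ) :
    DifferentiableAt ℝ (fun x : ℝ => f (Function.update ω i (x, (ω i).2))) x :=
  ((hf.contDiff_slice ω i).differentiable (by simp) (x, (ω i).2)).comp x
    (f := fun x : ℝ => (x, (ω i).2)) (by fun_prop)

theorem SmoothLocal.differentiableAt_dr (hf : SmoothLocal f) (i : ℤ) (ω : Config) (x : ℝ) :
    DifferentiableAt ℝ (fun x : ℝ => f (Function.update ω i ((ω i).1, x))) x :=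
  ((hf.contDiff_slice ω i).differentiable (by simp) ((ω i).1, x)).comp x
    (f := fun x : ℝ => ((ω i).1, x)) (by fun_prop)

theorem dp_add (hf : SmoothLocal f) (hg : SmoothLocal g) (i : ℤ) :
    dp i (f + g) = dp i f + dp i g := by
  ext ω
  exact deriv_fun_add (hf.differentiableAt_dp i ω _) (hg.differentiableAt_dp i ω _)

theorem dr_add (hf : SmoothLocal f) (hg : SmoothLocal g) (i : ℤ) :
    dr i (f + g) = dr i f + dr i g := by
  ext ω
  exact deriv_fun_add (hf.differentiableAt_dr i ω _) (hg.differentiableAt_dr i ω _)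

theorem dp_smul (hf : SmoothLocal f) (c : ℝ) (i : ℤ) : dp i (c • f) = c • dp i f := by
  ext ω
  exact deriv_const_mul c (hf.differentiableAt_dp i ω _)

theorem dr_smul (hf : SmoothLocal f) (c : ℝ) (i : ℤ) : dr i (c • f) = c • dr i f := by
  ext ω
  exact deriv_const_mul c (hf.differentiableAt_dr i ω _)

theorem dp_mul (hf : SmoothLocal f) (hg : SmoothLocal g) (i : ℤ) :
    dp i (f * g) = dp i f * g + f * dp i g := by
  ext ω
  have h := deriv_fun_mul (hf.differentiableAt_dp i ω (ω i).1)
    (hg.differentiableAt_dp i ω (ω i).1)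
  rwa [Prod.mk.eta, Function.update_eq_self] at h

theorem dr_mul (hf : SmoothLocal f) (hg : SmoothLocal g) (i : ℤ) :
    dr i (f * g) = dr i f * g + f * dr i g := by
  ext ω
  have h := deriv_fun_mul (hf.differentiableAt_dr i ω (ω i).2)
    (hg.differentiableAt_dr i ω (ω i).2)
  rwa [Prod.mk.eta, Function.update_eq_self] at h

theorem Y_add (hf : SmoothLocal f) (hg : SmoothLocal g) (i j : ℤ) :
    Y V i j (f + g) = Y V i j f + Y V i j g := by
  ext ω
  simp only [Y, dp_add hf hg, dr_add hf hg, Pi.add_apply]; ring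

theorem Y_smul (hf : SmoothLocal f) (c : ℝ) (i j : ℤ) : Y V i j (c • f) = c • Y V i j f := by
  ext ω
  simp only [Y, dp_smul hf, dr_smul hf, Pi.smul_apply, smul_eq_mul]; ring

theorem Y_sub (hf : SmoothLocal f) (hg : SmoothLocal g) (i j : ℤ) :
    Y V i j (f - g) = Y V i j f - Y V i j g := by
  have h := Y_add (V := V) hf (hg.smul (-1)) i j
  rw [Y_smul hg] at h
  simpa [sub_eq_add_neg] using h

theorem Y_mul (hf : SmoothLocal f) (hg : SmoothLocal g) (i j : ℤ) :
    Y V i j (f * g) = Y V i j f * g + f * Y V i j g := by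
  ext ω
  simp only [Y, dp_mul hf hg, dr_mul hf hg, Pi.add_apply, Pi.mul_apply]; ring

theorem Y_zero (i j : ℤ) : Y V i j 0 = 0 := by
  ext ω; simp [Y, dp, dr]

theorem Y_sum {ι : Type*} (s : Finset ι) {f : ι → Config → ℝ} (hf : ∀ k, SmoothLocal (f k))
    (i j : ℤ) : Y V i j (∑ k ∈ s, f k) = ∑ k ∈ s, Y V i j (f k) := by
  classical
  induction s using Finset.induction_on with
  | empty => simp [Y_zero]
  | insert a s ha ih =>
    rw [Finset.sum_insert ha, Finset.sum_insert ha,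
      Y_add (hf a) (SmoothLocal.sum s fun k _ => hf k), ih]

theorem X_eq_hamiltonianDeriv (hf : SmoothLocal f) (i : ℤ) (ω : Config) :
    X V i f ω = hamiltonianDeriv V (fun x => f (Function.update ω i x)) (ω i) := by
  rw [hamiltonianDeriv_eq, X, Y, dp_eq_fderiv hf, dr_eq_fderiv hf]

theorem Y_shift (i j k : ℤ) (f : Config → ℝ) :
    Y V (i + k) (j + k) (shift k f) = shift k (Y V i j f) := by
  have update_shift (ω : Config) (i : ℤ) (x : ℝ × ℝ) :
      (fun m => Function.update ω (i + k) x (m + k)) =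
      Function.update (fun m => ω (m + k)) i x := by
    ext m : 1
    rcases eq_or_ne m i with rfl | hm
    · simp
    · simp [hm]
  ext ω
  simp only [Y, shift, dp, dr, update_shift]

theorem shift_shift (j k : ℤ) (f : Config → ℝ) : shift j (shift k f) = shift (j + k) f := by
  ext ω
  simp only [shift]
  congr 1 with i : 1
  rw [add_assoc, add_comm k]

theorem X_slide (i s : ℤ) (f : Config → ℝ) (ω : Config) :
    X V i (fun ω => f (slide s ω)) ω = Y V i (i + s) f (slide s ω) := by
  have hp (x : ℝ) : slide s (Function.update ω i (x, (ω i).2)) =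
      Function.update (slide s ω) i (x, (slide s ω i).2) := by
    ext k : 1
    simp only [slide, Function.update_apply]
    split_ifs <;> simp_all
  have hr (x : ℝ) : slide s (Function.update ω i ((ω i).1, x)) =
      Function.update (slide s ω) (i + s) ((slide s ω (i + s)).1, x) := by
    ext k : 1
    simp only [slide, Function.update_apply, sub_eq_iff_eq_add]
    split_ifs <;> simp_all
  simp only [X, Y, dp, dr, hp, hr]
  simp [slide]

theorem X_flipAt (i : ℤ) (f : Config → ℝ) (ω : Config) :
    X V i (fun ω => f (flipAt i ω)) ω = -X V i f (flipAt i ω) := by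
  have flipAt_update (x : ℝ × ℝ) :
      flipAt i (Function.update ω i x) = Function.update ω i (flip x) := by
    simp [flipAt]
  have update_flipAt (x : ℝ × ℝ) : Function.update (flipAt i ω) i x = Function.update ω i x := by
    simp [flipAt]
  simp only [X, Y, dp, dr, flipAt_update, update_flipAt, flip,
    deriv_comp_neg fun x : ℝ => f (Function.update ω i (x, (ω i).2))]
  simp only [flipAt, flip, Function.update_self]
  ring

theorem flipAt_flipAt (i : ℤ) (ω : Config) : flipAt i (flipAt i ω) = ω := by
  simp [flipAt, flip]

theorem Y_eq_zero_of_dependsOn {Λ : Finset ℤ} (hf : DependsOn f Λ) {i j : ℤ}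
    (hi : i ∉ Λ) (hj : j ∉ Λ) : Y V i j f = 0 := by
  have h (ω : Config) {k : ℤ} (hk : k ∉ Λ) (x : ℝ × ℝ) : f (Function.update ω k x) = f ω :=
    hf fun m hm => Function.update_of_ne (ne_of_mem_of_not_mem hm hk) _ _
  ext ω
  simp [Y, dp, dr, h ω hi, h ω hj]

theorem SmoothLocal.exists_dependsOn (hf : SmoothLocal f) : ∃ Λ : Finset ℤ, DependsOn f Λ := by
  obtain ⟨Λ, φ, -, h⟩ := hf
  refine ⟨Λ, fun _ _ hω => ?_⟩
  rw [h, h]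
  congr 1 with i : 1
  exact hω i i.2

end Calculus

/-! ### Integration by parts and the sector estimate -/

section Integrals

variable {α κ : Type*} [MeasurableSpace α] [MeasurableSpace κ] {μ : Measure α}

theorem integral_comp_of_measurePreserving {ν : Measure κ} {T : α → κ}
    (hT : MeasurePreserving T μ ν) {f : κ → ℝ} (hf : AEStronglyMeasurable f ν) :
    ∫ x, f (T x) ∂μ = ∫ y, f y ∂ν := by
  rw [← hT.map_eq, integral_map hT.measurable.aemeasurable (by rwa [hT.map_eq])]

theorem integral_eq_zero_of_comp_eq_neg {T : α → α} (hT : MeasurePreserving T μ μ) {f : α → ℝ}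
    (hf : AEStronglyMeasurable f μ) (hneg : ∀ x, f (T x) = -f x) : ∫ x, f x ∂μ = 0 := by
  have h := integral_comp_of_measurePreserving hT hf
  simp only [hneg, integral_neg] at h
  linarith

theorem integrable_mul_of_memLp_two {a b : α → ℝ} (ha : MemLp a 2 μ) (hb : MemLp b 2 μ) :
    Integrable (fun x => a x * b x) μ :=
  ha.integrable_mul hb

theorem inner_toLp_toLp {a b : α → ℝ} (ha : MemLp a 2 μ) (hb : MemLp b 2 μ) :
    inner ℝ (ha.toLp a) (hb.toLp b) = ∫ x, a x * b x ∂μ := by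
  rw [L2.inner_def]
  refine integral_congr_ae ?_
  filter_upwards [ha.coeFn_toLp, hb.coeFn_toLp] with x hax hbx
  simp [hax, hbx, mul_comm]

theorem norm_toLp_eq_sqrt {a : α → ℝ} (ha : MemLp a 2 μ) :
    ‖ha.toLp a‖ = √(∫ x, a x ^ 2 ∂μ) := by
  simp_rw [norm_eq_sqrt_real_inner, inner_toLp_toLp ha ha, sq]

theorem abs_integral_mul_le {a b : α → ℝ} (ha : MemLp a 2 μ) (hb : MemLp b 2 μ) :
    |∫ x, a x * b x ∂μ| ≤ √(∫ x, a x ^ 2 ∂μ) * √(∫ x, b x ^ 2 ∂μ) := by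
  rw [← inner_toLp_toLp ha hb, ← norm_toLp_eq_sqrt ha, ← norm_toLp_eq_sqrt hb]
  exact abs_real_inner_le_norm _ _

theorem integral_half_add_sq_le {a b : α → ℝ} (ha : MemLp a 2 μ) (hb : MemLp b 2 μ) :
    ∫ x, ((a x + b x) / 2) ^ 2 ∂μ ≤ (∫ x, a x ^ 2 ∂μ + ∫ x, b x ^ 2 ∂μ) / 2 := by
  have hsum := ha.integrable_sq.add hb.integrable_sq
  rw [← integral_add ha.integrable_sq hb.integrable_sq, ← integral_div]
  refine integral_mono_of_nonneg (.of_forall fun x => sq_nonneg _) (hsum.div_const 2)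
    (.of_forall fun x => ?_)
  dsimp only
  linarith [sq_nonneg (a x - b x)]

end Integrals

theorem SmoothLocal.aestronglyMeasurable {f : Config → ℝ} (hf : SmoothLocal f)
    (μ : Measure Config) : AEStronglyMeasurable f μ :=
  hf.continuous.aestronglyMeasurable

/-- The smooth local functions in the `L²(ν_β)`-domain of the vector field `Y_{i,j}`. -/
structure MemDomain (V : ℝ → ℝ) (β : ℝ) (i j : ℤ) (f : Config → ℝ) : Prop where
  smoothLocal : SmoothLocal f
  memLp : MemLp f 2 (gibbs V β)
  memLp_Y : MemLp (Y V i j f) 2 (gibbs V β)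

/-- The part of `f` that is even in the momentum `p_i`. -/
def evenPart (i : ℤ) (f : Config → ℝ) : Config → ℝ := fun ω => (f ω + f (flipAt i ω)) / 2

/-- The part of `f` that is odd in the momentum `p_i`. -/
def oddPart (i : ℤ) (f : Config → ℝ) : Config → ℝ := fun ω => (f ω - f (flipAt i ω)) / 2

section Sector

variable {V : ℝ → ℝ} {δm δp β : ℝ} {f g : Config → ℝ} {i j : ℤ}

theorem X_update (hf : SmoothLocal f) (i : ℤ) (ω : Config) (x : ℝ × ℝ) :
    X V i f (Function.update ω i x) =
      hamiltonianDeriv V (fun y => f (Function.update ω i y)) x := by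
  simp [X_eq_hamiltonianDeriv hf]

theorem integral_X_eq_zero (hV : IsConvexPotential V δm δp) (hβ : 0 < β) (hf : SmoothLocal f)
    (hi : Integrable (X V i f) (gibbs V β)) : ∫ ω, X V i f ω ∂(gibbs V β) = 0 := by
  have := hV.isProbabilityMeasure_siteMeasure hβ
  have := hV.isProbabilityMeasure_gibbs hβ
  have hT := measurePreserving_update hV hβ i
  have hiT : Integrable (fun z : Config × (ℝ × ℝ) => X V i f (Function.update z.1 i z.2))
      ((gibbs V β).prod (siteMeasure V β)) := hT.integrable_comp_of_integrable hi
  rw [← integral_comp_of_measurePreserving hT hi.aestronglyMeasurable, integral_prod _ hiT]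
  refine integral_eq_zero_of_ae ?_
  filter_upwards [hiT.prod_right_ae] with ω hω
  simp only [X_update hf] at hω ⊢
  exact integral_hamiltonianDeriv_eq_zero hV ((hf.contDiff_slice ω i).of_le (by simp)) hω

theorem mul_integral_sq_le_integral_X_sq (hV : IsConvexPotential V δm δp) (hβ : 0 < β)
    (hf : MemDomain V β i i f) (hodd : ∀ ω, f (flipAt i ω) = -f ω) :
    δm * ∫ ω, f ω ^ 2 ∂(gibbs V β) ≤ ∫ ω, X V i f ω ^ 2 ∂(gibbs V β) := by
  have := hV.isProbabilityMeasure_siteMeasure hβ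
  have := hV.isProbabilityMeasure_gibbs hβ
  have hT := measurePreserving_update hV hβ i
  have hsq := hf.memLp.integrable_sq
  have hXsq : Integrable (fun ω => X V i f ω ^ 2) (gibbs V β) := hf.memLp_Y.integrable_sq
  have hprod : Integrable (fun z : Config × (ℝ × ℝ) => f (Function.update z.1 i z.2) ^ 2)
      ((gibbs V β).prod (siteMeasure V β)) := hT.integrable_comp_of_integrable hsq
  have hXprod : Integrable (fun z : Config × (ℝ × ℝ) => X V i f (Function.update z.1 i z.2) ^ 2)
      ((gibbs V β).prod (siteMeasure V β)) := hT.integrable_comp_of_integrable hXsq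
  rw [← integral_comp_of_measurePreserving hT hsq.aestronglyMeasurable,
    ← integral_comp_of_measurePreserving hT hXsq.aestronglyMeasurable, integral_prod _ hprod,
    integral_prod _ hXprod, ← integral_const_mul]
  refine integral_mono_ae (hprod.integral_prod_left.const_mul _) hXprod.integral_prod_left ?_
  filter_upwards [hprod.prod_right_ae, hXprod.prod_right_ae] with ω hω hXω
  simp only [X_update hf.smoothLocal] at hXω ⊢
  refine mul_integral_sq_le_integral_hamiltonianDeriv_sq hV hβ
    ((hf.smoothLocal.contDiff_slice ω i).of_le (by simp)) (fun r => ?_) hω hXω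
  have h := hodd (Function.update ω i (0, r))
  simp only [flipAt, flip, Function.update_self, Function.update_idem, neg_zero] at h
  linarith

theorem integral_X_mul (hV : IsConvexPotential V δm δp) (hβ : 0 < β)
    (hf : MemDomain V β i i f) (hg : MemDomain V β i i g) :
    ∫ ω, X V i f ω * g ω ∂(gibbs V β) = -∫ ω, f ω * X V i g ω ∂(gibbs V β) := by
  have hXfg : Integrable (fun ω => X V i f ω * g ω) (gibbs V β) :=
    integrable_mul_of_memLp_two hf.memLp_Y hg.memLp
  have hfXg : Integrable (fun ω => f ω * X V i g ω) (gibbs V β) :=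
    integrable_mul_of_memLp_two hf.memLp hg.memLp_Y
  have leibniz : X V i (f * g) = fun ω => X V i f ω * g ω + f ω * X V i g ω :=
    Y_mul hf.smoothLocal hg.smoothLocal i i
  have h := integral_X_eq_zero (i := i) hV hβ (hf.smoothLocal.mul hg.smoothLocal)
    (by rw [leibniz]; exact hXfg.add hfXg)
  rw [leibniz, integral_add hXfg hfXg] at h
  linarith

theorem evenPart_add_oddPart (i : ℤ) (f : Config → ℝ) (ω : Config) :
    evenPart i f ω + oddPart i f ω = f ω := by
  simp only [evenPart, oddPart]; ring

theorem evenPart_flipAt (i : ℤ) (f : Config → ℝ) (ω : Config) :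
    evenPart i f (flipAt i ω) = evenPart i f ω := by
  simp only [evenPart, flipAt_flipAt]; ring

theorem oddPart_flipAt (i : ℤ) (f : Config → ℝ) (ω : Config) :
    oddPart i f (flipAt i ω) = -oddPart i f ω := by
  simp only [oddPart, flipAt_flipAt]; ring

theorem SmoothLocal.evenPart (hf : SmoothLocal f) (i : ℤ) : SmoothLocal (evenPart i f) :=
  (hf.prodMk (hf.flipAt i)).comp (ψ := fun z => (z.1 + z.2) / 2) (by fun_prop)

theorem SmoothLocal.oddPart (hf : SmoothLocal f) (i : ℤ) : SmoothLocal (oddPart i f) :=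
  (hf.prodMk (hf.flipAt i)).comp (ψ := fun z => (z.1 - z.2) / 2) (by fun_prop)

theorem X_evenPart (hf : SmoothLocal f) (i : ℤ) :
    X V i (evenPart i f) = oddPart i (X V i f) := by
  have half_add : evenPart i f = (1 / 2 : ℝ) • (f + fun ω => f (flipAt i ω)) := by
    ext ω; simp [evenPart]; ring
  ext ω
  have hflip : Y V i i (fun ω => f (flipAt i ω)) ω = -Y V i i f (flipAt i ω) := X_flipAt i f ω
  simp only [half_add, X, Y_smul (hf.add (hf.flipAt i)), Y_add hf (hf.flipAt i), oddPart,
    Pi.smul_apply, Pi.add_apply, smul_eq_mul, hflip]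
  ring

theorem X_oddPart (hf : SmoothLocal f) (i : ℤ) :
    X V i (oddPart i f) = evenPart i (X V i f) := by
  have sub_evenPart : oddPart i f = f - evenPart i f :=
    funext fun ω => by simp only [Pi.sub_apply, ← evenPart_add_oddPart i f ω]; ring
  ext ω
  have h := congrFun (X_evenPart (V := V) hf i) ω
  simp only [X] at h
  simp only [sub_evenPart, X, Y_sub hf (hf.evenPart i), Pi.sub_apply, h,
    ← evenPart_add_oddPart i (Y V i i f) ω]
  ring

theorem memLp_evenPart (hV : IsConvexPotential V δm δp) (hβ : 0 < β)
    (hf : MemLp f 2 (gibbs V β)) : MemLp (evenPart i f) 2 (gibbs V β) := by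
  convert (hf.add
    (hf.comp_measurePreserving (measurePreserving_flipAt hV hβ i))).const_mul 2⁻¹ using 1
  ext ω
  simp [evenPart, div_eq_inv_mul]

theorem memLp_oddPart (hV : IsConvexPotential V δm δp) (hβ : 0 < β)
    (hf : MemLp f 2 (gibbs V β)) : MemLp (oddPart i f) 2 (gibbs V β) := by
  convert (hf.sub
    (hf.comp_measurePreserving (measurePreserving_flipAt hV hβ i))).const_mul 2⁻¹ using 1
  ext ω
  simp [oddPart, div_eq_inv_mul]

theorem integral_evenPart_sq_le (hV : IsConvexPotential V δm δp) (hβ : 0 < β)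
    (hf : MemLp f 2 (gibbs V β)) :
    ∫ ω, evenPart i f ω ^ 2 ∂(gibbs V β) ≤ ∫ ω, f ω ^ 2 ∂(gibbs V β) := by
  have hT := measurePreserving_flipAt hV hβ i
  have h := integral_half_add_sq_le hf (hf.comp_measurePreserving hT)
  simp only [Function.comp_apply,
    integral_comp_of_measurePreserving hT hf.integrable_sq.aestronglyMeasurable] at h
  exact h.trans_eq (add_self_div_two _)

theorem integral_oddPart_sq_le (hV : IsConvexPotential V δm δp) (hβ : 0 < β)
    (hf : MemLp f 2 (gibbs V β)) :
    ∫ ω, oddPart i f ω ^ 2 ∂(gibbs V β) ≤ ∫ ω, f ω ^ 2 ∂(gibbs V β) := by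
  have hT := measurePreserving_flipAt hV hβ i
  have h := integral_half_add_sq_le hf (hf.comp_measurePreserving hT).neg
  simp only [Pi.neg_apply, Function.comp_apply, neg_sq, ← sub_eq_add_neg,
    integral_comp_of_measurePreserving hT hf.integrable_sq.aestronglyMeasurable] at h
  exact h.trans_eq (add_self_div_two _)

theorem MemDomain.evenPart (hV : IsConvexPotential V δm δp) (hβ : 0 < β)
    (hf : MemDomain V β i i f) : MemDomain V β i i (evenPart i f) where
  smoothLocal := hf.smoothLocal.evenPart i
  memLp := memLp_evenPart hV hβ hf.memLp
  memLp_Y := by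
    rw [show Y V i i _ = _ from X_evenPart hf.smoothLocal i]
    exact memLp_oddPart hV hβ hf.memLp_Y

theorem MemDomain.oddPart (hV : IsConvexPotential V δm δp) (hβ : 0 < β)
    (hf : MemDomain V β i i f) : MemDomain V β i i (oddPart i f) where
  smoothLocal := hf.smoothLocal.oddPart i
  memLp := memLp_oddPart hV hβ hf.memLp
  memLp_Y := by
    rw [show Y V i i _ = _ from X_oddPart hf.smoothLocal i]
    exact memLp_evenPart hV hβ hf.memLp_Y

theorem sqrt_integral_oddPart_sq_le (hV : IsConvexPotential V δm δp) (hβ : 0 < β)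
    (hf : MemDomain V β i i f) :
    √(∫ ω, oddPart i f ω ^ 2 ∂(gibbs V β)) ≤ √(∫ ω, X V i f ω ^ 2 ∂(gibbs V β)) / √δm := by
  have poincare := mul_integral_sq_le_integral_X_sq hV hβ (hf.oddPart hV hβ) (oddPart_flipAt i f)
  rw [X_oddPart hf.smoothLocal] at poincare
  rw [← Real.sqrt_div' _ hV.pos.le]
  refine Real.sqrt_le_sqrt ((le_div_iff₀' hV.pos).2 (poincare.trans ?_))
  exact integral_evenPart_sq_le hV hβ hf.memLp_Y

theorem integral_mul_oddPart (hV : IsConvexPotential V δm δp) (hβ : 0 < β)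
    (hf : MemLp f 2 (gibbs V β)) (hg : MemLp g 2 (gibbs V β)) :
    ∫ ω, f ω * oddPart i g ω ∂(gibbs V β) =
      ∫ ω, oddPart i f ω * oddPart i g ω ∂(gibbs V β) := by
  have hgo := memLp_oddPart (i := i) hV hβ hg
  have heven := integrable_mul_of_memLp_two (memLp_evenPart (i := i) hV hβ hf) hgo
  have even_odd : ∫ ω, evenPart i f ω * oddPart i g ω ∂(gibbs V β) = 0 :=
    integral_eq_zero_of_comp_eq_neg (measurePreserving_flipAt hV hβ i) heven.aestronglyMeasurable
      fun ω => by rw [evenPart_flipAt, oddPart_flipAt, mul_neg]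
  have hodd := integrable_mul_of_memLp_two (memLp_oddPart (i := i) hV hβ hf) hgo
  rw [← zero_add (∫ ω, oddPart i f ω * _ ∂_), ← even_odd, ← integral_add heven hodd]
  simp only [← add_mul, evenPart_add_oddPart]

/- Splitting `g` into parts even and odd in `p_i`, the Poincaré inequality bounds the odd part. On
the even part `X_i` is moved to `g`, which makes it odd, so that only the odd part of `f` counts. -/
theorem abs_integral_X_mul_le (hV : IsConvexPotential V δm δp) (hβ : 0 < β)
    (hf : MemDomain V β i i f) (hg : MemDomain V β i i g) :
    |∫ ω, X V i f ω * g ω ∂(gibbs V β)| ≤ 2 / √δm *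
      (√(∫ ω, X V i f ω ^ 2 ∂(gibbs V β)) * √(∫ ω, X V i g ω ^ 2 ∂(gibbs V β))) := by
  have hXf : MemLp (X V i f) 2 (gibbs V β) := hf.memLp_Y
  have hXg : MemLp (X V i g) 2 (gibbs V β) := hg.memLp_Y
  have hge := (hg.evenPart hV hβ).memLp
  have hgo := (hg.oddPart hV hβ).memLp
  have split : ∫ ω, X V i f ω * g ω ∂(gibbs V β) =
      ∫ ω, X V i f ω * oddPart i g ω ∂(gibbs V β) -
        ∫ ω, oddPart i f ω * oddPart i (X V i g) ω ∂(gibbs V β) := by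
    rw [← integral_mul_oddPart hV hβ hf.memLp hXg, ← X_evenPart hg.smoothLocal, sub_eq_add_neg,
      ← integral_X_mul hV hβ hf (hg.evenPart hV hβ),
      ← integral_add (integrable_mul_of_memLp_two hXf hgo) (integrable_mul_of_memLp_two hXf hge)]
    simp only [← mul_add, add_comm (oddPart i g _), evenPart_add_oddPart]
  have odd_le := (abs_integral_mul_le hXf hgo).trans
    (mul_le_mul_of_nonneg_left (sqrt_integral_oddPart_sq_le hV hβ hg) (Real.sqrt_nonneg _))
  have even_le := (abs_integral_mul_le (hf.oddPart hV hβ).memLp (memLp_oddPart hV hβ hXg)).trans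
    (mul_le_mul (sqrt_integral_oddPart_sq_le hV hβ hf)
      (Real.sqrt_le_sqrt (integral_oddPart_sq_le (i := i) hV hβ hXg)) (Real.sqrt_nonneg _)
      (by positivity))
  rw [split]
  refine (abs_sub _ _).trans ((add_le_add odd_le even_le).trans_eq ?_)
  ring

theorem X_comp_slide (i s : ℤ) (f : Config → ℝ) :
    X V i (fun ω => f (slide s ω)) = fun ω => Y V i (i + s) f (slide s ω) :=
  funext fun ω => X_slide i s f ω

theorem MemDomain.slide (hV : IsConvexPotential V δm δp) (hβ : 0 < β)
    (hf : MemDomain V β i j f) : MemDomain V β i i fun ω => f (slide (j - i) ω) := by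
  have hT := measurePreserving_slide hV hβ (j - i)
  refine ⟨hf.smoothLocal.slide _, hf.memLp.comp_measurePreserving hT, ?_⟩
  have hYf := hf.memLp_Y.comp_measurePreserving hT
  rw [show Y V i i _ = _ from X_comp_slide i (j - i) f, add_sub_cancel]
  exact hYf

theorem integral_Y_mul (hV : IsConvexPotential V δm δp) (hβ : 0 < β)
    (hf : MemDomain V β i j f) (hg : MemDomain V β i j g) :
    ∫ ω, Y V i j f ω * g ω ∂(gibbs V β) = -∫ ω, f ω * Y V i j g ω ∂(gibbs V β) := by
  have hT := measurePreserving_slide hV hβ (j - i)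
  have h := integral_X_mul hV hβ (hf.slide hV hβ) (hg.slide hV hβ)
  rw [X_comp_slide, X_comp_slide, add_sub_cancel] at h
  rwa [integral_comp_of_measurePreserving (f := fun ω => Y V i j f ω * g ω) hT
    (hf.memLp_Y.aestronglyMeasurable.mul hg.memLp.aestronglyMeasurable),
    integral_comp_of_measurePreserving (f := fun ω => f ω * Y V i j g ω) hT
    (hf.memLp.aestronglyMeasurable.mul hg.memLp_Y.aestronglyMeasurable)] at h

theorem abs_integral_Y_mul_le (hV : IsConvexPotential V δm δp) (hβ : 0 < β)
    (hf : MemDomain V β i j f) (hg : MemDomain V β i j g) :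
    |∫ ω, Y V i j f ω * g ω ∂(gibbs V β)| ≤ 2 / √δm *
      (√(∫ ω, Y V i j f ω ^ 2 ∂(gibbs V β)) * √(∫ ω, Y V i j g ω ^ 2 ∂(gibbs V β))) := by
  have hT := measurePreserving_slide hV hβ (j - i)
  have h := abs_integral_X_mul_le hV hβ (hf.slide hV hβ) (hg.slide hV hβ)
  rw [X_comp_slide, X_comp_slide, add_sub_cancel] at h
  rwa [integral_comp_of_measurePreserving (f := fun ω => Y V i j f ω * g ω) hT
    (hf.memLp_Y.aestronglyMeasurable.mul hg.memLp.aestronglyMeasurable),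
    integral_comp_of_measurePreserving (f := fun ω => Y V i j f ω ^ 2) hT
    hf.memLp_Y.integrable_sq.aestronglyMeasurable,
    integral_comp_of_measurePreserving (f := fun ω => Y V i j g ω ^ 2) hT
    hg.memLp_Y.integrable_sq.aestronglyMeasurable] at h

end Sector

/-! ### Tame functions -/

/-- Smooth local functions that belong to `L^q(ν_β)` for all `q < ∞`. -/
structure MemAllLp (V : ℝ → ℝ) (β : ℝ) (f : Config → ℝ) : Prop where
  smoothLocal : SmoothLocal f
  memLp : ∀ q : ENNReal, q ≠ ⊤ → MemLp f q (gibbs V β)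

/-- Smooth local functions that belong to all `L^q(ν_β)`, `q < ∞`, together with their derivatives
of order at most `n`: classes stable under products on which the vector fields act. -/
def Tame (V : ℝ → ℝ) (β : ℝ) : ℕ → Set (Config → ℝ)
  | 0 => {f | MemAllLp V β f}
  | n + 1 => {f | MemAllLp V β f ∧ ∀ i, dp i f ∈ Tame V β n ∧ dr i f ∈ Tame V β n}

/-- Smooth local functions with compact support in the coordinates on which they depend. -/
def CompactLocal (f : Config → ℝ) : Prop :=
  ∃ (Λ : Finset ℤ) (φ : (Λ → ℝ × ℝ) → ℝ),
    ContDiff ℝ (⊤ : ℕ∞) φ ∧ HasCompactSupport φ ∧ ∀ ω, f ω = φ fun i => ω i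

section Coordinates

variable (k i : ℤ) (u : ℝ → ℝ)

theorem dp_comp_momentum :
    dp i (fun ω => u (ω k).1) = fun ω => if k = i then deriv u (ω k).1 else 0 := by
  ext ω
  rcases eq_or_ne k i with rfl | h <;> simp [dp, *]

theorem dr_comp_momentum : dr i (fun ω => u (ω k).1) = fun _ => 0 := by
  ext ω
  rcases eq_or_ne k i with rfl | h <;> simp [dr, *]

theorem dp_comp_position : dp i (fun ω => u (ω k).2) = fun _ => 0 := by
  ext ω
  rcases eq_or_ne k i with rfl | h <;> simp [dp, *]

theorem dr_comp_position :
    dr i (fun ω => u (ω k).2) = fun ω => if k = i then deriv u (ω k).2 else 0 := by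
  ext ω
  rcases eq_or_ne k i with rfl | h <;> simp [dr, *]

end Coordinates

theorem abs_le_one_add_sq (r : ℝ) : |r| ≤ 1 + r ^ 2 := by
  rw [abs_le]
  constructor <;> nlinarith

theorem IsConvexPotential.exists_abs_deriv_le_sq {V : ℝ → ℝ} {δm δp : ℝ}
    (hV : IsConvexPotential V δm δp) : ∃ a b, ∀ r, |deriv V r| ≤ a + b * r ^ 2 := by
  refine ⟨|deriv V 0| + δp, δp, fun r => ?_⟩
  have hδ : 0 ≤ δp := hV.pos.le.trans ((hV.lower 0).trans (hV.upper 0))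
  nlinarith [hV.abs_deriv_le r, abs_le_one_add_sq r]

theorem IsConvexPotential.exists_abs_le_sq {V : ℝ → ℝ} {δm δp : ℝ}
    (hV : IsConvexPotential V δm δp) : ∃ a b, ∀ r, |V r| ≤ a + b * r ^ 2 := by
  refine ⟨|V 0| + |deriv V 0|, |deriv V 0| + δp, fun r => ?_⟩
  have hδ : 0 ≤ δp := hV.pos.le.trans ((hV.lower 0).trans (hV.upper 0))
  have mean_value : |V r - V 0| ≤ (|deriv V 0| + δp * |r|) * |r - 0| :=
    (convex_Icc (-|r|) |r|).norm_image_sub_le_of_norm_deriv_le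
      (fun x _ => hV.differentiable x)
      (fun x hx => (hV.abs_deriv_le x).trans
        (add_le_add_right (mul_le_mul_of_nonneg_left (abs_le.2 hx) hδ) _))
      ⟨by simp, by simp⟩ ⟨neg_abs_le r, le_abs_self r⟩
  rw [sub_zero, add_mul, mul_assoc, abs_mul_abs_self] at mean_value
  nlinarith [abs_sub_abs_le_abs_sub (V r) (V 0),
    mul_le_mul_of_nonneg_left (abs_le_one_add_sq r) (abs_nonneg (deriv V 0))]

namespace MemAllLp

variable {V : ℝ → ℝ} {δm δp β : ℝ} {f g : Config → ℝ}

theorem add (hf : MemAllLp V β f) (hg : MemAllLp V β g) : MemAllLp V β (f + g) :=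
  ⟨hf.smoothLocal.add hg.smoothLocal, fun q hq => (hf.memLp q hq).add (hg.memLp q hq)⟩

theorem smul (hf : MemAllLp V β f) (c : ℝ) : MemAllLp V β (c • f) :=
  ⟨hf.smoothLocal.smul c, fun q hq => (hf.memLp q hq).const_smul c⟩

theorem mul (hf : MemAllLp V β f) (hg : MemAllLp V β g) : MemAllLp V β (f * g) := by
  refine ⟨hf.smoothLocal.mul hg.smoothLocal, fun q hq => ?_⟩
  have two_mul_ne_top : 2 * q ≠ ⊤ := ENNReal.mul_ne_top (by simp) hq
  have : ENNReal.HolderTriple (2 * q) (2 * q) q := ⟨by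
    rw [ENNReal.mul_inv (.inl two_ne_zero) (.inl (by simp)), ← two_mul, ← mul_assoc,
      ENNReal.mul_inv_cancel two_ne_zero (by simp), one_mul]⟩
  exact (hg.memLp _ two_mul_ne_top).mul (hf.memLp _ two_mul_ne_top)

theorem const (hV : IsConvexPotential V δm δp) (hβ : 0 < β) (c : ℝ) :
    MemAllLp V β fun _ => c := by
  have := hV.isProbabilityMeasure_gibbs hβ
  exact ⟨SmoothLocal.const c, fun q _ => memLp_const c⟩

theorem momentum (hV : IsConvexPotential V δm δp) (hβ : 0 < β) (k : ℤ) :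
    MemAllLp V β fun ω => (ω k).1 :=
  ⟨smoothLocal_momentum k, fun _ hq =>
    (memLp_fst_siteMeasure hV hβ hq).comp_measurePreserving (measurePreserving_eval hV hβ k)⟩

theorem position (hV : IsConvexPotential V δm δp) (hβ : 0 < β) (k : ℤ) :
    MemAllLp V β fun ω => (ω k).2 :=
  ⟨smoothLocal_position k, fun _ hq =>
    (memLp_snd_siteMeasure hV hβ hq).comp_measurePreserving (measurePreserving_eval hV hβ k)⟩

theorem comp_position (hV : IsConvexPotential V δm δp) (hβ : 0 < β) (k : ℤ) {u : ℝ → ℝ}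
    (hu : ContDiff ℝ (⊤ : ℕ∞) u) {a b : ℝ} (hb : ∀ r, |u r| ≤ a + b * r ^ 2) :
    MemAllLp V β fun ω => u (ω k).2 := by
  have hr := position hV hβ k
  have majorant := (const hV hβ a).add ((hr.mul hr).smul b)
  have hs := (smoothLocal_position k).comp hu
  refine ⟨hs, fun q hq =>
    (majorant.memLp q hq).mono (hs.aestronglyMeasurable _) (.of_forall fun ω => ?_)⟩
  refine (hb _).trans ((le_abs_self _).trans_eq ?_)
  simp [sq]

end MemAllLp

namespace Tame

variable {V : ℝ → ℝ} {δm δp β : ℝ} {f g : Config → ℝ} {n : ℕ}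

theorem memAllLp (hf : f ∈ Tame V β n) : MemAllLp V β f := by
  cases n with
  | zero => exact hf
  | succ n => exact hf.1

theorem smoothLocal (hf : f ∈ Tame V β n) : SmoothLocal f := (memAllLp hf).smoothLocal

theorem memLp_two (hf : f ∈ Tame V β n) : MemLp f 2 (gibbs V β) := (memAllLp hf).memLp 2 (by simp)

theorem of_succ (hf : f ∈ Tame V β (n + 1)) : f ∈ Tame V β n := by
  induction n generalizing f with
  | zero => exact hf.1
  | succ n ih => exact ⟨hf.1, fun i => ⟨ih (hf.2 i).1, ih (hf.2 i).2⟩⟩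

theorem add (hf : f ∈ Tame V β n) (hg : g ∈ Tame V β n) : f + g ∈ Tame V β n := by
  induction n generalizing f g with
  | zero => exact MemAllLp.add hf hg
  | succ n ih =>
    refine ⟨hf.1.add hg.1, fun i => ?_⟩
    rw [dp_add (smoothLocal hf) (smoothLocal hg), dr_add (smoothLocal hf) (smoothLocal hg)]
    exact ⟨ih (hf.2 i).1 (hg.2 i).1, ih (hf.2 i).2 (hg.2 i).2⟩

theorem smul (hf : f ∈ Tame V β n) (c : ℝ) : c • f ∈ Tame V β n := by
  induction n generalizing f with
  | zero => exact MemAllLp.smul hf c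
  | succ n ih =>
    refine ⟨hf.1.smul c, fun i => ?_⟩
    rw [dp_smul (smoothLocal hf), dr_smul (smoothLocal hf)]
    exact ⟨ih (hf.2 i).1, ih (hf.2 i).2⟩

theorem sub (hf : f ∈ Tame V β n) (hg : g ∈ Tame V β n) : f - g ∈ Tame V β n := by
  rw [sub_eq_add_neg, ← neg_one_smul ℝ]
  exact add hf (smul hg (-1))

theorem mul (hf : f ∈ Tame V β n) (hg : g ∈ Tame V β n) : f * g ∈ Tame V β n := by
  induction n generalizing f g with
  | zero => exact MemAllLp.mul hf hg
  | succ n ih =>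
    refine ⟨hf.1.mul hg.1, fun i => ?_⟩
    rw [dp_mul (smoothLocal hf) (smoothLocal hg), dr_mul (smoothLocal hf) (smoothLocal hg)]
    exact ⟨add (ih (hf.2 i).1 (of_succ hg)) (ih (of_succ hf) (hg.2 i).1),
      add (ih (hf.2 i).2 (of_succ hg)) (ih (of_succ hf) (hg.2 i).2)⟩

theorem const (hV : IsConvexPotential V δm δp) (hβ : 0 < β) (c : ℝ) :
    (fun _ => c : Config → ℝ) ∈ Tame V β n := by
  induction n generalizing c with
  | zero => exact MemAllLp.const hV hβ c
  | succ n ih =>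
    refine ⟨MemAllLp.const hV hβ c, fun i => ?_⟩
    have hdp : dp i (fun _ => c : Config → ℝ) = fun _ => 0 := by ext ω; simp [dp]
    have hdr : dr i (fun _ => c : Config → ℝ) = fun _ => 0 := by ext ω; simp [dr]
    rw [hdp, hdr]
    exact ⟨ih 0, ih 0⟩

theorem momentum (hV : IsConvexPotential V δm δp) (hβ : 0 < β) (k : ℤ) :
    (fun ω => (ω k).1 : Config → ℝ) ∈ Tame V β n := by
  cases n with
  | zero => exact MemAllLp.momentum hV hβ k
  | succ n =>
    refine ⟨MemAllLp.momentum hV hβ k, fun i => ?_⟩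
    rw [dp_comp_momentum k i fun p => p, dr_comp_momentum k i fun p => p]
    simp only [deriv_id'']
    exact ⟨const hV hβ _, const hV hβ _⟩

theorem comp_position (hV : IsConvexPotential V δm δp) (hβ : 0 < β) (k : ℤ) {u : ℝ → ℝ}
    (hu : ContDiff ℝ (⊤ : ℕ∞) u) {a b : ℝ} (hb : ∀ r, |u r| ≤ a + b * r ^ 2)
    (hd : (fun ω => deriv u (ω k).2 : Config → ℝ) ∈ Tame V β n) :
    (fun ω => u (ω k).2 : Config → ℝ) ∈ Tame V β (n + 1) := by
  refine ⟨MemAllLp.comp_position hV hβ k hu hb, fun i => ?_⟩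
  rw [dp_comp_position, dr_comp_position]
  refine ⟨const hV hβ 0, ?_⟩
  split_ifs
  exacts [hd, const hV hβ 0]

theorem position (hV : IsConvexPotential V δm δp) (hβ : 0 < β) (k : ℤ) :
    (fun ω => (ω k).2 : Config → ℝ) ∈ Tame V β 1 := by
  refine comp_position hV hβ k (u := fun r => r) (a := 1) (b := 1) contDiff_id (fun r => ?_) ?_
  · simpa using abs_le_one_add_sq r
  · simp only [deriv_id'']
    exact const hV hβ 1

theorem force (hV : IsConvexPotential V δm δp) (hβ : 0 < β) (k : ℤ) :
    (fun ω => deriv V (ω k).2 : Config → ℝ) ∈ Tame V β 1 := by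
  obtain ⟨a, b, hab⟩ := hV.exists_abs_deriv_le_sq
  refine comp_position hV hβ k hV.contDiff_deriv hab
    (MemAllLp.comp_position hV hβ k (hV.contDiff_deriv.iterate_deriv 1) (a := δp) (b := 0)
      fun r => ?_)
  simp only [abs_of_nonneg (hV.pos.le.trans (hV.lower r)), zero_mul, add_zero]
  exact hV.upper r

theorem energy (hV : IsConvexPotential V δm δp) (hβ : 0 < β) (k : ℤ) :
    energy V k ∈ Tame V β 1 := by
  obtain ⟨a, b, hab⟩ := hV.exists_abs_le_sq
  have kinetic := smul (mul (momentum hV hβ k) (momentum hV hβ k)) (1 / 2) (n := 1)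
  have potential := comp_position hV hβ k hV.smooth hab (of_succ (force hV hβ k))
  convert add kinetic potential using 1
  ext ω
  simp [EnergyChain.energy]; ring

theorem Y (hV : IsConvexPotential V δm δp) (hβ : 0 < β) (hf : f ∈ Tame V β (n + 1)) (hn : n ≤ 1)
    (i j : ℤ) : Y V i j f ∈ Tame V β n := by
  have hforce : (fun ω => deriv V (ω j).2 : Config → ℝ) ∈ Tame V β n := by
    interval_cases n
    · exact of_succ (force hV hβ j)
    · exact force hV hβ j
  exact sub (mul (momentum hV hβ i) (hf.2 j).2) (mul hforce (hf.2 i).1)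

theorem memLp_Y (hV : IsConvexPotential V δm δp) (hβ : 0 < β) (hf : f ∈ Tame V β 1) (i j : ℤ) :
    MemLp (EnergyChain.Y V i j f) 2 (gibbs V β) :=
  memLp_two (Y hV hβ hf zero_le_one i j)

theorem memDomain (hV : IsConvexPotential V δm δp) (hβ : 0 < β) (hf : f ∈ Tame V β 1) (i j : ℤ) :
    MemDomain V β i j f :=
  ⟨smoothLocal hf, memLp_two hf, memLp_Y hV hβ hf i j⟩

theorem mem_spaceCTilde (hV : IsConvexPotential V δm δp) (hβ : 0 < β) (hf : f ∈ Tame V β 1) :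
    f ∈ spaceCTilde V β :=
  ⟨smoothLocal hf, memLp_two hf, fun i => ⟨memLp_Y hV hβ hf i i, memLp_Y hV hβ hf i (i + 1)⟩⟩

end Tame

namespace CompactLocal

variable {V : ℝ → ℝ} {δm δp β : ℝ} {f : Config → ℝ}

theorem zero : CompactLocal 0 := ⟨∅, 0, contDiff_const, .zero, fun _ => rfl⟩

theorem smoothLocal (hf : CompactLocal f) : SmoothLocal f := by
  obtain ⟨Λ, φ, hφ, -, hfφ⟩ := hf
  exact ⟨Λ, φ, hφ, hfφ⟩

theorem exists_bound (hf : CompactLocal f) : ∃ C, ∀ ω, |f ω| ≤ C := by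
  obtain ⟨Λ, φ, hφ, hsupp, hfφ⟩ := hf
  obtain ⟨C, hC⟩ := hφ.continuous.bounded_above_of_compact_support hsupp
  exact ⟨C, fun ω => by rw [hfφ]; exact hC _⟩

theorem fderiv_slice (hf : CompactLocal f) (i : ℤ) (v : ℝ × ℝ) :
    CompactLocal fun ω => fderiv ℝ (fun x => f (Function.update ω i x)) (ω i) v := by
  obtain ⟨Λ, φ, hφ, hsupp, hfφ⟩ := hf
  by_cases hi : i ∈ Λ
  · refine ⟨Λ, fun y => fderiv ℝ φ y (Pi.single ⟨i, hi⟩ v),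
      (hφ.fderiv_right (m := (⊤ : ℕ∞)) (by simp)).clm_apply contDiff_const, ?_,
      fun ω => fderiv_slice_apply hφ hfφ hi ω v⟩
    refine (hsupp.fderiv (𝕜 := ℝ)).mono fun x hx => ?_
    contrapose! hx
    simp only [Function.mem_support, ne_eq, not_not] at hx ⊢
    simp [hx]
  · have slice_const (ω : Config) : (fun x => f (Function.update ω i x)) = fun _ => f ω := by
      ext x
      rw [hfφ, hfφ]
      congr 1 with k : 1
      exact Function.update_of_ne (ne_of_mem_of_not_mem k.2 hi) _ _
    simp only [slice_const, fderiv_fun_const]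
    exact zero

theorem dp (hf : CompactLocal f) (i : ℤ) : CompactLocal (dp i f) := by
  rw [show EnergyChain.dp i f = _ from funext fun ω => dp_eq_fderiv hf.smoothLocal i ω]
  exact hf.fderiv_slice i _

theorem dr (hf : CompactLocal f) (i : ℤ) : CompactLocal (dr i f) := by
  rw [show EnergyChain.dr i f = _ from funext fun ω => dr_eq_fderiv hf.smoothLocal i ω]
  exact hf.fderiv_slice i _

theorem memAllLp (hV : IsConvexPotential V δm δp) (hβ : 0 < β) (hf : CompactLocal f) :
    MemAllLp V β f := by
  have := hV.isProbabilityMeasure_gibbs hβ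
  obtain ⟨C, hC⟩ := hf.exists_bound
  exact ⟨hf.smoothLocal, fun q _ =>
    .of_bound (hf.smoothLocal.aestronglyMeasurable _) C (.of_forall hC)⟩

theorem tame (hV : IsConvexPotential V δm δp) (hβ : 0 < β) (hf : CompactLocal f) (n : ℕ) :
    f ∈ Tame V β n := by
  induction n generalizing f with
  | zero => exact hf.memAllLp hV hβ
  | succ n ih => exact ⟨hf.memAllLp hV hβ, fun i => ⟨ih (hf.dp i), ih (hf.dr i)⟩⟩

end CompactLocal

/-! ### Formal sums over translates and their pairings -/

/-- `Y_{0,s} Γ_g` for the formal sum `Γ_g = ∑_j τ_j g`; the cases `s = 0, 1` are `XGamma` and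
`YGamma`, and `X_i`, `Y_{i,i+1}` are likewise treated together as `Y_{i,i+s}`. -/
def ZGamma (V : ℝ → ℝ) (s : ℤ) (g : Config → ℝ) : Config → ℝ := fun ω =>
  ∑ᶠ j : ℤ, Y V 0 s (shift j g) ω

theorem XGamma_eq (V : ℝ → ℝ) (g : Config → ℝ) : XGamma V g = ZGamma V 0 g := rfl

theorem YGamma_eq (V : ℝ → ℝ) (g : Config → ℝ) : YGamma V g = ZGamma V 1 g := rfl

/-- A window of `g` is a set `M` of sites outside which `X_k` and `Y_{k,k+1}` annihilate `g`, so
that `M` carries the sums over sites of these derivatives of `g`. -/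
def IsWindow (V : ℝ → ℝ) (M : Finset ℤ) (g : Config → ℝ) : Prop :=
  ∀ s : ℤ, s = 0 ∨ s = 1 → ∀ k ∉ M, Y V k (k + s) g = 0

/-- The sum of the translates `τ_{-k} g` for `k` in `M`, a truncation of `Γ_g`. -/
def truncGamma (M : Finset ℤ) (g : Config → ℝ) : Config → ℝ := ∑ k ∈ M, shift (-k) g

/-- The energy current `p_0 V'(r_1)`, up to the sign. -/
def current (V : ℝ → ℝ) : Config → ℝ := fun ω => (ω 0).1 * deriv V (ω 1).2

section Gamma

variable {V : ℝ → ℝ} {δm δp β : ℝ} {f g F : Config → ℝ} {M : Finset ℤ} {s : ℤ}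

theorem isWindow_of_dependsOn {Λ : Finset ℤ} (hg : DependsOn g Λ) :
    IsWindow V (Λ ∪ Λ.map (addRightEmbedding (-1))) g := by
  intro s hs k hk
  rw [Finset.mem_union, not_or] at hk
  refine Y_eq_zero_of_dependsOn hg hk.1 ?_
  rcases hs with rfl | rfl
  · simpa using hk.1
  · exact fun h => hk.2 (Finset.mem_map.2 ⟨k + 1, h, by simp⟩)

theorem SmoothLocal.exists_isWindow (hg : SmoothLocal g) : ∃ M, IsWindow V M g := by
  obtain ⟨Λ, hΛ⟩ := hg.exists_dependsOn
  exact ⟨_, isWindow_of_dependsOn hΛ⟩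

theorem IsWindow.mono {M' : Finset ℤ} (h : IsWindow V M g) (hM : M ⊆ M') : IsWindow V M' g :=
  fun s hs k hk => h s hs k fun hk' => hk (hM hk')

theorem Y_zero_shift_neg (k s : ℤ) (g : Config → ℝ) :
    Y V 0 s (shift (-k) g) = shift (-k) (Y V k (k + s) g) := by
  rw [← Y_shift]
  simp

theorem shift_zero (k : ℤ) : shift k 0 = 0 := rfl

theorem ZGamma_eq_sum (h : IsWindow V M g) (hs : s = 0 ∨ s = 1) :
    ZGamma V s g = ∑ k ∈ M, shift (-k) (Y V k (k + s) g) := by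
  ext ω
  rw [ZGamma, ← finsum_comp_equiv (Equiv.neg ℤ), Finset.sum_apply]
  simp only [Equiv.neg_apply, Y_zero_shift_neg]
  refine finsum_eq_sum_of_support_subset _ fun k hk => ?_
  by_contra hkM
  exact hk (by simp only [h s hs k hkM, shift_zero, Pi.zero_apply])

theorem Y_truncGamma (hg : SmoothLocal g) (h : IsWindow V M g) (hs : s = 0 ∨ s = 1) :
    Y V 0 s (truncGamma M g) = ZGamma V s g := by
  rw [ZGamma_eq_sum h hs, truncGamma, Y_sum _ fun k => hg.shift _]
  simp only [Y_zero_shift_neg]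

theorem integral_shift (hV : IsConvexPotential V δm δp) (hβ : 0 < β) (k : ℤ)
    (hf : AEStronglyMeasurable f (gibbs V β)) :
    ∫ ω, shift k f ω ∂(gibbs V β) = ∫ ω, f ω ∂(gibbs V β) :=
  integral_comp_of_measurePreserving (measurePreserving_shift hV hβ k) hf

theorem memLp_shift (hV : IsConvexPotential V δm δp) (hβ : 0 < β) (k : ℤ) {q : ENNReal}
    (hf : MemLp f q (gibbs V β)) : MemLp (shift k f) q (gibbs V β) :=
  hf.comp_measurePreserving (measurePreserving_shift hV hβ k)

theorem MemDomain.shift (hV : IsConvexPotential V δm δp) (hβ : 0 < β) {i j : ℤ}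
    (hF : MemDomain V β i j F) (k : ℤ) : MemDomain V β (i + k) (j + k) (shift k F) :=
  ⟨hF.smoothLocal.shift k, memLp_shift hV hβ k hF.memLp, by
    rw [Y_shift]; exact memLp_shift hV hβ k hF.memLp_Y⟩

theorem memDomain_truncGamma (hV : IsConvexPotential V δm δp) (hβ : 0 < β)
    (hg : g ∈ Tame V β 1) (h : IsWindow V M g) (hs : s = 0 ∨ s = 1) :
    MemDomain V β 0 s (truncGamma M g) where
  smoothLocal := SmoothLocal.sum M fun k _ => (Tame.smoothLocal hg).shift (-k)
  memLp := memLp_finsetSum' M fun k _ => memLp_shift hV hβ (-k) (Tame.memLp_two hg)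
  memLp_Y := by
    rw [Y_truncGamma (Tame.smoothLocal hg) h hs, ZGamma_eq_sum h hs]
    exact memLp_finsetSum' M fun k _ => memLp_shift hV hβ (-k) (Tame.memLp_Y hV hβ hg _ _)

theorem memLp_ZGamma (hV : IsConvexPotential V δm δp) (hβ : 0 < β) (hg : g ∈ Tame V β 1)
    (hs : s = 0 ∨ s = 1) : MemLp (ZGamma V s g) 2 (gibbs V β) := by
  obtain ⟨M, hM⟩ := (Tame.smoothLocal hg).exists_isWindow (V := V)
  rw [← Y_truncGamma (Tame.smoothLocal hg) hM hs]
  exact (memDomain_truncGamma hV hβ hg hM hs).memLp_Y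

theorem integral_mul_shift_Y (hV : IsConvexPotential V δm δp) (hβ : 0 < β) (hg : g ∈ Tame V β 1)
    {i : ℤ} (hF : MemDomain V β i (i + s) F) (k : ℤ) :
    ∫ ω, g ω * shift k (Y V i (i + s) F) ω ∂(gibbs V β) =
      -∫ ω, shift (-(i + k)) (Y V (i + k) (i + k + s) g) ω * shift (-i) F ω ∂(gibbs V β) := by
  have hYg := Tame.memDomain hV hβ hg (i + k) (i + s + k)
  have hFk := hF.shift hV hβ k
  have translate := integral_shift hV hβ (-(i + k))
    (hYg.memLp_Y.aestronglyMeasurable.mul hFk.memLp.aestronglyMeasurable)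
  have by_parts := integral_Y_mul hV hβ hYg hFk
  rw [Y_shift] at by_parts
  have shift_neg : shift (-(i + k)) (shift k F) = shift (-i) F := by
    rw [shift_shift]; congr 1; ring
  have shift_mul : shift (-(i + k)) (Y V (i + k) (i + s + k) g * shift k F) =
      fun ω => shift (-(i + k)) (Y V (i + k) (i + s + k) g) ω * shift (-i) F ω := by
    rw [← shift_neg]; rfl
  rw [shift_mul] at translate
  rw [add_right_comm i k s, translate]
  simp only [Pi.mul_apply, by_parts, neg_neg]

theorem support_pairStar_finite (hV : IsConvexPotential V δm δp) (hβ : 0 < β) (hg : g ∈ Tame V β 1)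
    {i : ℤ} (hF : MemDomain V β i (i + s) F) (hs : s = 0 ∨ s = 1) :
    (Function.support fun k : ℤ =>
      ∫ ω, g ω * shift k (Y V i (i + s) F) ω ∂(gibbs V β)).Finite := by
  obtain ⟨M, hM⟩ := (Tame.smoothLocal hg).exists_isWindow (V := V)
  refine (M.finite_toSet.preimage (add_right_injective i).injOn).subset fun k hk => ?_
  by_contra hkM
  exact hk (by simp [integral_mul_shift_Y hV hβ hg hF, hM s hs (i + k) hkM, shift_zero])

theorem pairStar_Y (hV : IsConvexPotential V δm δp) (hβ : 0 < β) (hg : g ∈ Tame V β 1)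
    {i : ℤ} (hF : MemDomain V β i (i + s) F) (hs : s = 0 ∨ s = 1) :
    pairStar V β g (Y V i (i + s) F) =
      -∫ ω, ZGamma V s g ω * shift (-i) F ω ∂(gibbs V β) := by
  obtain ⟨M, hM⟩ := (Tame.smoothLocal hg).exists_isWindow (V := V)
  rw [pairStar, ← finsum_comp_equiv (Equiv.addLeft (-i))]
  simp only [Equiv.coe_addLeft, integral_mul_shift_Y hV hβ hg hF, add_neg_cancel_left]
  rw [finsum_eq_sum_of_support_subset (s := M), Finset.sum_neg_distrib, ZGamma_eq_sum hM hs,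
    ← integral_finsetSum]
  · simp [Finset.sum_mul]
  · exact fun k _ => integrable_mul_of_memLp_two (memLp_shift hV hβ _ (Tame.memLp_Y hV hβ hg _ _))
      (memLp_shift hV hβ _ hF.memLp)
  · intro k hk
    by_contra hkM
    exact hk (by simp [hM s hs k hkM, shift_zero])

theorem memLp_current (hV : IsConvexPotential V δm δp) (hβ : 0 < β) :
    MemLp (current V) 2 (gibbs V β) :=
  Tame.memLp_two (Tame.mul (Tame.momentum hV hβ 0) (Tame.of_succ (Tame.force hV hβ 1)))

theorem Y_energy (hV : IsConvexPotential V δm δp) (i j k : ℤ) (ω : Config) :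
    Y V i j (energy V k) ω =
      ((if k = j then 1 else 0) - (if k = i then 1 else 0)) * ((ω i).1 * deriv V (ω j).2) := by
  have kinetic : SmoothLocal fun ω => (ω k).1 ^ 2 / 2 :=
    (smoothLocal_momentum k).comp (ψ := fun p => p ^ 2 / 2) (by fun_prop)
  have potential := (smoothLocal_position k).comp hV.smooth
  have split : energy V k = (fun ω => (ω k).1 ^ 2 / 2) + fun ω => V (ω k).2 := rfl
  rw [Y, split, dp_add kinetic potential, dr_add kinetic potential,
    dp_comp_momentum k i fun p => p ^ 2 / 2, dr_comp_momentum k j fun p => p ^ 2 / 2,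
    dp_comp_position, dr_comp_position]
  rcases eq_or_ne k i with rfl | hi <;> rcases eq_or_ne k j with rfl | hj <;> simp [*] <;> ring

theorem mul_integral_Y_mul_energy (hV : IsConvexPotential V δm δp) (hβ : 0 < β)
    {i : ℤ} (hF : MemDomain V β i (i + s) F) (k : ℤ) :
    (k : ℝ) * ∫ ω, Y V i (i + s) F ω * energy V k ω ∂(gibbs V β) =
      -k * ((if k = i + s then 1 else 0) - (if k = i then 1 else 0)) *
        ∫ ω, F ω * ((ω i).1 * deriv V (ω (i + s)).2) ∂(gibbs V β) := by
  rw [integral_Y_mul hV hβ hF (Tame.memDomain hV hβ (Tame.energy hV hβ k) _ _), mul_neg,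
    mul_assoc, neg_mul]
  simp only [Y_energy hV, mul_left_comm (F _), integral_const_mul]

theorem support_pairStarStar_subset (hV : IsConvexPotential V δm δp) (hβ : 0 < β)
    {i : ℤ} (hF : MemDomain V β i (i + s) F) :
    (Function.support fun k : ℤ =>
      (k : ℝ) * ∫ ω, Y V i (i + s) F ω * energy V k ω ∂(gibbs V β)) ⊆
        ({i, i + s} : Finset ℤ) := by
  intro k hk
  by_contra h
  simp only [Finset.coe_insert, Finset.coe_singleton, Set.mem_insert_iff,
    Set.mem_singleton_iff, not_or] at h
  exact hk (by simp [mul_integral_Y_mul_energy hV hβ hF, h.1, h.2])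

theorem pairStarStar_X (hV : IsConvexPotential V δm δp) (hβ : 0 < β) {i : ℤ}
    (hF : MemDomain V β i (i + 0) F) : pairStarStar V β (Y V i (i + 0) F) = 0 := by
  simp only [pairStarStar, mul_integral_Y_mul_energy hV hβ hF]
  simp

theorem pairStarStar_Y (hV : IsConvexPotential V δm δp) (hβ : 0 < β) {i : ℤ}
    (hF : MemDomain V β i (i + 1) F) :
    pairStarStar V β (Y V i (i + 1) F) =
      -∫ ω, current V ω * shift (-i) F ω ∂(gibbs V β) := by
  have translate := integral_shift hV hβ i ((memLp_current hV hβ).aestronglyMeasurable.mul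
    (memLp_shift hV hβ (-i) hF.memLp).aestronglyMeasurable)
  have shift_mul : shift i (current V * shift (-i) F) =
      fun ω => F ω * ((ω i).1 * deriv V (ω (i + 1)).2) := by
    ext ω
    simp [shift, current, add_comm 1 i, mul_comm (F ω)]
  rw [shift_mul] at translate
  rw [pairStarStar,
    finsum_eq_sum_of_support_subset _ (support_pairStarStar_subset hV hβ hF),
    Finset.sum_pair (by simp), mul_integral_Y_mul_energy hV hβ hF,
    mul_integral_Y_mul_energy hV hβ hF, translate]
  simp
  ring

end Gamma

/-! ### Perturbation of the range of a linear map -/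

theorem eq_zero_of_mem_closure_of_norm_le {H : Type*} [NormedAddCommGroup H] {S : Set H} {η : H}
    {A : ℝ} (hη : η ∈ closure S) (h : ∀ x ∈ S, ‖η‖ ≤ A * ‖x - η‖) : η = 0 := by
  have hclosed : IsClosed {x : H | ‖η‖ ≤ A * ‖x - η‖} :=
    isClosed_le continuous_const (by fun_prop)
  have hle : ‖η‖ ≤ A * ‖η - η‖ := closure_minimal h hclosed hη
  simpa using hle

section Hilbert

variable {H : Type*} [NormedAddCommGroup H] [InnerProductSpace ℝ H]

theorem isLUB_quadratic {γ : ℝ} (hγ : 0 < γ) {S : Set H} {κ : H}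
    (hκ : (2 / γ) • κ ∈ closure S) :
    IsLUB {x : ℝ | ∃ w ∈ S, x = 2 * inner ℝ w κ - γ / 2 * ‖w‖ ^ 2} (2 / γ * ‖κ‖ ^ 2) := by
  have complete_square (w : H) : 2 * inner ℝ w κ - γ / 2 * ‖w‖ ^ 2 =
      2 / γ * ‖κ‖ ^ 2 - γ / 2 * ‖w - (2 / γ) • κ‖ ^ 2 := by
    rw [norm_sub_sq_real, inner_smul_right, norm_smul, mul_pow,
      Real.norm_of_nonneg (by positivity)]
    field_simp
    ring
  constructor
  · rintro _ ⟨w, -, rfl⟩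
    rw [complete_square]
    exact sub_le_self _ (by positivity)
  · intro b hb
    have hclosed : IsClosed {w : H | 2 * inner ℝ w κ - γ / 2 * ‖w‖ ^ 2 ≤ b} :=
      isClosed_le (by fun_prop) continuous_const
    have hle : 2 * inner ℝ ((2 / γ) • κ) κ - γ / 2 * ‖(2 / γ) • κ‖ ^ 2 ≤ b :=
      closure_minimal (fun w hw => hb ⟨w, hw, rfl⟩) hclosed hκ
    simpa [complete_square] using hle

theorem eq_zero_of_mem_topologicalClosure_of_mem_orthogonal {W : Submodule ℝ H} {y : H}
    (hy : y ∈ W.topologicalClosure) (hWy : y ∈ Wᗮ) : y = 0 := by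
  rw [← Submodule.mem_bot ℝ, ← W.topologicalClosure.inf_orthogonal_eq_bot]
  exact ⟨hy, W.orthogonal_closure ▸ hWy⟩

theorem topologicalClosure_sup_span_singleton_le (W : Submodule ℝ H) (e : H) :
    (W ⊔ Submodule.span ℝ {e}).topologicalClosure ≤
      W.topologicalClosure ⊔ Submodule.span ℝ {e} :=
  Submodule.topologicalClosure_minimal _ (sup_le_sup_right W.le_topologicalClosure _)
    (Submodule.isClosed_sup_finiteDimensional _ _ W.isClosed_topologicalClosure)

theorem topologicalClosure_sup_span_le {W N : Submodule ℝ H} {e x : H}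
    (hx : x ∈ (W ⊔ Submodule.span ℝ {e}).topologicalClosure) (hWx : x ∈ Wᗮ) (hx0 : x ≠ 0)
    (hN : IsClosed (N : Set H)) (hWN : W ≤ N) (hxN : x ∈ N) :
    (W ⊔ Submodule.span ℝ {e}).topologicalClosure ≤ N := by
  obtain ⟨k, hk, _, hz, hsum⟩ :=
    Submodule.mem_sup.1 (topologicalClosure_sup_span_singleton_le W e hx)
  obtain ⟨t, rfl⟩ := Submodule.mem_span_singleton.1 hz
  have ht : t ≠ 0 := by
    rintro rfl
    rw [zero_smul, add_zero] at hsum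
    exact hx0 (eq_zero_of_mem_topologicalClosure_of_mem_orthogonal (hsum ▸ hk) hWx)
  have hkN : k ∈ N := Submodule.topologicalClosure_minimal _ hWN hN hk
  have heN : e ∈ N := by
    rw [← N.smul_mem_iff ht, ← N.add_mem_iff_right hkN, hsum]
    exact hxN
  exact Submodule.topologicalClosure_minimal _
    (sup_le hWN ((Submodule.span_singleton_le_iff_mem _ _).2 heN)) hN

theorem mem_of_mem_sup_span_of_inner_eq_zero {K : Submodule ℝ H} {ξ η : H} (hξK : ξ ∈ Kᗮ)
    (hξη : inner ℝ ξ η = 0) (hη : η ∈ K ⊔ Submodule.span ℝ {ξ}) : η ∈ K := by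
  obtain ⟨σ, hσ, _, hz, rfl⟩ := Submodule.mem_sup.1 hη
  obtain ⟨t, rfl⟩ := Submodule.mem_span_singleton.1 hz
  rw [inner_add_right, (K.mem_orthogonal' ξ).1 hξK σ hσ, zero_add, inner_smul_right,
    mul_eq_zero, inner_self_eq_zero] at hξη
  rcases hξη with rfl | rfl <;> simpa using hσ

theorem existsUnique_add_smul_mem {M : Submodule ℝ H} {ξ : H}
    (hM : IsCompl M (Submodule.span ℝ {ξ})) (hξ : ξ ≠ 0) (x : H) : ∃! a : ℝ, x + a • ξ ∈ M := by
  have hx : x ∈ M ⊔ Submodule.span ℝ {ξ} := hM.sup_eq_top ▸ Submodule.mem_top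
  obtain ⟨m, hm, _, hz, rfl⟩ := Submodule.mem_sup.1 hx
  obtain ⟨t, rfl⟩ := Submodule.mem_span_singleton.1 hz
  refine ⟨-t, by simpa using hm, fun b hb => ?_⟩
  have hmem : (t + b) • ξ ∈ M := by
    rw [← M.add_mem_iff_right hm, add_smul, ← add_assoc]
    exact hb
  by_contra hne
  have htb : t + b ≠ 0 := fun h => hne (eq_neg_of_add_eq_zero_right h)
  exact (Submodule.disjoint_span_singleton' hξ).1 hM.disjoint ((M.smul_mem_iff htb).1 hmem)

variable {G : Type*} [AddCommGroup G] [Module ℝ G] {s l : G →ₗ[ℝ] H} {C : ℝ}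

theorem eq_zero_of_mem_closure_range_of_mem_orthogonal {ξ : H}
    (hξ : ξ ∈ (LinearMap.range l).topologicalClosure) (horth : ξ ∈ (LinearMap.range s)ᗮ)
    (hdiag : ∀ g, inner ℝ (s g) (l g) = ‖s g‖ ^ 2) (hC : 0 ≤ C)
    (hbound : ∀ g, ‖l g‖ ≤ C * ‖s g‖) : ξ = 0 := by
  refine eq_zero_of_mem_closure_of_norm_le (A := 1 + C) hξ ?_
  rintro _ ⟨g, rfl⟩
  have hsg : ‖s g‖ ^ 2 ≤ ‖s g‖ * ‖l g - ξ‖ := by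
    rw [← hdiag g, ← sub_zero (inner ℝ (s g) (l g)), ← horth (s g) ⟨g, rfl⟩, ← inner_sub_right]
    exact real_inner_le_norm _ _
  have hsg' : ‖s g‖ ≤ ‖l g - ξ‖ := by
    by_contra! hlt
    nlinarith [norm_nonneg (l g - ξ)]
  calc ‖ξ‖ = ‖l g - (l g - ξ)‖ := by rw [sub_sub_cancel]
    _ ≤ ‖l g‖ + ‖l g - ξ‖ := norm_sub_le _ _
    _ ≤ C * ‖l g - ξ‖ + ‖l g - ξ‖ := by gcongr; exact (hbound g).trans (by gcongr)
    _ = (1 + C) * ‖l g - ξ‖ := by ring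

theorem eq_zero_of_mem_orthogonal_range_of_mem_closure {σ : H}
    (hσ : σ ∈ (LinearMap.range s).topologicalClosure) (horth : σ ∈ (LinearMap.range l)ᗮ)
    (hdiag : ∀ g, inner ℝ (s g) (l g) = ‖s g‖ ^ 2) (hC : 0 ≤ C)
    (hbound : ∀ g, ‖l g‖ ≤ C * ‖s g‖) : σ = 0 := by
  refine eq_zero_of_mem_closure_of_norm_le (A := 1 + C) hσ ?_
  rintro _ ⟨g, rfl⟩
  have hsg : ‖s g‖ ^ 2 ≤ ‖s g - σ‖ * (C * ‖s g‖) := by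
    have hσl : inner ℝ σ (l g) = 0 := real_inner_comm σ (l g) ▸ horth (l g) ⟨g, rfl⟩
    rw [← hdiag g, ← sub_zero (inner ℝ (s g) (l g)), ← hσl, ← inner_sub_left]
    exact (real_inner_le_norm _ _).trans (by gcongr; exact hbound g)
  have hsg' : ‖s g‖ ≤ C * ‖s g - σ‖ := by
    by_contra! hlt
    nlinarith [mul_nonneg hC (norm_nonneg (s g - σ))]
  calc ‖σ‖ = ‖s g - (s g - σ)‖ := by rw [sub_sub_cancel]
    _ ≤ ‖s g‖ + ‖s g - σ‖ := norm_sub_le _ _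
    _ ≤ (1 + C) * ‖s g - σ‖ := by linarith

theorem isCompl_closure_range [CompleteSpace H] {ξ : H} (hξ : ξ ≠ 0)
    (horth : ξ ∈ (LinearMap.range s)ᗮ)
    (hdense : (LinearMap.range s ⊔ Submodule.span ℝ {ξ}).topologicalClosure = ⊤)
    (hdiag : ∀ g, inner ℝ (s g) (l g) = ‖s g‖ ^ 2) (hC : 0 ≤ C)
    (hbound : ∀ g, ‖l g‖ ≤ C * ‖s g‖) :
    IsCompl (LinearMap.range l).topologicalClosure (Submodule.span ℝ {ξ}) := by
  refine ⟨(Submodule.disjoint_span_singleton' hξ).2 fun hmem => hξ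
    (eq_zero_of_mem_closure_range_of_mem_orthogonal hmem horth hdiag hC hbound),
    codisjoint_iff.2 ?_⟩
  have hclosed : IsClosed (((LinearMap.range l).topologicalClosure ⊔ Submodule.span ℝ {ξ} :
      Submodule ℝ H) : Set H) :=
    Submodule.isClosed_sup_finiteDimensional _ _ (Submodule.isClosed_topologicalClosure _)
  have := hclosed.completeSpace_coe
  rw [← Submodule.orthogonal_eq_bot_iff, eq_bot_iff]
  intro η hη
  rw [← Submodule.inf_orthogonal] at hη
  have hη_mem : η ∈ (LinearMap.range s).topologicalClosure ⊔ Submodule.span ℝ {ξ} :=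
    topologicalClosure_sup_span_singleton_le _ _ (hdense ▸ Submodule.mem_top)
  have hησ := mem_of_mem_sup_span_of_inner_eq_zero
    (Submodule.orthogonal_closure (LinearMap.range s) ▸ horth)
    (hη.2 ξ (Submodule.mem_span_singleton_self ξ)) hη_mem
  have hηl : η ∈ (LinearMap.range l)ᗮ := by simpa using hη.1
  exact eq_zero_of_mem_orthogonal_range_of_mem_closure hησ hηl hdiag hC hbound

end Hilbert

section Completion

variable {E : Type*} [AddCommGroup E] [Module ℝ E] {B : E → E → ℝ} (hB : IsSemiInner B)

theorem inner_toCompletion (x y : E) :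
    inner ℝ (toCompletion hB x) (toCompletion hB y) = B x y :=
  UniformSpace.Completion.inner_coe (𝕜 := ℝ) (E := PreHilbert hB) x y

theorem norm_sq_toCompletion (x : E) : ‖toCompletion hB x‖ ^ 2 = B x x := by
  rw [← real_inner_self_eq_norm_sq, inner_toCompletion]

theorem denseRange_toCompletion : DenseRange (toCompletion hB) :=
  UniformSpace.Completion.denseRange_coe (α := PreHilbert hB)

theorem isSemiInner_of_inner {H : Type*} [NormedAddCommGroup H] [InnerProductSpace ℝ H]
    (κ : E →ₗ[ℝ] H) {c : ℝ} (hc : 0 ≤ c) (h : ∀ x y, B x y = c * inner ℝ (κ x) (κ y)) :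
    IsSemiInner B where
  symm x y := by rw [h, h, real_inner_comm]
  add_left x y z := by rw [h, h, h, map_add, inner_add_left, mul_add]
  smul_left a x y := by rw [h, h, map_smul, real_inner_smul_left]; ring
  nonneg x := by rw [h]; exact mul_nonneg hc real_inner_self_nonneg

end Completion

/-! ### Approximation by compactly supported functions -/

section Dilation

theorem dp_comp_smul (c : ℝ) (χ : Config → ℝ) (i : ℤ) (ω : Config) :
    dp i (fun ω => χ (c • ω)) ω = c * dp i χ (c • ω) := by
  have smul_update (x : ℝ) : c • Function.update ω i (x, (ω i).2) =
      Function.update (c • ω) i (c * x, ((c • ω) i).2) := by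
    ext k : 1
    rcases eq_or_ne k i with rfl | hk <;> simp [*]
  simp only [dp, smul_update]
  exact deriv_comp_mul_left c
    (fun y : ℝ => χ (Function.update (c • ω) i (y, ((c • ω) i).2))) (ω i).1

theorem dr_comp_smul (c : ℝ) (χ : Config → ℝ) (i : ℤ) (ω : Config) :
    dr i (fun ω => χ (c • ω)) ω = c * dr i χ (c • ω) := by
  have smul_update (x : ℝ) : c • Function.update ω i ((ω i).1, x) =
      Function.update (c • ω) i (((c • ω) i).1, c * x) := by
    ext k : 1
    rcases eq_or_ne k i with rfl | hk <;> simp [*]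
  simp only [dr, smul_update]
  exact deriv_comp_mul_left c
    (fun y : ℝ => χ (Function.update (c • ω) i (((c • ω) i).1, y))) (ω i).2

theorem CompactLocal.exists_abs_Y_comp_smul_le (V : ℝ → ℝ) {χ : Config → ℝ} (hχ : CompactLocal χ)
    (i j : ℤ) : ∃ K, 0 ≤ K ∧ ∀ c : ℝ, 0 ≤ c → ∀ ω : Config,
      |Y V i j (fun ω => χ (c • ω)) ω| ≤ c * (K * (|(ω i).1| + |deriv V (ω j).2|)) := by
  obtain ⟨K₁, hK₁⟩ := (hχ.dp i).exists_bound
  obtain ⟨K₂, hK₂⟩ := (hχ.dr j).exists_bound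
  have hK₁0 := (abs_nonneg _).trans (hK₁ 0)
  have hK₂0 := (abs_nonneg _).trans (hK₂ 0)
  refine ⟨K₁ + K₂, by positivity, fun c hc ω => ?_⟩
  have hdp : |EnergyChain.dp i χ (c • ω)| ≤ K₁ + K₂ := (hK₁ _).trans (by linarith)
  have hdr : |EnergyChain.dr j χ (c • ω)| ≤ K₁ + K₂ := (hK₂ _).trans (by linarith)
  rw [Y, dp_comp_smul, dr_comp_smul]
  calc |(ω i).1 * (c * EnergyChain.dr j χ (c • ω))
        - deriv V (ω j).2 * (c * EnergyChain.dp i χ (c • ω))|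
      ≤ |(ω i).1| * (c * |EnergyChain.dr j χ (c • ω)|)
        + |deriv V (ω j).2| * (c * |EnergyChain.dp i χ (c • ω)|) := by
        refine (abs_sub _ _).trans_eq ?_
        simp only [abs_mul, abs_of_nonneg hc]
    _ ≤ |(ω i).1| * (c * (K₁ + K₂)) + |deriv V (ω j).2| * (c * (K₁ + K₂)) := by gcongr
    _ = c * ((K₁ + K₂) * (|(ω i).1| + |deriv V (ω j).2|)) := by ring

end Dilation

section Cutoff

/-- A bump function in the coordinates of `Λ`, equal to `1` near the origin. -/
def unitCutoff (Λ : Finset ℤ) (ω : Config) : ℝ :=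
  (⟨1, 2, one_pos, one_lt_two⟩ : ContDiffBump (0 : Λ → ℝ × ℝ)) fun i => ω i

/-- The cutoff `unitCutoff Λ` dilated by the factor `n + 1`; these cutoffs tend to `1`. -/
def cutoff (Λ : Finset ℤ) (n : ℕ) (ω : Config) : ℝ := unitCutoff Λ ((1 / ((n : ℝ) + 1)) • ω)

variable {V : ℝ → ℝ} {δm δp β : ℝ} (Λ : Finset ℤ) (n : ℕ) (ω : Config)

theorem compactLocal_unitCutoff : CompactLocal (unitCutoff Λ) :=
  ⟨Λ, _, ContDiffBump.contDiff _, ContDiffBump.hasCompactSupport _, fun _ => rfl⟩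

theorem unitCutoff_zero : unitCutoff Λ 0 = 1 :=
  ContDiffBump.one_of_mem_closedBall _ (Metric.mem_closedBall_self zero_le_one)

theorem exists_profile_cutoff : ∃ θ : (Λ → ℝ × ℝ) → ℝ, ContDiff ℝ (⊤ : ℕ∞) θ ∧
    HasCompactSupport θ ∧ ∀ ω, cutoff Λ n ω = θ fun i => ω i := by
  let bump : ContDiffBump (0 : Λ → ℝ × ℝ) := ⟨1, 2, one_pos, one_lt_two⟩
  exact ⟨fun y => bump ((1 / ((n : ℝ) + 1)) • y), bump.contDiff.comp (contDiff_id.const_smul _),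
    bump.hasCompactSupport.comp_smul (by positivity), fun _ => rfl⟩

theorem compactLocal_cutoff : CompactLocal (cutoff Λ n) := ⟨Λ, exists_profile_cutoff Λ n⟩

theorem cutoff_nonneg : 0 ≤ cutoff Λ n ω := ContDiffBump.nonneg _

theorem cutoff_le_one : cutoff Λ n ω ≤ 1 := ContDiffBump.le_one _

theorem abs_cutoff_le_one : |cutoff Λ n ω| ≤ 1 :=
  (abs_of_nonneg (cutoff_nonneg Λ n ω)).trans_le (cutoff_le_one Λ n ω)

theorem abs_one_sub_cutoff_le_one : |1 - cutoff Λ n ω| ≤ 1 := by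
  rw [abs_le]
  constructor <;> linarith [cutoff_nonneg Λ n ω, cutoff_le_one Λ n ω]

theorem tendsto_cutoff : Tendsto (fun n => cutoff Λ n ω) atTop (𝓝 1) := by
  have tendsto_smul : Tendsto (fun n : ℕ => (1 / ((n : ℝ) + 1)) • ω) atTop (𝓝 0) := by
    simpa using (tendsto_one_div_add_atTop_nhds_zero_nat (𝕜 := ℝ)).smul_const ω
  have tendsto_zero :=
    ((compactLocal_unitCutoff Λ).smoothLocal.continuous.tendsto 0).comp tendsto_smul
  rwa [unitCutoff_zero] at tendsto_zero

variable {Λ}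

theorem integrable_mul_cutoff {ν : Measure Config} {f : Config → ℝ} (hf : Integrable f ν) :
    Integrable (f * cutoff Λ n) ν :=
  hf.mul_bdd ((compactLocal_cutoff Λ n).smoothLocal.aestronglyMeasurable ν)
    (.of_forall fun ω => abs_cutoff_le_one Λ n ω)

theorem tendsto_integral_mul_cutoff {ν : Measure Config} {f : Config → ℝ} (hf : Integrable f ν) :
    Tendsto (fun n => ∫ ω, (f * cutoff Λ n) ω ∂ν) atTop (𝓝 (∫ ω, f ω ∂ν)) := by
  refine tendsto_integral_of_dominated_convergence (fun ω => ‖f ω‖)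
    (fun n => (integrable_mul_cutoff n hf).aestronglyMeasurable) hf.norm
    (fun n => .of_forall fun ω => ?_) (.of_forall fun ω => ?_)
  · rw [Pi.mul_apply, norm_mul]
    exact mul_le_of_le_one_right (norm_nonneg _) (abs_cutoff_le_one Λ n ω)
  · simpa using (tendsto_cutoff Λ ω).const_mul (f ω)

theorem exists_integral_cutoff_ne_zero {ν : Measure Config} [IsProbabilityMeasure ν] :
    ∃ N, ∫ ω, cutoff Λ N ω ∂ν ≠ 0 := by
  have tendsto_one := tendsto_integral_mul_cutoff (Λ := Λ) (integrable_const (μ := ν) (1 : ℝ))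
  simp only [integral_const, probReal_univ, smul_eq_mul, mul_one, Pi.mul_apply, one_mul]
    at tendsto_one
  exact (tendsto_one.eventually_ne one_ne_zero).exists

theorem Y_sub_mul_cutoff {f : Config → ℝ} (hf : SmoothLocal f) (i j : ℤ) :
    Y V i j (f - f * cutoff Λ n) ω =
      (1 - cutoff Λ n ω) * Y V i j f ω - f ω * Y V i j (cutoff Λ n) ω := by
  have hχ := (compactLocal_cutoff Λ n).smoothLocal
  rw [Y_sub hf (hf.mul hχ), Y_mul hf hχ]
  simp only [Pi.sub_apply, Pi.add_apply, Pi.mul_apply]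
  ring

variable (Λ) in
theorem exists_abs_Y_cutoff_le (V : ℝ → ℝ) (i j : ℤ) : ∃ K, 0 ≤ K ∧ ∀ n ω,
    |Y V i j (cutoff Λ n) ω| ≤
      1 / ((n : ℝ) + 1) * (K * (|(ω i).1| + |deriv V (ω j).2|)) := by
  obtain ⟨K, hK0, hK⟩ := (compactLocal_unitCutoff Λ).exists_abs_Y_comp_smul_le V i j
  exact ⟨K, hK0, fun n => hK _ (by positivity)⟩

theorem tendsto_Y_sub_mul_cutoff {f : Config → ℝ} (hf : SmoothLocal f) (i j : ℤ) :
    Tendsto (fun n => Y V i j (f - f * cutoff Λ n) ω) atTop (𝓝 0) := by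
  obtain ⟨K, -, hK⟩ := exists_abs_Y_cutoff_le Λ V i j
  have tendsto_Y_cutoff : Tendsto (fun n => Y V i j (cutoff Λ n) ω) atTop (𝓝 0) :=
    squeeze_zero_norm (fun n => hK n ω) <| by
      simpa only [zero_mul] using (tendsto_one_div_add_atTop_nhds_zero_nat (𝕜 := ℝ)).mul_const
        (K * (|(ω i).1| + |deriv V (ω j).2|))
  simp only [Y_sub_mul_cutoff _ _ hf]
  simpa using (((tendsto_cutoff Λ ω).const_sub 1).mul_const (Y V i j f ω)).sub
    (tendsto_Y_cutoff.const_mul (f ω))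

theorem exists_memLp_bound_Y_sub_mul_cutoff (hV : IsConvexPotential V δm δp) (hβ : 0 < β)
    {f : Config → ℝ} (hf : f ∈ Tame V β 1) (i j : ℤ) :
    ∃ b : Config → ℝ, MemLp b 2 (gibbs V β) ∧
      ∀ n ω, |Y V i j (f - f * cutoff Λ n) ω| ≤ b ω := by
  obtain ⟨K, hK0, hK⟩ := exists_abs_Y_cutoff_le Λ V i j
  have hYf := Tame.memLp_Y hV hβ hf i j
  have hfp := Tame.memLp_two (Tame.mul (Tame.of_succ hf) (Tame.momentum hV hβ i))
  have hfV := Tame.memLp_two (Tame.mul (Tame.of_succ hf) (Tame.of_succ (Tame.force hV hβ j)))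
  refine ⟨fun ω => |Y V i j f ω| + K * (|f ω * (ω i).1| + |f ω * deriv V (ω j).2|),
    hYf.abs.add ((hfp.abs.add hfV.abs).const_mul K), fun n ω => ?_⟩
  have hcn : 1 / ((n : ℝ) + 1) ≤ 1 := div_le_one_of_le₀ (by simp) (by positivity)
  have hYχ : |Y V i j (cutoff Λ n) ω| ≤ K * (|(ω i).1| + |deriv V (ω j).2|) :=
    (hK n ω).trans (mul_le_of_le_one_left (by positivity) hcn)
  rw [Y_sub_mul_cutoff n ω (Tame.smoothLocal hf)]
  calc |(1 - cutoff Λ n ω) * Y V i j f ω - f ω * Y V i j (cutoff Λ n) ω|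
      ≤ |1 - cutoff Λ n ω| * |Y V i j f ω| + |f ω| * |Y V i j (cutoff Λ n) ω| := by
        rw [← abs_mul, ← abs_mul]
        exact abs_sub _ _
    _ ≤ 1 * |Y V i j f ω| + |f ω| * (K * (|(ω i).1| + |deriv V (ω j).2|)) := by
        gcongr
        exact abs_one_sub_cutoff_le_one Λ n ω
    _ = |Y V i j f ω| + K * (|f ω * (ω i).1| + |f ω * deriv V (ω j).2|) := by
        simp only [abs_mul]
        ring

end Cutoff

section Truncation

/-- The truncation of `f` by the `n`-th cutoff, made centred by subtracting a multiple of the fixed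
cutoff `cutoff Λ N`, whose average must not vanish. -/
def centredTruncation (V : ℝ → ℝ) (β : ℝ) (Λ : Finset ℤ) (N : ℕ) (f : Config → ℝ) (n : ℕ) :
    Config → ℝ :=
  f * cutoff Λ n -
    ((∫ ω, (f * cutoff Λ n) ω ∂(gibbs V β)) / ∫ ω, cutoff Λ N ω ∂(gibbs V β)) • cutoff Λ N

variable {V : ℝ → ℝ} {δm δp β : ℝ} {Λ : Finset ℤ} {N : ℕ} {f : Config → ℝ}
  {φ : (Λ → ℝ × ℝ) → ℝ}

theorem SmoothLocal.centredTruncation (hf : SmoothLocal f) (n : ℕ) :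
    SmoothLocal (centredTruncation V β Λ N f n) :=
  (hf.mul (compactLocal_cutoff Λ n).smoothLocal).sub ((compactLocal_cutoff Λ N).smoothLocal.smul _)

theorem centredTruncation_mem_spaceC (hV : IsConvexPotential V δm δp) (hβ : 0 < β)
    (hf : f ∈ Tame V β 1) (hφ : ContDiff ℝ (⊤ : ℕ∞) φ) (hfφ : ∀ ω, f ω = φ fun i => ω i)
    (hN : ∫ ω, cutoff Λ N ω ∂(gibbs V β) ≠ 0) (n : ℕ) :
    centredTruncation V β Λ N f n ∈ spaceC V β := by
  have := hV.isProbabilityMeasure_gibbs hβ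
  obtain ⟨θ, hθ, hθc, hθn⟩ := exists_profile_cutoff Λ n
  obtain ⟨η, hη, hηc, hηN⟩ := exists_profile_cutoff Λ N
  have hfχ := integrable_mul_cutoff (Λ := Λ) n
    ((Tame.memLp_two hf).integrable one_le_two)
  have hχN : Integrable (cutoff Λ N) (gibbs V β) :=
    (Tame.memLp_two ((compactLocal_cutoff Λ N).tame hV hβ 0)).integrable one_le_two
  let coefficient : ℝ :=
    (∫ ω, (f * cutoff Λ n) ω ∂(gibbs V β)) / ∫ ω, cutoff Λ N ω ∂(gibbs V β)
  refine ⟨⟨Λ, _, (hφ.mul hθ).sub (contDiff_const.smul hη),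
    hθc.mul_left.sub (hηc.smul_left (f := fun _ => coefficient)), fun ω => ?_⟩, ?_⟩
  · change f ω * cutoff Λ n ω - coefficient * cutoff Λ N ω = _
    rw [hfφ, hθn, hηN]
    rfl
  · rw [centredTruncation]
    simp only [Pi.sub_apply, Pi.smul_apply, smul_eq_mul]
    rw [integral_sub hfχ (hχN.const_mul _), integral_const_mul, div_mul_cancel₀ _ hN, sub_self]

theorem dependsOn_sub_centredTruncation (hf : DependsOn f Λ) (n : ℕ) :
    DependsOn (f - centredTruncation V β Λ N f n) Λ := by
  have dependsOn_cutoff (k : ℕ) : DependsOn (cutoff Λ k) Λ := fun x y h => by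
    obtain ⟨θ, -, -, hθ⟩ := exists_profile_cutoff Λ k
    rw [hθ, hθ]
    exact congrArg θ (funext fun i => h i i.2)
  intro x y h
  simp only [centredTruncation, Pi.sub_apply, Pi.mul_apply, Pi.smul_apply, hf h,
    dependsOn_cutoff _ h]

theorem tendsto_integral_sq_zero {ν : Measure Config} {u : ℕ → Config → ℝ} {b : Config → ℝ}
    (hu : ∀ n, AEStronglyMeasurable (u n) ν) (hb : MemLp b 2 ν) (hle : ∀ n ω, |u n ω| ≤ b ω)
    (hlim : ∀ ω, Tendsto (fun n => u n ω) atTop (𝓝 0)) :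
    Tendsto (fun n => ∫ ω, u n ω ^ 2 ∂ν) atTop (𝓝 0) := by
  have htendsto := tendsto_integral_of_dominated_convergence (μ := ν)
    (F := fun n ω => u n ω ^ 2) (f := fun _ => (0 : ℝ)) (fun ω => b ω ^ 2)
    (fun n => (hu n).pow 2) hb.integrable_sq (fun n => .of_forall fun ω => ?_)
    (.of_forall fun ω => by simpa using (hlim ω).pow 2)
  · simpa using htendsto
  · rw [norm_pow]
    exact pow_le_pow_left₀ (norm_nonneg _) (hle n ω) 2

theorem tendsto_integral_Y_sub_centredTruncation (hV : IsConvexPotential V δm δp) (hβ : 0 < β)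
    (hf : f ∈ Tame V β 1) (hf0 : ∫ ω, f ω ∂(gibbs V β) = 0) (i j : ℤ) :
    Tendsto (fun n => ∫ ω, Y V i j (f - centredTruncation V β Λ N f n) ω ^ 2 ∂(gibbs V β))
      atTop (𝓝 0) := by
  have := hV.isProbabilityMeasure_gibbs hβ
  have hfs := Tame.smoothLocal hf
  have hχ (n : ℕ) := (compactLocal_cutoff Λ n).smoothLocal
  let a (n : ℕ) : ℝ :=
    (∫ ω, (f * cutoff Λ n) ω ∂(gibbs V β)) / ∫ ω, cutoff Λ N ω ∂(gibbs V β)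
  have ha : Tendsto a atTop (𝓝 0) := by
    simpa only [hf0, zero_div] using (tendsto_integral_mul_cutoff (Λ := Λ)
      ((Tame.memLp_two hf).integrable one_le_two)).div_const (∫ ω, cutoff Λ N ω ∂(gibbs V β))
  have remainder (n : ℕ) (ω : Config) : Y V i j (f - centredTruncation V β Λ N f n) ω =
      Y V i j (f - f * cutoff Λ n) ω + a n * Y V i j (cutoff Λ N) ω := by
    have hsub : f - centredTruncation V β Λ N f n = f - f * cutoff Λ n + a n • cutoff Λ N :=
      (sub_add _ _ _).symm
    rw [hsub, Y_add (hfs.sub (hfs.mul (hχ n))) ((hχ N).smul _), Y_smul (hχ N)]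
    rfl
  obtain ⟨A, hA⟩ := ha.abs.bddAbove_range
  obtain ⟨b, hb, hle⟩ := exists_memLp_bound_Y_sub_mul_cutoff (Λ := Λ) hV hβ hf i j
  have hYχ := Tame.memLp_Y hV hβ ((compactLocal_cutoff Λ N).tame hV hβ 1) i j
  refine tendsto_integral_sq_zero (b := fun ω => b ω + A * |Y V i j (cutoff Λ N) ω|)
    (fun n => ((hfs.sub (hfs.centredTruncation n)).Y hV i j).aestronglyMeasurable _)
    (hb.add (hYχ.abs.const_mul A)) (fun n ω => ?_) fun ω => ?_
  · rw [remainder]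
    refine (abs_add_le _ _).trans (add_le_add (hle n ω) ?_)
    rw [abs_mul]
    exact mul_le_mul_of_nonneg_right (hA ⟨n, rfl⟩) (abs_nonneg _)
  · simp only [remainder]
    simpa using (tendsto_Y_sub_mul_cutoff ω hfs i j).add (ha.mul_const (Y V i j (cutoff Λ N) ω))

theorem exists_approximation (hV : IsConvexPotential V δm δp) (hβ : 0 < β) (hf : f ∈ Tame V β 1)
    (hf0 : ∫ ω, f ω ∂(gibbs V β) = 0) :
    ∃ (g : ℕ → Config → ℝ) (M : Finset ℤ), (∀ n, g n ∈ spaceC V β) ∧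
      (∀ n, IsWindow V M (f - g n)) ∧
      ∀ i j, Tendsto (fun n => ∫ ω, Y V i j (f - g n) ω ^ 2 ∂(gibbs V β)) atTop (𝓝 0) := by
  have := hV.isProbabilityMeasure_gibbs hβ
  obtain ⟨Λ, φ, hφ, hfφ⟩ := Tame.smoothLocal hf
  have hfΛ : DependsOn f Λ := fun x y h => by
    rw [hfφ, hfφ]
    exact congrArg φ (funext fun i => h i i.2)
  obtain ⟨N, hN⟩ := exists_integral_cutoff_ne_zero (Λ := Λ) (ν := gibbs V β)
  exact ⟨centredTruncation V β Λ N f, _,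
    centredTruncation_mem_spaceC hV hβ hf hφ hfφ hN,
    fun n => isWindow_of_dependsOn (dependsOn_sub_centredTruncation hfΛ n),
    tendsto_integral_Y_sub_centredTruncation hV hβ hf hf0⟩

end Truncation

/-! ### Representation of the pairings in `L² ⊕ L²` -/

/-- The class in `L²(ν_β)` of a square integrable function; every other function is sent to `0`. -/
def l2 (V : ℝ → ℝ) (β : ℝ) (f : Config → ℝ) : Lp ℝ 2 (gibbs V β) :=
  open scoped Classical in if h : MemLp f 2 (gibbs V β) then h.toLp f else 0

/-- The Hilbert space `L²(ν_β) ⊕ L²(ν_β)`, in which the test vectors and the elements of `𝒞₀` are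
represented. -/
abbrev PairL2 (V : ℝ → ℝ) (β : ℝ) : Type :=
  WithLp 2 (Lp ℝ 2 (gibbs V β) × Lp ℝ 2 (gibbs V β))

/-- The element of `L²(ν_β) ⊕ L²(ν_β)` with components `u` and `v`. -/
def pairL2 {V : ℝ → ℝ} {β : ℝ} (u v : Lp ℝ 2 (gibbs V β)) : PairL2 V β := WithLp.toLp 2 (u, v)

section L2

variable {V : ℝ → ℝ} {β : ℝ} {f g : Config → ℝ}

theorem l2_eq_toLp (hf : MemLp f 2 (gibbs V β)) : l2 V β f = hf.toLp f := dif_pos hf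

theorem l2_add (hf : MemLp f 2 (gibbs V β)) (hg : MemLp g 2 (gibbs V β)) :
    l2 V β (f + g) = l2 V β f + l2 V β g := by
  rw [l2_eq_toLp hf, l2_eq_toLp hg, l2_eq_toLp (hf.add hg), MemLp.toLp_add]

theorem l2_smul (hf : MemLp f 2 (gibbs V β)) (c : ℝ) : l2 V β (c • f) = c • l2 V β f := by
  rw [l2_eq_toLp hf, l2_eq_toLp (hf.const_smul c), MemLp.toLp_const_smul]

theorem l2_sum {ι : Type*} (s : Finset ι) {f : ι → Config → ℝ}
    (hf : ∀ k, MemLp (f k) 2 (gibbs V β)) : l2 V β (∑ k ∈ s, f k) = ∑ k ∈ s, l2 V β (f k) := by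
  classical
  induction s using Finset.induction_on with
  | empty => exact (l2_eq_toLp .zero).trans (MemLp.toLp_zero _)
  | insert a s ha ih =>
    rw [Finset.sum_insert ha, Finset.sum_insert ha,
      l2_add (hf a) (memLp_finsetSum' s fun k _ => hf k), ih]

theorem inner_l2 (hf : MemLp f 2 (gibbs V β)) (hg : MemLp g 2 (gibbs V β)) :
    inner ℝ (l2 V β f) (l2 V β g) = ∫ ω, f ω * g ω ∂(gibbs V β) := by
  rw [l2_eq_toLp hf, l2_eq_toLp hg, inner_toLp_toLp]

theorem norm_l2 (hf : MemLp f 2 (gibbs V β)) :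
    ‖l2 V β f‖ = √(∫ ω, f ω ^ 2 ∂(gibbs V β)) := by
  rw [l2_eq_toLp hf, norm_toLp_eq_sqrt]

theorem norm_l2_sq (hf : MemLp f 2 (gibbs V β)) :
    ‖l2 V β f‖ ^ 2 = ∫ ω, f ω ^ 2 ∂(gibbs V β) := by
  rw [norm_l2 hf, Real.sq_sqrt (integral_nonneg fun ω => sq_nonneg (f ω))]

theorem inner_pairL2 (u v u' v' : Lp ℝ 2 (gibbs V β)) :
    inner ℝ (pairL2 u v) (pairL2 u' v') = inner ℝ u u' + inner ℝ v v' :=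
  WithLp.prod_inner_apply _ _

theorem norm_sq_pairL2 (u v : Lp ℝ 2 (gibbs V β)) :
    ‖pairL2 u v‖ ^ 2 = ‖u‖ ^ 2 + ‖v‖ ^ 2 :=
  WithLp.prod_norm_sq_eq_of_L2 _

theorem pairL2_add (u v u' v' : Lp ℝ 2 (gibbs V β)) :
    pairL2 (u + u') (v + v') = pairL2 u v + pairL2 u' v' := rfl

theorem pairL2_smul (c : ℝ) (u v : Lp ℝ 2 (gibbs V β)) :
    pairL2 (c • u) (c • v) = c • pairL2 u v := rfl

theorem pairL2_sum {ι : Type*} (s : Finset ι) (u v : ι → Lp ℝ 2 (gibbs V β)) :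
    pairL2 (∑ k ∈ s, u k) (∑ k ∈ s, v k) = ∑ k ∈ s, pairL2 (u k) (v k) := by
  classical
  induction s using Finset.induction_on with
  | empty => rfl
  | insert a s ha ih => simp only [Finset.sum_insert ha, pairL2_add, ih]

theorem norm_pairL2_le (u v : Lp ℝ 2 (gibbs V β)) : ‖pairL2 u v‖ ≤ ‖u‖ + ‖v‖ := by
  refine le_of_sq_le_sq ?_ (by positivity)
  rw [norm_sq_pairL2, add_sq]
  linarith [mul_nonneg (norm_nonneg u) (norm_nonneg v)]

theorem norm_mul_add_norm_mul_le (u v u' v' : Lp ℝ 2 (gibbs V β)) :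
    ‖u‖ * ‖u'‖ + ‖v‖ * ‖v'‖ ≤ ‖pairL2 u v‖ * ‖pairL2 u' v'‖ := by
  refine le_of_sq_le_sq ?_ (by positivity)
  rw [mul_pow, norm_sq_pairL2, norm_sq_pairL2]
  linarith [sq_nonneg (‖u‖ * ‖v'‖ - ‖v‖ * ‖u'‖)]

end L2

/-- The test vector `(X_0 Γ_g, a p_0 V'(r_1) + Y_{0,1} Γ_g)`, whose squared norm is the quadratic
part of the variational formula. -/
def wvec (V : ℝ → ℝ) (β : ℝ) (g : Config → ℝ) (a : ℝ) : PairL2 V β :=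
  pairL2 (l2 V β (ZGamma V 0 g)) (l2 V β (a • current V + ZGamma V 1 g))

/-- The vector `(-Γ, Γ)`, where `Γ` is the truncation of `Γ_g` to `M`. It represents `A g` when `M`
is a window of `g`. -/
def skewVec (V : ℝ → ℝ) (β : ℝ) (M : Finset ℤ) (g : Config → ℝ) : PairL2 V β :=
  pairL2 (-l2 V β (truncGamma M g)) (l2 V β (truncGamma M g))

/-- `K` represents the linear functional `(g, a) ↦ ≪ g, h ≫_* + a ≪ h ≫_{**}` on test vectors. The
finiteness of the supports makes both pairings additive in `h`. -/
structure Represents (V : ℝ → ℝ) (β : ℝ) (h : Config → ℝ) (K : PairL2 V β) : Prop where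
  memLp : MemLp h 2 (gibbs V β)
  finite_star : ∀ g ∈ Tame V β 1,
    (Function.support fun i : ℤ => ∫ ω, g ω * shift i h ω ∂(gibbs V β)).Finite
  finite_starStar : (Function.support fun i : ℤ =>
    (i : ℝ) * ∫ ω, h ω * energy V i ω ∂(gibbs V β)).Finite
  pairing : ∀ g ∈ Tame V β 1, ∀ a : ℝ,
    pairStar V β g h + a * pairStarStar V β h = inner ℝ (wvec V β g a) K

section Represents

variable {V : ℝ → ℝ} {δm δp β γ : ℝ} {f g h h' F : Config → ℝ} {K K' : PairL2 V β}
  {M : Finset ℤ} {s : ℤ}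

theorem Represents.zero : Represents V β 0 0 := by
  exact ⟨.zero, fun g _ => by simp [shift_zero], by simp,
    fun g _ a => by simp [pairStar, pairStarStar, shift_zero]⟩

theorem Represents.add (hV : IsConvexPotential V δm δp) (hβ : 0 < β) (H : Represents V β h K)
    (H' : Represents V β h' K') : Represents V β (h + h') (K + K') := by
  have star (g) (hg : g ∈ Tame V β 1) (i : ℤ) : ∫ ω, g ω * shift i (h + h') ω ∂(gibbs V β) =
      ∫ ω, g ω * shift i h ω ∂(gibbs V β) + ∫ ω, g ω * shift i h' ω ∂(gibbs V β) := by
    rw [← integral_add (integrable_mul_of_memLp_two (Tame.memLp_two hg)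
      (memLp_shift hV hβ i H.memLp)) (integrable_mul_of_memLp_two (Tame.memLp_two hg)
      (memLp_shift hV hβ i H'.memLp))]
    simp [shift, mul_add]
  have starStar (i : ℤ) : (i : ℝ) * ∫ ω, (h + h') ω * energy V i ω ∂(gibbs V β) =
      i * ∫ ω, h ω * energy V i ω ∂(gibbs V β) + i * ∫ ω, h' ω * energy V i ω ∂(gibbs V β) := by
    have hE := Tame.memLp_two (Tame.energy hV hβ i)
    rw [← mul_add, ← integral_add (integrable_mul_of_memLp_two H.memLp hE)
      (integrable_mul_of_memLp_two H'.memLp hE)]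
    simp [add_mul]
  refine ⟨H.memLp.add H'.memLp, fun g hg => ?_, ?_, fun g hg a => ?_⟩
  · simp only [star g hg]
    exact ((H.finite_star g hg).union (H'.finite_star g hg)).subset (Function.support_add _ _)
  · simp only [starStar]
    exact (H.finite_starStar.union H'.finite_starStar).subset (Function.support_add _ _)
  · have pairStar_add : pairStar V β g (h + h') = pairStar V β g h + pairStar V β g h' := by
      simp only [pairStar, star g hg]
      exact finsum_add_distrib (H.finite_star g hg) (H'.finite_star g hg)
    have pairStarStar_add :
        pairStarStar V β (h + h') = pairStarStar V β h + pairStarStar V β h' := by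
      simp only [pairStarStar, starStar]
      exact finsum_add_distrib H.finite_starStar H'.finite_starStar
    rw [pairStar_add, pairStarStar_add, inner_add_right, ← H.pairing g hg, ← H'.pairing g hg]
    ring

theorem Represents.smul (c : ℝ) (H : Represents V β h K) : Represents V β (c • h) (c • K) := by
  have star (g : Config → ℝ) (i : ℤ) : ∫ ω, g ω * shift i (c • h) ω ∂(gibbs V β) =
      c * ∫ ω, g ω * shift i h ω ∂(gibbs V β) := by
    simp only [shift, Pi.smul_apply, smul_eq_mul, mul_left_comm, integral_const_mul]
  have starStar (i : ℤ) : (i : ℝ) * ∫ ω, (c • h) ω * energy V i ω ∂(gibbs V β) =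
      c * (i * ∫ ω, h ω * energy V i ω ∂(gibbs V β)) := by
    simp only [Pi.smul_apply, smul_eq_mul, mul_assoc, integral_const_mul, mul_left_comm]
  refine ⟨H.memLp.const_smul c, fun g hg => ?_, ?_, fun g hg a => ?_⟩
  · simp only [star]
    exact (H.finite_star g hg).subset (Function.support_const_smul_subset c _)
  · simp only [starStar]
    exact H.finite_starStar.subset (Function.support_const_smul_subset c _)
  · simp only [pairStar, pairStarStar, star, starStar]
    rw [← mul_finsum, ← mul_finsum, inner_smul_right, ← H.pairing g hg, pairStar, pairStarStar]
    ring

theorem Represents.sum (hV : IsConvexPotential V δm δp) (hβ : 0 < β) {ι : Type*} (s : Finset ι)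
    {h : ι → Config → ℝ} {K : ι → PairL2 V β} (H : ∀ k, Represents V β (h k) (K k)) :
    Represents V β (∑ k ∈ s, h k) (∑ k ∈ s, K k) := by
  classical
  induction s using Finset.induction_on with
  | empty => exact .zero
  | insert a s ha ih =>
    rw [Finset.sum_insert ha, Finset.sum_insert ha]
    exact (H a).add hV hβ ih

theorem memLp_wvec_snd (hV : IsConvexPotential V δm δp) (hβ : 0 < β) (hg : g ∈ Tame V β 1) (a : ℝ) :
    MemLp (a • current V + ZGamma V 1 g) 2 (gibbs V β) :=
  ((memLp_current hV hβ).const_smul a).add (memLp_ZGamma hV hβ hg (.inr rfl))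

theorem represents_X (hV : IsConvexPotential V δm δp) (hβ : 0 < β) {i : ℤ}
    (hF : MemDomain V β i (i + 0) F) :
    Represents V β (Y V i (i + 0) F) (pairL2 (-l2 V β (shift (-i) F)) 0) where
  memLp := hF.memLp_Y
  finite_star _ hg := support_pairStar_finite hV hβ hg hF (.inl rfl)
  finite_starStar := (Finset.finite_toSet _).subset (support_pairStarStar_subset hV hβ hF)
  pairing g hg a := by
    rw [pairStar_Y hV hβ hg hF (.inl rfl), pairStarStar_X hV hβ hF, mul_zero, add_zero, wvec,
      inner_pairL2, inner_neg_right, inner_zero_right, add_zero,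
      inner_l2 (memLp_ZGamma hV hβ hg (.inl rfl)) (memLp_shift hV hβ _ hF.memLp)]

theorem represents_Y (hV : IsConvexPotential V δm δp) (hβ : 0 < β) {i : ℤ}
    (hF : MemDomain V β i (i + 1) F) :
    Represents V β (Y V i (i + 1) F) (pairL2 0 (-l2 V β (shift (-i) F))) where
  memLp := hF.memLp_Y
  finite_star _ hg := support_pairStar_finite hV hβ hg hF (.inr rfl)
  finite_starStar := (Finset.finite_toSet _).subset (support_pairStarStar_subset hV hβ hF)
  pairing g hg a := by
    have hFi := memLp_shift hV hβ (-i) hF.memLp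
    have hj := memLp_current hV hβ
    have hZ := memLp_ZGamma hV hβ hg (.inr rfl)
    rw [pairStar_Y hV hβ hg hF (.inr rfl), pairStarStar_Y hV hβ hF, wvec, inner_pairL2,
      inner_neg_right, inner_zero_right, l2_add (hj.const_smul a) hZ, l2_smul hj, inner_add_left,
      real_inner_smul_left, inner_l2 hj hFi, inner_l2 hZ hFi]
    ring

theorem exists_represents (hV : IsConvexPotential V δm δp) (hβ : 0 < β) (hh : h ∈ spaceC0 V β) :
    ∃ K, Represents V β h K := by
  induction hh using Submodule.span_induction with
  | mem x hx =>
    obtain ⟨i, F, ⟨hF, hF2, hYF⟩, rfl | rfl⟩ := hx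
    · have hX := represents_X hV hβ (i := i) ⟨hF, hF2, (add_zero i).symm ▸ (hYF i).1⟩
      rw [add_zero] at hX
      exact ⟨_, hX⟩
    · exact ⟨_, represents_Y hV hβ ⟨hF, hF2, (hYF i).2⟩⟩
  | zero => exact ⟨0, .zero⟩
  | add x y _ _ hx hy =>
    obtain ⟨K, hK⟩ := hx
    obtain ⟨K', hK'⟩ := hy
    exact ⟨_, hK.add hV hβ hK'⟩
  | smul c x _ hx =>
    obtain ⟨K, hK⟩ := hx
    exact ⟨_, hK.smul c⟩

/-! ### The symmetric and the antisymmetric part of the generator -/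

theorem opA_eq_sum (hM : IsWindow V M g) :
    opA V g = ∑ k ∈ M, (Y V k (k + 0) g - Y V k (k + 1) g) := by
  ext ω
  rw [opA, Finset.sum_apply]
  simp only [add_zero]
  refine finsum_eq_sum_of_support_subset _ fun k hk => ?_
  by_contra hkM
  have hX := hM 0 (.inl rfl) k hkM
  rw [add_zero] at hX
  exact hk (by simp [X, hX, hM 1 (.inr rfl) k hkM])

theorem opS_eq_sum (hM : IsWindow V M g) :
    opS V γ g = (γ / 2) • ∑ k ∈ M, (Y V k (k + 0) (Y V k (k + 0) g) +
      Y V k (k + 1) (Y V k (k + 1) g)) := by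
  ext ω
  rw [opS, Pi.smul_apply, Finset.sum_apply, smul_eq_mul]
  simp only [add_zero]
  congr 1
  refine finsum_eq_sum_of_support_subset _ fun k hk => ?_
  by_contra hkM
  have hX := hM 0 (.inl rfl) k hkM
  rw [add_zero] at hX
  exact hk (by simp [X, hX, hM 1 (.inr rfl) k hkM, Y_zero])

theorem X_mem_spaceC0 (hF : F ∈ spaceCTilde V β) (i : ℤ) : Y V i (i + 0) F ∈ spaceC0 V β :=
  Submodule.subset_span ⟨i, F, hF, .inl (by rw [add_zero]; rfl)⟩

theorem Y_mem_spaceC0 (hF : F ∈ spaceCTilde V β) (i : ℤ) : Y V i (i + 1) F ∈ spaceC0 V β :=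
  Submodule.subset_span ⟨i, F, hF, .inr rfl⟩

theorem opA_mem (hV : IsConvexPotential V δm δp) (hβ : 0 < β) (hg : g ∈ Tame V β 1) :
    opA V g ∈ spaceC0 V β := by
  obtain ⟨M, hM⟩ := (Tame.smoothLocal hg).exists_isWindow (V := V)
  have hgC := Tame.mem_spaceCTilde hV hβ hg
  rw [opA_eq_sum hM]
  exact Submodule.sum_mem _ fun k _ =>
    Submodule.sub_mem _ (X_mem_spaceC0 hgC k) (Y_mem_spaceC0 hgC k)

theorem opS_mem (hV : IsConvexPotential V δm δp) (hβ : 0 < β) (hg : g ∈ Tame V β 2) (γ : ℝ) :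
    opS V γ g ∈ spaceC0 V β := by
  obtain ⟨M, hM⟩ := (Tame.smoothLocal hg).exists_isWindow (V := V)
  have hYg (i j : ℤ) := Tame.mem_spaceCTilde hV hβ (Tame.Y hV hβ hg le_rfl i j)
  rw [opS_eq_sum hM]
  exact Submodule.smul_mem _ _ (Submodule.sum_mem _ fun k _ =>
    Submodule.add_mem _ (X_mem_spaceC0 (hYg _ _) k) (Y_mem_spaceC0 (hYg _ _) k))

theorem opL_mem (hV : IsConvexPotential V δm δp) (hβ : 0 < β) (hg : g ∈ Tame V β 2) (γ : ℝ) :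
    opL V γ g ∈ spaceC0 V β :=
  Submodule.add_mem _ (opS_mem hV hβ hg γ) (opA_mem hV hβ (Tame.of_succ hg))

theorem represents_opA (hV : IsConvexPotential V δm δp) (hβ : 0 < β) (hg : g ∈ Tame V β 1)
    (hM : IsWindow V M g) : Represents V β (opA V g) (skewVec V β M g) := by
  have summand (k : ℤ) : Represents V β (Y V k (k + 0) g - Y V k (k + 1) g)
      (pairL2 (-l2 V β (shift (-k) g)) (l2 V β (shift (-k) g))) := by
    have h := (represents_X hV hβ (Tame.memDomain hV hβ hg k (k + 0))).add hV hβ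
      ((represents_Y hV hβ (Tame.memDomain hV hβ hg k (k + 1))).smul (-1))
    rw [neg_one_smul, ← sub_eq_add_neg, ← pairL2_smul, ← pairL2_add] at h
    simpa using h
  have h := Represents.sum hV hβ M summand
  rwa [← opA_eq_sum hM, ← pairL2_sum, Finset.sum_neg_distrib,
    ← l2_sum M fun k => memLp_shift hV hβ (-k) (Tame.memLp_two hg)] at h

theorem wvec_zero_right :
    wvec V β g 0 = pairL2 (l2 V β (ZGamma V 0 g)) (l2 V β (ZGamma V 1 g)) := by
  rw [wvec, zero_smul, zero_add]

theorem represents_opS (hV : IsConvexPotential V δm δp) (hβ : 0 < β) (hg : g ∈ Tame V β 2) :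
    Represents V β (opS V γ g) (-(γ / 2) • wvec V β g 0) := by
  obtain ⟨M, hM⟩ := (Tame.smoothLocal hg).exists_isWindow (V := V)
  have hY (i j : ℤ) := Tame.Y hV hβ hg le_rfl i j
  have hYk (s k : ℤ) := memLp_shift hV hβ (-k) (Tame.memLp_two (hY k (k + s)))
  have summand (k : ℤ) : Represents V β
      (Y V k (k + 0) (Y V k (k + 0) g) + Y V k (k + 1) (Y V k (k + 1) g))
      (-pairL2 (l2 V β (shift (-k) (Y V k (k + 0) g)))
        (l2 V β (shift (-k) (Y V k (k + 1) g)))) := by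
    have h := (represents_X hV hβ (Tame.memDomain hV hβ (hY k (k + 0)) k (k + 0))).add hV hβ
      (represents_Y hV hβ (Tame.memDomain hV hβ (hY k (k + 1)) k (k + 1)))
    rw [← pairL2_add, add_zero (-l2 V β _), zero_add] at h
    exact h
  have h := (Represents.sum hV hβ M summand).smul (γ / 2)
  rwa [← opS_eq_sum hM, Finset.sum_neg_distrib, ← pairL2_sum, ← l2_sum M (hYk 0),
    ← l2_sum M (hYk 1), ← ZGamma_eq_sum hM (.inl rfl), ← ZGamma_eq_sum hM (.inr rfl),
    ← wvec_zero_right, smul_neg, ← neg_smul] at h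

theorem abs_inner_Y_truncGamma_le (hV : IsConvexPotential V δm δp) (hβ : 0 < β)
    (hf : MemDomain V β 0 s f) (hg : g ∈ Tame V β 1) (hM : IsWindow V M g)
    (hs : s = 0 ∨ s = 1) :
    |inner ℝ (l2 V β (Y V 0 s f)) (l2 V β (truncGamma M g))| ≤
      2 / √δm * (‖l2 V β (Y V 0 s f)‖ * ‖l2 V β (ZGamma V s g)‖) := by
  have hΓ := memDomain_truncGamma hV hβ hg hM hs
  rw [← Y_truncGamma (Tame.smoothLocal hg) hM hs, inner_l2 hf.memLp_Y hΓ.memLp,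
    norm_l2 hf.memLp_Y, norm_l2 hΓ.memLp_Y]
  exact abs_integral_Y_mul_le hV hβ hf hΓ

theorem Y_energy_one (hV : IsConvexPotential V δm δp) : Y V 0 1 (energy V 1) = current V := by
  ext ω
  rw [Y_energy hV]
  simp [current]

theorem exists_memDomain_Y_eq (hV : IsConvexPotential V δm δp) (hβ : 0 < β)
    (hf : f ∈ Tame V β 1) (a : ℝ) :
    ∃ G, MemDomain V β 0 1 G ∧ Y V 0 1 G = a • current V + ZGamma V 1 f := by
  obtain ⟨M, hM⟩ := (Tame.smoothLocal hf).exists_isWindow (V := V)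
  have hΓ := memDomain_truncGamma hV hβ hf hM (.inr rfl)
  have hE := Tame.energy hV hβ 1
  have hEs := Tame.smoothLocal hE
  have hY : Y V 0 1 (a • energy V 1 + truncGamma M f) = a • current V + ZGamma V 1 f := by
    rw [Y_add (hEs.smul a) hΓ.smoothLocal, Y_smul hEs, Y_energy_one hV,
      Y_truncGamma (Tame.smoothLocal hf) hM (.inr rfl)]
  exact ⟨_, ⟨(hEs.smul a).add hΓ.smoothLocal, ((Tame.memLp_two hE).const_smul a).add hΓ.memLp,
    hY ▸ memLp_wvec_snd hV hβ hf a⟩, hY⟩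

theorem abs_inner_wvec_skewVec_le (hV : IsConvexPotential V δm δp) (hβ : 0 < β)
    (hf : f ∈ Tame V β 1) (hg : g ∈ Tame V β 1) (hM : IsWindow V M g) (a : ℝ) :
    |inner ℝ (wvec V β f a) (skewVec V β M g)| ≤
      2 / √δm * (‖wvec V β f a‖ * ‖wvec V β g 0‖) := by
  obtain ⟨N, hN⟩ := (Tame.smoothLocal hf).exists_isWindow (V := V)
  obtain ⟨G, hG, hYG⟩ := exists_memDomain_Y_eq hV hβ hf a
  have hX := abs_inner_Y_truncGamma_le hV hβ (memDomain_truncGamma hV hβ hf hN (.inl rfl)) hg hM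
    (.inl rfl)
  have hY := abs_inner_Y_truncGamma_le hV hβ hG hg hM (.inr rfl)
  rw [Y_truncGamma (Tame.smoothLocal hf) hN (.inl rfl)] at hX
  rw [hYG] at hY
  rw [wvec_zero_right, wvec, skewVec, inner_pairL2, inner_neg_right]
  refine (abs_add_le _ _).trans ?_
  rw [abs_neg]
  refine (add_le_add hX hY).trans ?_
  rw [← mul_add]
  exact mul_le_mul_of_nonneg_left (norm_mul_add_norm_mul_le _ _ _ _) (by positivity)

theorem inner_wvec_skewVec_self (hV : IsConvexPotential V δm δp) (hβ : 0 < β)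
    (hg : g ∈ Tame V β 1) (hM : IsWindow V M g) :
    inner ℝ (wvec V β g 0) (skewVec V β M g) = 0 := by
  have inner_ZGamma_truncGamma (s : ℤ) (hs : s = 0 ∨ s = 1) :
      inner ℝ (l2 V β (ZGamma V s g)) (l2 V β (truncGamma M g)) = 0 := by
    have hΓ := memDomain_truncGamma hV hβ hg hM hs
    have h := integral_Y_mul hV hβ hΓ hΓ
    rw [← inner_l2 hΓ.memLp_Y hΓ.memLp, ← inner_l2 hΓ.memLp hΓ.memLp_Y, real_inner_comm,
      Y_truncGamma (Tame.smoothLocal hg) hM hs] at h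
    rw [real_inner_comm]
    exact self_eq_neg.1 h
  rw [wvec_zero_right, skewVec, inner_pairL2, inner_neg_right,
    inner_ZGamma_truncGamma 0 (.inl rfl), inner_ZGamma_truncGamma 1 (.inr rfl), neg_zero, add_zero]

/-! ### The gradient `p_1² - p_0²` -/

theorem Y_momentum_mul_position (V : ℝ → ℝ) (i j : ℤ) :
    Y V i j (fun ω => (ω i).1 * (ω j).2) = fun ω => (ω i).1 ^ 2 - deriv V (ω j).2 * (ω j).2 := by
  ext ω
  have hdp : dp i (fun ω => (ω i).1 * (ω j).2) ω = (ω j).2 := by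
    rcases eq_or_ne j i with rfl | h <;> simp [dp, *]
  have hdr : dr j (fun ω => (ω i).1 * (ω j).2) ω = (ω i).1 := by
    rcases eq_or_ne i j with rfl | h <;> simp [dr, *]
  rw [Y, hdp, hdr]
  ring

theorem Y_momentum_sq (V : ℝ → ℝ) (i j : ℤ) :
    Y V i j (fun ω => (ω i).1 ^ 2) = fun ω => -2 * ((ω i).1 * deriv V (ω j).2) := by
  ext ω
  have hdp : dp i (fun ω => (ω i).1 ^ 2) ω = 2 * (ω i).1 := by simp [dp]
  have hdr : dr j (fun ω => (ω i).1 ^ 2) ω = 0 := by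
    rcases eq_or_ne i j with rfl | h <;> simp [dr, *]
  rw [Y, hdp, hdr]
  ring

theorem gradP_eq (V : ℝ → ℝ) : gradP =
    Y V 1 (1 + 0) (fun ω => (ω 1).1 * (ω 1).2) - Y V 0 (0 + 1) fun ω => (ω 0).1 * (ω 1).2 := by
  ext ω
  simp only [add_zero, zero_add, Pi.sub_apply, Y_momentum_mul_position, gradP]
  ring

theorem tame_momentum_mul_position (hV : IsConvexPotential V δm δp) (hβ : 0 < β) (i j : ℤ) :
    (fun ω => (ω i).1 * (ω j).2 : Config → ℝ) ∈ Tame V β 1 :=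
  Tame.mul (Tame.momentum hV hβ i) (Tame.position hV hβ j)

theorem gradP_mem (hV : IsConvexPotential V δm δp) (hβ : 0 < β) : gradP ∈ spaceC0 V β := by
  rw [gradP_eq V]
  exact Submodule.sub_mem _
    (X_mem_spaceC0 (Tame.mem_spaceCTilde hV hβ (tame_momentum_mul_position hV hβ 1 1)) 1)
    (Y_mem_spaceC0 (Tame.mem_spaceCTilde hV hβ (tame_momentum_mul_position hV hβ 0 1)) 0)

end Represents

/-! ### The space of test vectors -/

section TestSpace

variable {V : ℝ → ℝ} {δm δp β γ : ℝ} {f g h : Config → ℝ} {K K' : PairL2 V β} {M : Finset ℤ}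
  {s : ℤ}

theorem IsWindow.add (hf : SmoothLocal f) (hg : SmoothLocal g) (hMf : IsWindow V M f)
    (hMg : IsWindow V M g) : IsWindow V M (f + g) := fun s hs k hk => by
  rw [Y_add hf hg, hMf s hs k hk, hMg s hs k hk, add_zero]

theorem IsWindow.smul (hf : SmoothLocal f) (hM : IsWindow V M f) (c : ℝ) :
    IsWindow V M (c • f) := fun s hs k hk => by
  rw [Y_smul hf, hM s hs k hk, smul_zero]

theorem exists_common_window (hf : SmoothLocal f) (hg : SmoothLocal g) :
    ∃ M, IsWindow V M f ∧ IsWindow V M g := by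
  obtain ⟨M, hM⟩ := hf.exists_isWindow (V := V)
  obtain ⟨N, hN⟩ := hg.exists_isWindow (V := V)
  exact ⟨M ∪ N, hM.mono Finset.subset_union_left, hN.mono Finset.subset_union_right⟩

theorem ZGamma_add (hf : SmoothLocal f) (hg : SmoothLocal g) (hs : s = 0 ∨ s = 1) :
    ZGamma V s (f + g) = ZGamma V s f + ZGamma V s g := by
  obtain ⟨M, hMf, hMg⟩ := exists_common_window (V := V) hf hg
  rw [ZGamma_eq_sum hMf hs, ZGamma_eq_sum hMg hs, ZGamma_eq_sum (hMf.add hf hg hMg) hs,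
    ← Finset.sum_add_distrib]
  refine Finset.sum_congr rfl fun k _ => ?_
  rw [Y_add hf hg]
  rfl

theorem ZGamma_smul (hf : SmoothLocal f) (hs : s = 0 ∨ s = 1) (c : ℝ) :
    ZGamma V s (c • f) = c • ZGamma V s f := by
  obtain ⟨M, hM⟩ := hf.exists_isWindow (V := V)
  rw [ZGamma_eq_sum hM hs, ZGamma_eq_sum (hM.smul hf c) hs, Finset.smul_sum]
  refine Finset.sum_congr rfl fun k _ => ?_
  rw [Y_smul hf]
  rfl

theorem wvec_add (hV : IsConvexPotential V δm δp) (hβ : 0 < β) (hf : f ∈ Tame V β 1)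
    (hg : g ∈ Tame V β 1) (a b : ℝ) :
    wvec V β (f + g) (a + b) = wvec V β f a + wvec V β g b := by
  have hf' := Tame.smoothLocal hf
  have hg' := Tame.smoothLocal hg
  rw [wvec, ZGamma_add hf' hg' (.inl rfl), ZGamma_add hf' hg' (.inr rfl), add_smul,
    add_add_add_comm,
    l2_add (memLp_ZGamma hV hβ hf (.inl rfl)) (memLp_ZGamma hV hβ hg (.inl rfl)),
    l2_add (memLp_wvec_snd hV hβ hf a) (memLp_wvec_snd hV hβ hg b), pairL2_add]
  rfl

theorem wvec_smul (hV : IsConvexPotential V δm δp) (hβ : 0 < β) (hf : f ∈ Tame V β 1) (c a : ℝ) :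
    wvec V β (c • f) (c * a) = c • wvec V β f a := by
  have hf' := Tame.smoothLocal hf
  rw [wvec, ZGamma_smul hf' (.inl rfl), ZGamma_smul hf' (.inr rfl), mul_smul, ← smul_add,
    l2_smul (memLp_ZGamma hV hβ hf (.inl rfl)), l2_smul (memLp_wvec_snd hV hβ hf a), pairL2_smul]
  rfl

theorem norm_ZGamma_le (hV : IsConvexPotential V δm δp) (hβ : 0 < β) (hf : f ∈ Tame V β 1)
    (hM : IsWindow V M f) (hs : s = 0 ∨ s = 1) : ‖l2 V β (ZGamma V s f)‖ ≤
      ∑ k ∈ M, √(∫ ω, Y V k (k + s) f ω ^ 2 ∂(gibbs V β)) := by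
  have hY (k : ℤ) := Tame.memLp_Y hV hβ hf k (k + s)
  have hYk (k : ℤ) := memLp_shift hV hβ (-k) (hY k)
  rw [ZGamma_eq_sum hM hs, l2_sum M hYk]
  refine (norm_sum_le _ _).trans (Finset.sum_le_sum fun k _ => ?_)
  rw [norm_l2 (hYk k)]
  exact (congrArg Real.sqrt (integral_shift hV hβ (-k)
    ((hY k).aestronglyMeasurable.pow 2))).le

/-- The centred functions in `Tame V β 2`: an enlargement of `𝒞` that is stable enough for the
generator and in which `𝒞` is still dense for the seminorm `‖wvec V β · 0‖`. -/
def centred (hV : IsConvexPotential V δm δp) (hβ : 0 < β) : Submodule ℝ (Config → ℝ) where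
  carrier := {f | f ∈ Tame V β 2 ∧ ∫ ω, f ω ∂(gibbs V β) = 0}
  add_mem' {f g} hf hg := by
    have := hV.isProbabilityMeasure_gibbs hβ
    refine ⟨Tame.add hf.1 hg.1, ?_⟩
    have h := integral_add ((Tame.memLp_two hf.1).integrable one_le_two)
      ((Tame.memLp_two hg.1).integrable one_le_two)
    rwa [hf.2, hg.2, add_zero] at h
  zero_mem' := ⟨Tame.const hV hβ 0, by simp⟩
  smul_mem' c f hf := ⟨Tame.smul hf.1 c, by
    have h := integral_const_mul (μ := gibbs V β) c f
    rwa [hf.2, mul_zero] at h⟩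

theorem mem_centred_of_mem_spaceC (hV : IsConvexPotential V δm δp) (hβ : 0 < β)
    (hg : g ∈ spaceC V β) : g ∈ centred hV hβ :=
  ⟨CompactLocal.tame hV hβ hg.1 2, hg.2⟩

theorem tame_of_mem_centred {hV : IsConvexPotential V δm δp} {hβ : 0 < β}
    (hf : f ∈ centred hV hβ) : f ∈ Tame V β 1 :=
  Tame.of_succ hf.1

/-- The linear map `(g, a) ↦ wvec V β g a`. -/
def wmap (hV : IsConvexPotential V δm δp) (hβ : 0 < β) : centred hV hβ × ℝ →ₗ[ℝ] PairL2 V β where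
  toFun x := wvec V β x.1 x.2
  map_add' x y := wvec_add hV hβ (tame_of_mem_centred x.1.2) (tame_of_mem_centred y.1.2) _ _
  map_smul' c x := wvec_smul hV hβ (tame_of_mem_centred x.1.2) c _

/-- The closed span of the test vectors, which is the Hilbert space dual to the seminorm
`|||·|||_{-1}`. -/
def testSpace (hV : IsConvexPotential V δm δp) (hβ : 0 < β) : Submodule ℝ (PairL2 V β) :=
  (LinearMap.range (wmap hV hβ)).topologicalClosure

instance (hV : IsConvexPotential V δm δp) (hβ : 0 < β) : CompleteSpace (testSpace hV hβ) :=
  (Submodule.isClosed_topologicalClosure _).completeSpace_coe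

theorem wvec_mem_testSpace (hV : IsConvexPotential V δm δp) (hβ : 0 < β) (hf : f ∈ centred hV hβ)
    (a : ℝ) : wvec V β f a ∈ testSpace hV hβ :=
  Submodule.le_topologicalClosure _ ⟨(⟨f, hf⟩, a), rfl⟩

theorem exists_seq_spaceC (hV : IsConvexPotential V δm δp) (hβ : 0 < β) (hf : f ∈ centred hV hβ) :
    ∃ g : ℕ → Config → ℝ, (∀ n, g n ∈ spaceC V β) ∧
      Tendsto (fun n => wvec V β (f - g n) 0) atTop (𝓝 0) := by
  obtain ⟨g, M, hg, hM, hlim⟩ := exists_approximation hV hβ (tame_of_mem_centred hf) hf.2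
  have hfg (n : ℕ) : f - g n ∈ Tame V β 1 :=
    tame_of_mem_centred (sub_mem hf (mem_centred_of_mem_spaceC hV hβ (hg n)))
  have norm_le (n : ℕ) := norm_pairL2_le (l2 V β (ZGamma V 0 (f - g n)))
    (l2 V β (ZGamma V 1 (f - g n))) |>.trans
      (add_le_add (norm_ZGamma_le hV hβ (hfg n) (hM n) (.inl rfl))
        (norm_ZGamma_le hV hβ (hfg n) (hM n) (.inr rfl)))
  have bound_tendsto (s : ℤ) : Tendsto
      (fun n => ∑ k ∈ M, √(∫ ω, Y V k (k + s) (f - g n) ω ^ 2 ∂(gibbs V β))) atTop (𝓝 0) := by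
    simpa using tendsto_finsetSum M fun k _ => (hlim k (k + s)).sqrt
  refine ⟨g, hg, ?_⟩
  simp only [wvec_zero_right]
  refine squeeze_zero_norm norm_le ?_
  simpa using (bound_tendsto 0).add (bound_tendsto 1)

theorem testSpace_subset_closure (hV : IsConvexPotential V δm δp) (hβ : 0 < β) :
    (testSpace hV hβ : Set (PairL2 V β)) ⊆
      closure {w | ∃ g ∈ spaceC V β, ∃ a : ℝ, w = wvec V β g a} := by
  refine closure_minimal ?_ isClosed_closure
  rintro _ ⟨⟨f, a⟩, rfl⟩
  obtain ⟨g, hg, hlim⟩ := exists_seq_spaceC hV hβ f.2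
  refine mem_closure_of_tendsto (x := wvec V β f a) (b := atTop) ?_
    (.of_forall fun n => ⟨g n, hg n, a, rfl⟩)
  have wvec_eq_sub (n : ℕ) : wvec V β (g n) a = wvec V β f a - wvec V β (f - g n) 0 := by
    have hgn := tame_of_mem_centred (mem_centred_of_mem_spaceC hV hβ (hg n))
    rw [eq_sub_iff_add_eq, ← wvec_add hV hβ hgn (Tame.sub (tame_of_mem_centred f.2) hgn),
      add_sub_cancel, add_zero]
  simpa only [wvec_eq_sub, sub_zero] using tendsto_const_nhds.sub hlim

/-! ### The Riesz representative -/

theorem starProjection_eq_of_represents {hV : IsConvexPotential V δm δp} {hβ : 0 < β}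
    (hK : Represents V β h K) (hK' : Represents V β h K') :
    (testSpace hV hβ).starProjection K = (testSpace hV hβ).starProjection K' := by
  rw [← sub_eq_zero, ← map_sub, Submodule.starProjection_apply_eq_zero_iff, testSpace,
    Submodule.orthogonal_closure, Submodule.mem_orthogonal]
  rintro _ ⟨x, rfl⟩
  have hx := tame_of_mem_centred x.1.2
  rw [inner_sub_right, sub_eq_zero]
  exact (hK.pairing _ hx x.2).symm.trans (hK'.pairing _ hx x.2)

/-- The element of `testSpace` that represents the pairings with `h`. -/
def riesz (hV : IsConvexPotential V δm δp) (hβ : 0 < β) : spaceC0 V β →ₗ[ℝ] PairL2 V β where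
  toFun h := (testSpace hV hβ).starProjection (exists_represents hV hβ h.2).choose
  map_add' h h' := by
    rw [← map_add]
    exact starProjection_eq_of_represents (exists_represents hV hβ (h + h').2).choose_spec
      ((exists_represents hV hβ h.2).choose_spec.add hV hβ
        (exists_represents hV hβ h'.2).choose_spec)
  map_smul' c h := by
    rw [← map_smul]
    exact starProjection_eq_of_represents (exists_represents hV hβ (c • h).2).choose_spec
      ((exists_represents hV hβ h.2).choose_spec.smul c)

variable (hV : IsConvexPotential V δm δp) (hβ : 0 < β)

theorem riesz_eq {h : spaceC0 V β} (hK : Represents V β h K) :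
    riesz hV hβ h = (testSpace hV hβ).starProjection K :=
  starProjection_eq_of_represents (exists_represents hV hβ h.2).choose_spec hK

theorem riesz_mem (h : spaceC0 V β) : riesz hV hβ h ∈ testSpace hV hβ :=
  Submodule.starProjection_apply_mem _ _

theorem inner_wvec_riesz (hg : g ∈ centred hV hβ) (a : ℝ) (h : spaceC0 V β) :
    inner ℝ (wvec V β g a) (riesz hV hβ h) =
      pairStar V β g h + a * pairStarStar V β h := by
  obtain ⟨K, hK⟩ := exists_represents hV hβ h.2
  rw [riesz_eq hV hβ hK, ← Submodule.inner_starProjection_left_eq_right,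
    Submodule.starProjection_eq_self_iff.2 (wvec_mem_testSpace hV hβ hg a),
    hK.pairing g (tame_of_mem_centred hg)]

theorem inner_wvec_riesz_of_represents (hg : g ∈ centred hV hβ) (a : ℝ) {h : spaceC0 V β}
    (hK : Represents V β h K) :
    inner ℝ (wvec V β g a) (riesz hV hβ h) = inner ℝ (wvec V β g a) K := by
  rw [inner_wvec_riesz hV hβ hg, hK.pairing g (tame_of_mem_centred hg)]

theorem variationalSet_eq (h : spaceC0 V β) : variationalSet V β γ h =
    {x : ℝ | ∃ w ∈ {w | ∃ g ∈ spaceC V β, ∃ a : ℝ, w = wvec V β g a},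
      x = 2 * inner ℝ w (riesz hV hβ h) - γ / 2 * ‖w‖ ^ 2} := by
  have objective_eq (g : Config → ℝ) (hg : g ∈ spaceC V β) (a : ℝ) :
      2 * inner ℝ (wvec V β g a) (riesz hV hβ h) - γ / 2 * ‖wvec V β g a‖ ^ 2 =
      2 * pairStar V β g h + 2 * a * pairStarStar V β h
      - γ / 2 * ∫ ω, (a * ((ω 0).1 * deriv V (ω 1).2) + YGamma V g ω) ^ 2 ∂(gibbs V β)
      - γ / 2 * ∫ ω, (XGamma V g ω) ^ 2 ∂(gibbs V β) := by
    have hg' := mem_centred_of_mem_spaceC hV hβ hg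
    have ht := tame_of_mem_centred hg'
    rw [inner_wvec_riesz hV hβ hg' a h, wvec, norm_sq_pairL2,
      norm_l2_sq (memLp_ZGamma hV hβ ht (.inl rfl)), norm_l2_sq (memLp_wvec_snd hV hβ ht a),
      ← XGamma_eq, ← YGamma_eq]
    simp only [Pi.add_apply, Pi.smul_apply, smul_eq_mul, current]
    ring
  ext x
  constructor
  · rintro ⟨g, hg, a, rfl⟩
    exact ⟨_, ⟨g, hg, a, rfl⟩, (objective_eq g hg a).symm⟩
  · rintro ⟨_, ⟨g, hg, a, rfl⟩, rfl⟩
    exact ⟨g, hg, a, objective_eq g hg a⟩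

theorem isLUB_variationalSet (hγ : 0 < γ) (h : spaceC0 V β) :
    IsLUB (variationalSet V β γ h) (2 / γ * ‖riesz hV hβ h‖ ^ 2) := by
  rw [variationalSet_eq hV hβ]
  exact isLUB_quadratic hγ (testSpace_subset_closure hV hβ
    (Submodule.smul_mem _ _ (riesz_mem hV hβ h)))

theorem normSq_eq (hγ : 0 < γ) (h : spaceC0 V β) :
    normSq V β γ h = 2 / γ * ‖riesz hV hβ h‖ ^ 2 :=
  (isLUB_variationalSet hV hβ hγ h).csSup_eq ⟨_, 0, ⟨CompactLocal.zero, by simp⟩, 0, rfl⟩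

theorem form_eq (hγ : 0 < γ) (g h : spaceC0 V β) :
    form V β γ g h = 2 / γ * inner ℝ (riesz hV hβ g) (riesz hV hβ h) := by
  rw [form, normSq_eq hV hβ hγ, normSq_eq hV hβ hγ, map_add, map_sub, norm_add_sq_real,
    norm_sub_sq_real]
  ring

end TestSpace

theorem isSemiInner_form {V : ℝ → ℝ} {δm δp β γ : ℝ} (hV : IsConvexPotential V δm δp)
    (hβ : 0 < β) (hγ : 0 < γ) : IsSemiInner (form V β γ) :=
  isSemiInner_of_inner (riesz hV hβ) (by positivity) (form_eq hV hβ hγ)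

/-! ### The pairings of `p_1² - p_0²` -/

section GradP

variable {V : ℝ → ℝ} {δm δp β : ℝ} {f : Config → ℝ}

theorem tame_momentum_sq (hV : IsConvexPotential V δm δp) (hβ : 0 < β) (i : ℤ) (n : ℕ) :
    (fun ω => (ω i).1 ^ 2 : Config → ℝ) ∈ Tame V β n := by
  simpa only [sq] using! Tame.mul (Tame.momentum hV hβ i) (Tame.momentum hV hβ i)

theorem integral_mul_momentum_sq (hV : IsConvexPotential V δm δp) (hβ : 0 < β)
    {Λ : Finset ℤ} (hf : AEStronglyMeasurable f (gibbs V β)) (hΛ : DependsOn f Λ) {i : ℤ}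
    (hi : i ∉ Λ) (hf0 : ∫ ω, f ω ∂(gibbs V β) = 0) :
    ∫ ω, f ω * (ω i).1 ^ 2 ∂(gibbs V β) = 0 := by
  have := hV.isProbabilityMeasure_gibbs hβ
  have := hV.isProbabilityMeasure_siteMeasure hβ
  have hm : Measurable fun ω : Config => (ω i).1 ^ 2 := by fun_prop
  have factor (z : Config × (ℝ × ℝ)) : (f * fun ω : Config => (ω i).1 ^ 2)
      (Function.update z.1 i z.2) = f z.1 * z.2.1 ^ 2 := by
    have h : f (Function.update z.1 i z.2) = f z.1 :=
      hΛ fun k hk => Function.update_of_ne (ne_of_mem_of_not_mem hk hi) _ _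
    rw [Pi.mul_apply, Function.update_self, h]
  calc ∫ ω, f ω * (ω i).1 ^ 2 ∂(gibbs V β)
      = ∫ z, f z.1 * z.2.1 ^ 2 ∂((gibbs V β).prod (siteMeasure V β)) :=
        (integral_comp_of_measurePreserving (measurePreserving_update hV hβ i)
          (hf.mul hm.aestronglyMeasurable)).symm.trans (integral_congr_ae (.of_forall factor))
    _ = 0 := by rw [integral_prod_mul f fun x : ℝ × ℝ => x.1 ^ 2, hf0, zero_mul]

theorem pairStar_gradP (hV : IsConvexPotential V δm δp) (hβ : 0 < β) (hf : f ∈ centred hV hβ) :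
    pairStar V β f gradP = 0 := by
  obtain ⟨Λ, hΛ⟩ := (Tame.smoothLocal hf.1).exists_dependsOn
  have hf2 := Tame.memLp_two hf.1
  have hp (i : ℤ) := Tame.memLp_two (tame_momentum_sq hV hβ i 0)
  let a : ℤ → ℝ := fun i => ∫ ω, f ω * (ω i).1 ^ 2 ∂(gibbs V β)
  have ha : a.support.Finite := by
    refine Λ.finite_toSet.subset fun i hi => ?_
    by_contra h
    exact hi (integral_mul_momentum_sq hV hβ hf2.aestronglyMeasurable hΛ h hf.2)
  have ha_succ : (Function.support fun i : ℤ => a (i + 1)).Finite :=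
    ha.preimage (add_left_injective (1 : ℤ)).injOn
  have telescope (i : ℤ) : ∫ ω, f ω * shift i gradP ω ∂(gibbs V β) = a (i + 1) - a i := by
    simp only [a]
    rw [← integral_sub (integrable_mul_of_memLp_two hf2 (hp _))
      (integrable_mul_of_memLp_two hf2 (hp _))]
    refine integral_congr_ae (.of_forall fun ω => ?_)
    simp only [shift, gradP, zero_add, add_comm (1 : ℤ)]
    ring
  simp only [pairStar, telescope]
  rw [finsum_sub_distrib ha_succ ha, sub_eq_zero]
  exact finsum_comp_equiv (Equiv.addRight (1 : ℤ))

theorem pairStarStar_gradP (hV : IsConvexPotential V δm δp) (hβ : 0 < β) :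
    pairStarStar V β gradP = ∫ ω, current V ω * ((ω 0).1 * (ω 1).2) ∂(gibbs V β) := by
  have hF (i j : ℤ) := tame_momentum_mul_position hV hβ i j
  have hrep := (represents_X hV hβ (Tame.memDomain hV hβ (hF 1 1) 1 (1 + 0))).add hV hβ
    ((represents_Y hV hβ (Tame.memDomain hV hβ (hF 0 1) 0 (0 + 1))).smul (-1))
  rw [neg_one_smul, ← sub_eq_add_neg, ← gradP_eq] at hrep
  have ZGamma_zero {s : ℤ} (hs : s = 0 ∨ s = 1) : ZGamma V s (0 : Config → ℝ) = 0 := by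
    rw [ZGamma_eq_sum (M := ∅) (fun s _ k _ => Y_zero _ _) hs, Finset.sum_empty]
  have hpair := hrep.pairing 0 (Tame.const hV hβ 0) 1
  rw [wvec, ZGamma_zero (.inl rfl), ZGamma_zero (.inr rfl), one_smul, add_zero (current V),
    inner_add_right, inner_smul_right, inner_pairL2, inner_pairL2, inner_neg_right,
    inner_neg_right, inner_zero_right, inner_zero_right,
    inner_l2 .zero (memLp_shift hV hβ _ (Tame.memLp_two (hF 1 1))),
    inner_l2 (memLp_current hV hβ) (memLp_shift hV hβ _ (Tame.memLp_two (hF 0 1)))] at hpair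
  simpa [pairStar, shift] using! hpair

theorem three_mul_integral_current_mul (hV : IsConvexPotential V δm δp) (hβ : 0 < β) :
    3 * ∫ ω, current V ω * ((ω 0).1 * (ω 1).2) ∂(gibbs V β) =
      ∫ ω, (ω 0).1 ^ 2 * (ω 0).1 ^ 2 ∂(gibbs V β) := by
  have hF := tame_momentum_mul_position hV hβ 0 1
  have hG := tame_momentum_sq hV hβ 0 1
  have h := integral_Y_mul hV hβ (Tame.memDomain hV hβ hF 0 1) (Tame.memDomain hV hβ hG 0 1)
  have hleft : (fun ω => Y V 0 1 (fun ω => (ω 0).1 * (ω 1).2) ω * (ω 0).1 ^ 2) =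
      fun ω => (ω 0).1 ^ 2 * (ω 0).1 ^ 2 - current V ω * ((ω 0).1 * (ω 1).2) := by
    ext ω
    rw [Y_momentum_mul_position, current]
    ring
  have hright : (fun ω => (ω 0).1 * (ω 1).2 * Y V 0 1 (fun ω => (ω 0).1 ^ 2) ω) =
      fun ω => -2 * (current V ω * ((ω 0).1 * (ω 1).2)) := by
    ext ω
    rw [Y_momentum_sq, current]
    ring
  rw [hleft, hright, integral_const_mul, integral_sub
    (integrable_mul_of_memLp_two (Tame.memLp_two hG) (Tame.memLp_two hG))
    (integrable_mul_of_memLp_two (memLp_current hV hβ) (Tame.memLp_two hF))] at h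
  linarith

theorem ae_momentum_ne_zero (hV : IsConvexPotential V δm δp) (hβ : 0 < β) (i : ℤ) :
    ∀ᵐ ω ∂(gibbs V β), (ω i).1 ≠ 0 := by
  have hac : siteMeasure V β ≪ volume := withDensity_absolutelyContinuous _ _
  have ae_ne_zero : ∀ᵐ x : ℝ, x ≠ 0 := by simp [ae_iff]
  exact (measurePreserving_eval hV hβ i).quasiMeasurePreserving.ae (hac.ae_le
    ((Measure.quasiMeasurePreserving_fst (μ := volume) (ν := volume)).ae ae_ne_zero))

theorem pairStarStar_gradP_pos (hV : IsConvexPotential V δm δp) (hβ : 0 < β) :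
    0 < pairStarStar V β gradP := by
  have := hV.isProbabilityMeasure_gibbs hβ
  have hG := Tame.memLp_two (tame_momentum_sq hV hβ 0 0)
  have fourth_moment_pos : 0 < ∫ ω, (ω 0).1 ^ 2 * (ω 0).1 ^ 2 ∂(gibbs V β) := by
    have nonneg : 0 ≤ fun ω : Config => (ω 0).1 ^ 2 * (ω 0).1 ^ 2 := fun ω => by positivity
    refine (integral_nonneg nonneg).lt_of_ne' fun h => ?_
    rw [integral_eq_zero_iff_of_nonneg nonneg (integrable_mul_of_memLp_two hG hG)] at h
    obtain ⟨ω, h0, hne⟩ := (h.and (ae_momentum_ne_zero hV hβ 0)).exists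
    exact hne (by simpa using h0)
  rw [pairStarStar_gradP hV hβ]
  linarith [three_mul_integral_current_mul hV hβ]

variable (hV : IsConvexPotential V δm δp) (hβ : 0 < β)

theorem inner_wvec_riesz_gradP (hf : f ∈ centred hV hβ) (a : ℝ) :
    inner ℝ (wvec V β f a) (riesz hV hβ ⟨gradP, gradP_mem hV hβ⟩) =
      a * pairStarStar V β gradP := by
  rw [inner_wvec_riesz hV hβ hf, pairStar_gradP hV hβ hf, zero_add]

theorem riesz_gradP_ne_zero : riesz hV hβ ⟨gradP, gradP_mem hV hβ⟩ ≠ 0 := fun h => by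
  have hpair := inner_wvec_riesz_gradP hV hβ (zero_mem (centred hV hβ)) 1
  rw [h, inner_zero_right, one_mul] at hpair
  exact (pairStarStar_gradP_pos hV hβ).ne hpair

end GradP

/-! ### The generator on centred functions -/

section Generator

variable {V : ℝ → ℝ} {δm δp β γ : ℝ} {f g : Config → ℝ}

theorem opA_add (hf : SmoothLocal f) (hg : SmoothLocal g) :
    opA V (f + g) = opA V f + opA V g := by
  obtain ⟨M, hMf, hMg⟩ := exists_common_window (V := V) hf hg
  rw [opA_eq_sum hMf, opA_eq_sum hMg, opA_eq_sum (hMf.add hf hg hMg), ← Finset.sum_add_distrib]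
  refine Finset.sum_congr rfl fun k _ => ?_
  rw [Y_add hf hg, Y_add hf hg, add_sub_add_comm]

theorem opA_smul (hf : SmoothLocal f) (c : ℝ) : opA V (c • f) = c • opA V f := by
  obtain ⟨M, hM⟩ := hf.exists_isWindow (V := V)
  rw [opA_eq_sum hM, opA_eq_sum (hM.smul hf c), Finset.smul_sum]
  refine Finset.sum_congr rfl fun k _ => ?_
  rw [Y_smul hf, Y_smul hf, smul_sub]

theorem opS_add (hV : IsConvexPotential V δm δp) (hf : SmoothLocal f) (hg : SmoothLocal g) :
    opS V γ (f + g) = opS V γ f + opS V γ g := by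
  obtain ⟨M, hMf, hMg⟩ := exists_common_window (V := V) hf hg
  rw [opS_eq_sum hMf, opS_eq_sum hMg, opS_eq_sum (hMf.add hf hg hMg), ← smul_add,
    ← Finset.sum_add_distrib]
  congr 1
  refine Finset.sum_congr rfl fun k _ => ?_
  rw [Y_add hf hg, Y_add hf hg, Y_add (hf.Y hV _ _) (hg.Y hV _ _),
    Y_add (hf.Y hV _ _) (hg.Y hV _ _), add_add_add_comm]

theorem opS_smul (hV : IsConvexPotential V δm δp) (hf : SmoothLocal f) (c : ℝ) :
    opS V γ (c • f) = c • opS V γ f := by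
  obtain ⟨M, hM⟩ := hf.exists_isWindow (V := V)
  rw [opS_eq_sum hM, opS_eq_sum (hM.smul hf c), smul_comm c, Finset.smul_sum (r := c)]
  congr 1
  refine Finset.sum_congr rfl fun k _ => ?_
  rw [Y_smul hf, Y_smul hf, Y_smul (hf.Y hV _ _), Y_smul (hf.Y hV _ _), smul_add]

/-- The symmetric part of the generator as a linear map into `𝒞₀`. -/
def symmPart (hV : IsConvexPotential V δm δp) (hβ : 0 < β) (γ : ℝ) :
    centred hV hβ →ₗ[ℝ] spaceC0 V β where
  toFun f := ⟨opS V γ f, opS_mem hV hβ f.2.1 γ⟩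
  map_add' f g := Subtype.ext
    (opS_add hV (Tame.smoothLocal f.2.1) (Tame.smoothLocal g.2.1))
  map_smul' c f := Subtype.ext (opS_smul hV (Tame.smoothLocal f.2.1) c)

/-- The antisymmetric part of the generator as a linear map into `𝒞₀`. -/
def skewPart (hV : IsConvexPotential V δm δp) (hβ : 0 < β) :
    centred hV hβ →ₗ[ℝ] spaceC0 V β where
  toFun f := ⟨opA V f, opA_mem hV hβ (tame_of_mem_centred f.2)⟩
  map_add' f g := Subtype.ext (opA_add (Tame.smoothLocal f.2.1) (Tame.smoothLocal g.2.1))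
  map_smul' c f := Subtype.ext (opA_smul (Tame.smoothLocal f.2.1) c)

/-- The generator `L = S + A` as a linear map into `𝒞₀`. -/
def generator (hV : IsConvexPotential V δm δp) (hβ : 0 < β) (γ : ℝ) :
    centred hV hβ →ₗ[ℝ] spaceC0 V β :=
  symmPart hV hβ γ + skewPart hV hβ

variable (hV : IsConvexPotential V δm δp) (hβ : 0 < β)

theorem riesz_symmPart (f : centred hV hβ) :
    riesz hV hβ (symmPart hV hβ γ f) = -(γ / 2) • wvec V β f 0 := by
  have hrep : Represents V β (symmPart hV hβ γ f : Config → ℝ) _ := represents_opS hV hβ f.2.1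
  rw [riesz_eq hV hβ hrep, Submodule.starProjection_eq_self_iff]
  exact Submodule.smul_mem _ _ (wvec_mem_testSpace hV hβ f.2 0)

theorem inner_wvec_skewPart_self (f : centred hV hβ) :
    inner ℝ (wvec V β f 0) (riesz hV hβ (skewPart hV hβ f)) = 0 := by
  have hf := tame_of_mem_centred f.2
  obtain ⟨M, hM⟩ := (Tame.smoothLocal hf).exists_isWindow (V := V)
  have hrep : Represents V β (skewPart hV hβ f : Config → ℝ) _ := represents_opA hV hβ hf hM
  rw [inner_wvec_riesz_of_represents hV hβ f.2 0 hrep, inner_wvec_skewVec_self hV hβ hf hM]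

theorem norm_le_of_forall_inner_wvec_le {κ : PairL2 V β} (hκ : κ ∈ testSpace hV hβ) {C : ℝ}
    (hC : 0 ≤ C) (h : ∀ f ∈ centred hV hβ, ∀ a : ℝ, inner ℝ (wvec V β f a) κ ≤ C * ‖wvec V β f a‖) :
    ‖κ‖ ≤ C := by
  have hclosed : IsClosed {w : PairL2 V β | inner ℝ w κ ≤ C * ‖w‖} :=
    isClosed_le (by fun_prop) (by fun_prop)
  have hself : inner ℝ κ κ ≤ C * ‖κ‖ := by
    refine closure_minimal ?_ hclosed hκ
    rintro _ ⟨x, rfl⟩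
    exact h x.1 x.1.2 x.2
  rw [real_inner_self_eq_norm_mul_norm] at hself
  rcases (norm_nonneg κ).eq_or_lt with h0 | h0
  · rwa [← h0]
  · exact le_of_mul_le_mul_right hself h0

theorem norm_riesz_skewPart_le (g : centred hV hβ) :
    ‖riesz hV hβ (skewPart hV hβ g)‖ ≤ 2 / √δm * ‖wvec V β g 0‖ := by
  have hg := tame_of_mem_centred g.2
  obtain ⟨M, hM⟩ := (Tame.smoothLocal hg).exists_isWindow (V := V)
  have hrep : Represents V β (skewPart hV hβ g : Config → ℝ) _ := represents_opA hV hβ hg hM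
  refine norm_le_of_forall_inner_wvec_le hV hβ (riesz_mem hV hβ _) (by positivity)
    fun f hf a => ?_
  rw [inner_wvec_riesz_of_represents hV hβ hf a hrep, mul_right_comm, mul_assoc]
  exact (le_abs_self _).trans
    (abs_inner_wvec_skewVec_le hV hβ (tame_of_mem_centred hf) hg hM a)

theorem inner_wvec_generator_self (f : centred hV hβ) :
    inner ℝ (wvec V β f 0) (riesz hV hβ (generator hV hβ γ f)) =
      -(γ / 2) * ‖wvec V β f 0‖ ^ 2 := by
  rw [generator, LinearMap.add_apply, map_add, inner_add_right, inner_wvec_skewPart_self,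
    riesz_symmPart, inner_smul_right, real_inner_self_eq_norm_sq, add_zero]

theorem norm_riesz_generator_le (hγ : 0 < γ) (g : centred hV hβ) :
    ‖riesz hV hβ (generator hV hβ γ g)‖ ≤ (γ / 2 + 2 / √δm) * ‖wvec V β g 0‖ := by
  rw [generator, LinearMap.add_apply, map_add, add_mul]
  refine (norm_add_le _ _).trans (add_le_add ?_ (norm_riesz_skewPart_le hV hβ g))
  rw [riesz_symmPart, norm_smul, norm_neg, Real.norm_of_nonneg (half_pos hγ).le]

end Generator

/-! ### Decomposition of `ℋ₋₁` -/

section Decomposition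

variable {V : ℝ → ℝ} {δm δp β γ : ℝ} (hV : IsConvexPotential V δm δp) (hβ : 0 < β)

theorem testSpace_le (hγ : 0 < γ) {N : Submodule ℝ (PairL2 V β)}
    (hN : IsClosed (N : Set (PairL2 V β))) (hS : ∀ f, riesz hV hβ (symmPart hV hβ γ f) ∈ N)
    (hξ : riesz hV hβ ⟨gradP, gradP_mem hV hβ⟩ ∈ N) : testSpace hV hβ ≤ N := by
  let W : Submodule ℝ (PairL2 V β) :=
    LinearMap.range (wmap hV hβ ∘ₗ LinearMap.inl ℝ (centred hV hβ) ℝ)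
  have hle : testSpace hV hβ ≤ (W ⊔ Submodule.span ℝ {wvec V β 0 1}).topologicalClosure := by
    refine Submodule.topologicalClosure_mono ?_
    rintro _ ⟨⟨f, a⟩, rfl⟩
    have hsplit : ((f, a) : centred hV hβ × ℝ) =
        LinearMap.inl ℝ (centred hV hβ) ℝ f + a • (0, 1) := by simp
    rw [hsplit, map_add, map_smul]
    exact Submodule.add_mem_sup ⟨f, rfl⟩ (Submodule.smul_mem _ _
      (Submodule.mem_span_singleton_self _))
  have hWN : W ≤ N := by
    rintro _ ⟨f, rfl⟩
    have h := N.smul_mem (-(γ / 2))⁻¹ (hS f)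
    rwa [riesz_symmPart, inv_smul_smul₀ (neg_ne_zero.2 (half_pos hγ).ne')] at h
  have hWξ : riesz hV hβ ⟨gradP, gradP_mem hV hβ⟩ ∈ Wᗮ := by
    rintro _ ⟨f, rfl⟩
    exact (inner_wvec_riesz_gradP hV hβ f.2 0).trans (zero_mul _)
  exact hle.trans (topologicalClosure_sup_span_le (hle (riesz_mem hV hβ _)) hWξ
    (riesz_gradP_ne_zero hV hβ) hN hWN hξ)

theorem inner_toCompletion_eq (hγ : 0 < γ) (hB : IsSemiInner (form V β γ)) (g h : spaceC0 V β) :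
    inner ℝ (toCompletion hB g) (toCompletion hB h) =
      2 / γ * inner ℝ (riesz hV hβ g) (riesz hV hβ h) := by
  rw [inner_toCompletion, form_eq hV hβ hγ]

theorem norm_toCompletion_eq (hγ : 0 < γ) (hB : IsSemiInner (form V β γ)) (h : spaceC0 V β) :
    ‖toCompletion hB h‖ = √(2 / γ) * ‖riesz hV hβ h‖ := by
  rw [norm_eq_sqrt_real_inner, inner_toCompletion_eq hV hβ hγ, real_inner_self_eq_norm_sq,
    Real.sqrt_mul (by positivity), Real.sqrt_sq (norm_nonneg _)]

theorem toCompletion_mem_closure (hγ : 0 < γ) (hB : IsSemiInner (form V β γ))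
    {S : Set (spaceC0 V β)} {h : spaceC0 V β}
    (hh : riesz hV hβ h ∈ closure (riesz hV hβ '' S)) :
    toCompletion hB h ∈ closure (toCompletion hB '' S) := by
  have hpos : 0 < √(2 / γ) := Real.sqrt_pos.2 (by positivity)
  rw [Metric.mem_closure_iff] at hh ⊢
  intro ε hε
  obtain ⟨_, ⟨t, ht, rfl⟩, hlt⟩ := hh (ε / √(2 / γ)) (by positivity)
  refine ⟨_, ⟨t, ht, rfl⟩, ?_⟩
  rw [dist_eq_norm, ← map_sub] at hlt ⊢
  rw [norm_toCompletion_eq hV hβ hγ, mul_comm]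
  exact (lt_div_iff₀ hpos).1 hlt

theorem topologicalClosure_symmPart_sup (hγ : 0 < γ) (hB : IsSemiInner (form V β γ)) :
    (LinearMap.range (toCompletion hB ∘ₗ symmPart hV hβ γ) ⊔
      Submodule.span ℝ {toCompletion hB ⟨gradP, gradP_mem hV hβ⟩}).topologicalClosure = ⊤ := by
  let T : Submodule ℝ (spaceC0 V β) :=
    LinearMap.range (symmPart hV hβ γ) ⊔ Submodule.span ℝ {⟨gradP, gradP_mem hV hβ⟩}
  have map_T : T.map (toCompletion hB) = LinearMap.range (toCompletion hB ∘ₗ symmPart hV hβ γ) ⊔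
      Submodule.span ℝ {toCompletion hB ⟨gradP, gradP_mem hV hβ⟩} := by
    rw [Submodule.map_sup, LinearMap.range_comp, Submodule.map_span, Set.image_singleton]
  have hle : testSpace hV hβ ≤ (T.map (riesz hV hβ)).topologicalClosure :=
    testSpace_le hV hβ hγ (Submodule.isClosed_topologicalClosure _)
      (fun f => Submodule.le_topologicalClosure _
        ⟨_, Submodule.mem_sup_left (LinearMap.mem_range_self _ f), rfl⟩)
      (Submodule.le_topologicalClosure _
        ⟨_, Submodule.mem_sup_right (Submodule.mem_span_singleton_self _), rfl⟩)
  rw [← map_T, eq_top_iff]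
  refine fun x _ => closure_minimal ?_ (Submodule.isClosed_topologicalClosure _)
    (denseRange_toCompletion hB x)
  rintro _ ⟨h, rfl⟩
  exact toCompletion_mem_closure hV hβ hγ hB (S := T) (hle (riesz_mem hV hβ h))

theorem toCompletion_gradP_ne_zero (hγ : 0 < γ) (hB : IsSemiInner (form V β γ)) :
    toCompletion hB ⟨gradP, gradP_mem hV hβ⟩ ≠ 0 := by
  rw [← norm_ne_zero_iff, norm_toCompletion_eq hV hβ hγ]
  exact mul_ne_zero (Real.sqrt_pos.2 (by positivity)).ne'
    (norm_ne_zero_iff.2 (riesz_gradP_ne_zero hV hβ))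

theorem isCompl_closure_range_generator (hγ : 0 < γ) (hB : IsSemiInner (form V β γ)) :
    IsCompl (LinearMap.range (toCompletion hB ∘ₗ generator hV hβ γ)).topologicalClosure
      (Submodule.span ℝ {toCompletion hB ⟨gradP, gradP_mem hV hβ⟩}) := by
  have norm_symmPart (f : centred hV hβ) :
      ‖toCompletion hB (symmPart hV hβ γ f)‖ = √(2 / γ) * (γ / 2 * ‖wvec V β f 0‖) := by
    rw [norm_toCompletion_eq hV hβ hγ, riesz_symmPart, norm_smul, norm_neg,
      Real.norm_of_nonneg (half_pos hγ).le]
  have orthogonal : toCompletion hB ⟨gradP, gradP_mem hV hβ⟩ ∈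
      (LinearMap.range (toCompletion hB ∘ₗ symmPart hV hβ γ))ᗮ := by
    rintro _ ⟨f, rfl⟩
    rw [LinearMap.comp_apply, inner_toCompletion_eq hV hβ hγ, riesz_symmPart,
      real_inner_smul_left, inner_wvec_riesz_gradP hV hβ f.2, zero_mul, mul_zero, mul_zero]
  refine isCompl_closure_range (C := (γ / 2 + 2 / √δm) * (2 / γ))
    (toCompletion_gradP_ne_zero hV hβ hγ hB) orthogonal
    (topologicalClosure_symmPart_sup hV hβ hγ hB) (fun f => ?_) (by positivity) fun f => ?_
  · rw [LinearMap.comp_apply, LinearMap.comp_apply, norm_symmPart, inner_toCompletion_eq hV hβ hγ,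
      riesz_symmPart, real_inner_smul_left, inner_wvec_generator_self, mul_pow,
      Real.sq_sqrt (by positivity)]
    ring
  · rw [LinearMap.comp_apply, LinearMap.comp_apply, norm_symmPart, norm_toCompletion_eq hV hβ hγ]
    refine (mul_le_mul_of_nonneg_left (norm_riesz_generator_le hV hβ hγ f)
      (Real.sqrt_nonneg _)).trans (le_of_eq ?_)
    field_simp

theorem riesz_generator_mem_closure (hγ : 0 < γ) (f : centred hV hβ) :
    riesz hV hβ (generator hV hβ γ f) ∈
      closure (riesz hV hβ '' {h | ∃ g ∈ spaceC V β, (h : Config → ℝ) = opL V γ g}) := by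
  obtain ⟨g, hg, hlim⟩ := exists_seq_spaceC hV hβ f.2
  let g' (n : ℕ) : centred hV hβ := ⟨g n, mem_centred_of_mem_spaceC hV hβ (hg n)⟩
  have diff_tendsto :
      Tendsto (fun n => riesz hV hβ (generator hV hβ γ (f - g' n))) atTop (𝓝 0) := by
    refine squeeze_zero_norm (fun n => norm_riesz_generator_le hV hβ hγ _) ?_
    simpa using! hlim.norm.const_mul (γ / 2 + 2 / √δm)
  refine mem_closure_of_tendsto (b := atTop)
    (f := fun n => riesz hV hβ (generator hV hβ γ (g' n))) ?_
    (.of_forall fun n => ⟨_, ⟨g n, hg n, rfl⟩, rfl⟩)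
  simpa using (tendsto_const_nhds (x := riesz hV hβ (generator hV hβ γ f))).sub diff_tendsto

theorem closure_imageLC (hγ : 0 < γ) (hB : IsSemiInner (form V β γ)) :
    closure (imageLC V β γ hB) =
    ((LinearMap.range (toCompletion hB ∘ₗ generator hV hβ γ)).topologicalClosure :
      Set (HMinusOne V β γ hB)) := by
  refine subset_antisymm (closure_mono ?_) (closure_minimal ?_ isClosed_closure)
  · rintro _ ⟨g, hg, h, hh, rfl⟩
    exact ⟨⟨g, mem_centred_of_mem_spaceC hV hβ hg⟩,
      congrArg (toCompletion hB) (Subtype.ext hh.symm)⟩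
  · rintro _ ⟨f, rfl⟩
    refine closure_mono ?_ (toCompletion_mem_closure hV hβ hγ hB
      (riesz_generator_mem_closure hV hβ hγ f))
    rintro _ ⟨h, ⟨g, hg, hh⟩, rfl⟩
    exact ⟨g, hg, h, hh, rfl⟩

end Decomposition

end EnergyChain

end

open EnergyChain in
theorem mainTheorem8_general (V : ℝ → ℝ) (δm δp : ℝ) (hV : IsConvexPotential V δm δp)
    (β γ : ℝ) (hβ : 0 < β) (hγ : 0 < γ) :
    (∀ g ∈ spaceC V β, opL V γ g ∈ spaceC0 V β) ∧
    (∀ h ∈ spaceC0 V β, BddAbove (variationalSet V β γ h)) ∧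
    ∃ (hξ : gradP ∈ spaceC0 V β) (hB : IsSemiInner (form V β γ)),
      (∀ h : spaceC0 V β, ‖toCompletion hB h‖ ^ 2 = normSq V β γ h) ∧
      (∃ M : Submodule ℝ (HMinusOne V β γ hB),
        (M : Set (HMinusOne V β γ hB)) = closure (imageLC V β γ hB) ∧
        IsCompl M (Submodule.span ℝ {toCompletion hB ⟨gradP, hξ⟩})) ∧
      ∀ g : spaceC0 V β, ∃! a : ℝ,
        toCompletion hB (g + a • (⟨gradP, hξ⟩ : spaceC0 V β)) ∈ closure (imageLC V β γ hB) := by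
  have hB := isSemiInner_form hV hβ hγ
  have hcompl := isCompl_closure_range_generator hV hβ hγ hB
  refine ⟨fun g hg => opL_mem hV hβ (mem_centred_of_mem_spaceC hV hβ hg).1 γ,
    fun h hh => (isLUB_variationalSet hV hβ hγ ⟨h, hh⟩).bddAbove, gradP_mem hV hβ, hB, fun h => ?_,
    ⟨_, (closure_imageLC hV hβ hγ hB).symm, hcompl⟩, fun g => ?_⟩
  · rw [norm_sq_toCompletion, form_eq hV hβ hγ, normSq_eq hV hβ hγ, real_inner_self_eq_norm_sq]
  · simp only [map_add, map_smul]
    rw [closure_imageLC hV hβ hγ hB]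
    exact existsUnique_add_smul_mem hcompl (toCompletion_gradP_ne_zero hV hβ hγ hB)
      (toCompletion hB g)

open EnergyChain in
theorem mainTheorem8 (V : ℝ → ℝ) (δm δp : ℝ) (hV : IsAdmissible V δm δp)
    (β γ : ℝ) (hβ : 0 < β) (hγ : 0 < γ) :
    -- `L𝒞` and `p_1² - p_0²` lie in `𝒞₀`, and the semi-norm is finite on `𝒞₀`
    (∀ g ∈ spaceC V β, opL V γ g ∈ spaceC0 V β) ∧
    (∀ h ∈ spaceC0 V β, BddAbove (variationalSet V β γ h)) ∧
    ∃ (hξ : gradP ∈ spaceC0 V β) (hB : IsSemiInner (form V β γ)),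
      -- the form induces the semi-norm given by the variational formula
      (∀ h : spaceC0 V β, ‖toCompletion hB h‖ ^ 2 = normSq V β γ h) ∧
      -- direct sum decomposition of `ℋ₋₁`
      (∃ M : Submodule ℝ (HMinusOne V β γ hB),
        (M : Set (HMinusOne V β γ hB)) = closure (imageLC V β γ hB) ∧
        IsCompl M (Submodule.span ℝ {toCompletion hB ⟨gradP, hξ⟩})) ∧
      -- every element of `𝒞₀`
      ∀ g : spaceC0 V β, ∃! a : ℝ,
        toCompletion hB (g + a • (⟨gradP, hξ⟩ : spaceC0 V β)) ∈ closure (imageLC V β γ hB) :=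
  mainTheorem8_general V δm δp hV.isConvexPotential β γ hβ hγ
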